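/- Let $R$ be a two-dimensional regular domain, that is, a Noetherian integral domain of Krull dimension $2$ all of whose localizations at prime ideals are regular local rings (for instance, a two-dimensional regular local ring), and let $K$ be its field of fractions. For an ideal $I$ of $R$, the adjoint of $I$ is $$\operatorname{adj}(I)=\bigcap_{v}\,\{r\in R \mid v(r)\ge v(I)-v(J_{R_v/R})\},$$ where $v$ runs over the normalized valuations of $K$ that are non-negative on $R$ and whose valuation ring $R_v$ is a localization of a finitely generated $R$-algebra; here $v(I)=\min\{v(a)\mid a\in I\}$ (with $v(0)=\infty$), and the Jacobian ideal $J_{R_v/R}$ is the zeroth Fitting ideal of the module of Kähler differentials $\Omega_{R_v/R}$. Then $$\operatorname{adj}(IJ)\subseteq \operatorname{adj}(I)\,\operatorname{adj}(J)$$ for all ideals $I$ and $J$ of $R$. -/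

import Mathlib

noncomputable section

namespace AdjointIdeals

/-- The zeroth Fitting ideal of a (finitely generated) `A`-module `M`: the ideal generated by the
determinants of the square matrices whose rows are relations among a finite generating family of
`M`. All finite generating families give the same ideal, so we may let the family vary. -/
def fittingIdealZero (A : Type*) [CommRing A] (M : Type*) [AddCommGroup M] [Module A M] :
    Ideal A :=
  Ideal.span {d : A | ∃ (n : ℕ) (g : Fin n → M) (P : Matrix (Fin n) (Fin n) A),
    Submodule.span A (Set.range g) = ⊤ ∧ (∀ i, ∑ j, P i j • g j = 0) ∧ d = P.det}

/-- The Jacobian ideal `J_{S/R}` of an `R`-algebra `S` (essentially of finite type): the zeroth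
Fitting ideal of the module of Kähler differentials of `S` over `R`. -/
def jacobianIdeal (R S : Type*) [CommRing R] [CommRing S] [Algebra R S] : Ideal S :=
  fittingIdealZero S (KaehlerDifferential R S)

/-- The normalized order of an ideal `𝔞` of a local ring `V`: the largest `n` such that `𝔞` lies
in the `n`-th power of the maximal ideal, and `⊤` if there is no largest one.
If `V` is a discrete valuation ring with normalized valuation `v`, this is
`v(𝔞) = min {v(a) | a ∈ 𝔞}`, with `v(0) = ⊤`; if `V` is a field, it is the trivial valuation. -/
def order (V : Type*) [CommRing V] [IsLocalRing V] (𝔞 : Ideal V) : ℕ∞ :=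
  ⨆ (n : ℕ) (_ : 𝔞 ≤ IsLocalRing.maximalIdeal V ^ n), (n : ℕ∞)

theorem natCast_le_order_iff {V : Type*} [CommRing V] [IsLocalRing V] {𝔞 : Ideal V} {n : ℕ} :
    (n : ℕ∞) ≤ order V 𝔞 ↔ 𝔞 ≤ IsLocalRing.maximalIdeal V ^ n := by
  refine ⟨fun h => ?_, fun h => le_iSup₂_of_le n h le_rfl⟩
  rcases n with _ | n
  · simp
  · have h1 : (n : ℕ∞) < order V 𝔞 := lt_of_lt_of_le (by exact_mod_cast Nat.lt_succ_self n) h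
    obtain ⟨k, hk⟩ := lt_iSup_iff.1 h1
    obtain ⟨hk1, hk2⟩ := lt_iSup_iff.1 hk
    exact hk1.trans (Ideal.pow_le_pow_right (by exact_mod_cast hk2))

theorem order_anti {V : Type*} [CommRing V] [IsLocalRing V] {𝔞 𝔟 : Ideal V} (h : 𝔞 ≤ 𝔟) :
    order V 𝔟 ≤ order V 𝔞 :=
  iSup₂_le fun _ hn => natCast_le_order_iff.2 (h.trans hn)

theorem min_order_le_order_sup {V : Type*} [CommRing V] [IsLocalRing V] (𝔞 𝔟 : Ideal V) :
    min (order V 𝔞) (order V 𝔟) ≤ order V (𝔞 ⊔ 𝔟) :=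
  ENat.forall_natCast_le_iff_le.1 fun _ hn => natCast_le_order_iff.2
    (sup_le (natCast_le_order_iff.1 (hn.trans (min_le_left _ _)))
      (natCast_le_order_iff.1 (hn.trans (min_le_right _ _))))

/-- For an `R`-algebra `V` that is a local ring with normalized order `v`, the ideal
`{r ∈ R | v(r) ≥ v(I) - v(J_{V/R})}` of `R`, with the inequality written without subtraction as
`v(I) ≤ v(r) + v(J_{V/R})`. -/
def valuativeIdeal {R : Type*} [CommRing R] (V : Type*) [CommRing V] [IsLocalRing V]
    [Algebra R V] (I : Ideal R) : Ideal R where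
  carrier := {r | order V (I.map (algebraMap R V)) ≤
    order V (Ideal.span {algebraMap R V r}) + order V (jacobianIdeal R V)}
  zero_mem' := by
    have h : order V (Ideal.span {algebraMap R V 0}) = ⊤ :=
      top_unique (ENat.forall_natCast_le_iff_le.1 fun n _ => natCast_le_order_iff.2 (by simp))
    simp only [Set.mem_ofPred_eq, h, top_add, le_top]
  add_mem' := by
    intro a b ha hb
    simp only [Set.mem_ofPred_eq] at ha hb ⊢
    have h1 : Ideal.span {algebraMap R V (a + b)} ≤
        Ideal.span {algebraMap R V a} ⊔ Ideal.span {algebraMap R V b} := by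
      rw [Ideal.span_singleton_le_iff_mem, map_add]
      exact Submodule.add_mem_sup (Ideal.mem_span_singleton_self _)
        (Ideal.mem_span_singleton_self _)
    have h2 := (min_order_le_order_sup (Ideal.span {algebraMap R V a})
      (Ideal.span {algebraMap R V b})).trans (order_anti h1)
    rcases min_le_iff.1 h2 with h | h
    · exact ha.trans (add_le_add_left h _)
    · exact hb.trans (add_le_add_left h _)
  smul_mem' := by
    intro c a ha
    simp only [Set.mem_ofPred_eq] at ha ⊢
    refine ha.trans (add_le_add_left (order_anti ?_) _)
    rw [Ideal.span_singleton_le_iff_mem, smul_eq_mul, map_mul]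
    exact Ideal.mul_mem_left _ _ (Ideal.mem_span_singleton_self _)

/-- The adjoint of an ideal `I` of a regular domain `R` with field of fractions `K`. The
intersection runs over the valuation rings `V` with `R ⊆ V ⊆ K` that are localizations of
finitely generated `R`-algebras. -/
def adj {R : Type*} [CommRing R] (K : Type*) [Field K] [Algebra R K] (I : Ideal R) : Ideal R :=
  ⨅ (V : Subalgebra R K) (_ : ValuationRing V) (_ : Algebra.EssFiniteType R V),
    valuativeIdeal V I

end AdjointIdeals

end

/-! The inclusion is local on `R`, and near a maximal ideal `n` something stronger holds: `adj(IJ)`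
lies in `I·adj(J) + J·adj(I)`. If the maximal ideal of the localization is principal, the
localization is itself one of the valuation rings in the intersection, with unit Jacobian, so
`adj(IJ)` is `IJ` there. Otherwise the localization `B` is a factorial ring with maximal ideal `m =
(x, y)`. Splitting off greatest common divisors of generators reduces to ideals `I`, `J` containing
a power of `m`.

Encode generators of `I` and `J` as coefficients of polynomials `f` and `g`, put in separate
variables: `α = f(T₀)`, `β = g(T₁)`. These are coprime in `B[T₀,T₁]` even if `I = J`. For `r` in
`adj(IJ)` one looks for `h r = α s + β t` where `h` has a unit coefficient, the coefficients of `s`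
lie in `adj(J)` and those of `t` in `adj(I)`. Comparing one coefficient then gives the claim.

Such a solution is built by induction on the length of `B/I`, by blowing up `m`
(`exists_sol_of_chainLE`). If `f`, `g` have orders `p`, `q`, the order valuation shows that `r` has
order at least `p + q - 1`: the Jacobian accounts for the one. At each infinitely near point of the
chart `B[z]`, `z = y/x`, the data `x⁻ᵖf`, `x⁻ᑫg` and `x` to the power `-(p+q-1)` times `r` satisfy
the same hypotheses, with a shorter coefficient ideal (`chainLE_transform`), so solutions exist
there. They patch to each whole chart, with `h` still over `B` (`exists_unit_coeff_of_chart`), by a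
count of heights and transcendence degrees. The two charts are glued in `exists_glue`: the solutions
differ by a Koszul relation, and `B[z,z⁻¹] = B[z] + z⁻¹B[z⁻¹]` lets the difference be distributed.

The glued `s`, `t` have the right orders. They also satisfy the adjoint conditions (`isAdj_of_eq`),
because at an infinitely near point they differ from the inductive solution, up to factors `h`, by
multiples of the transforms of `β` and `α`, and Gauss' lemma applies. All of this rests on `J_{V/B}
= x J_{V/B[z]}` for a valuation ring `V` dominating `B` and containing `z`. The inclusion `⊇` is
formal; `⊆` (`relJac_le_span_mul`) says that the differential `dz` has no annihilator outside `(x)`,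
which is detected by a derivation `V → K/V` vanishing on `B` with `dz = 1/x`. This derivation is
extended through successive quadratic transforms up to `V`, since `K/V` is divisible. -/

section

open IsLocalRing

namespace AdjointIdeals

/-! ### Two-dimensional regular local rings through a pair of parameters. -/

/-- A pair of elements of a local ring exhibiting it as a regular local ring of dimension two. -/
structure RegPair {A : Type*} [CommRing A] [IsLocalRing A] (x y : A) : Prop where
  max : maximalIdeal A = Ideal.span {x, y}
  prime : Prime x
  not_dvd : ¬ x ∣ y

section RegPair

variable {A : Type*} [CommRing A] [IsLocalRing A] [IsNoetherianRing A] {x y : A}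

/-- Modulo `x` the maximal ideal is generated by `y`. By Krull's intersection theorem some power of
`y` is the last one dividing the class of `b`, and the cofactor is then a unit. -/
theorem exists_unit_mul_pow_add (h : maximalIdeal A = Ideal.span {x, y}) {b : A}
    (hb : ¬ x ∣ b) : ∃ (k : ℕ) (u c : A), IsUnit u ∧ b = u * y ^ k + x * c := by
  have hy : y ∈ maximalIdeal A := by rw [h]; exact Ideal.subset_span (by simp)
  have hne : Ideal.span {y} ≠ ⊤ := fun e =>
    (Ideal.ne_top_iff_one _).1 (Ideal.IsPrime.ne_top (I := maximalIdeal A) inferInstance)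
      ((Ideal.span_le.2 (by simpa using hy)) (e ▸ Submodule.mem_top : (1 : A) ∈ Ideal.span {y}))
  have key := Ideal.iInf_pow_smul_eq_bot_of_isLocalRing (M := A ⧸ Ideal.span {x})
    (Ideal.span {y}) hne
  have hmem : ∀ i, (Ideal.Quotient.mk (Ideal.span {x}) b ∈
      (Ideal.span {y} ^ i • ⊤ : Submodule A (A ⧸ Ideal.span {x}))) ↔
      ∃ d c, b = y ^ i * d + x * c := by
    intro i
    rw [Ideal.span_singleton_pow, Submodule.ideal_span_singleton_smul,
      Submodule.mem_smul_pointwise_iff_exists]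
    constructor
    · rintro ⟨d, -, hd⟩
      obtain ⟨d, rfl⟩ := Ideal.Quotient.mk_surjective d
      have h1 : Ideal.Quotient.mk (Ideal.span {x}) (y ^ i * d) =
        Ideal.Quotient.mk (Ideal.span {x}) b := hd
      obtain ⟨c, hc⟩ := Ideal.mem_span_singleton.1 ((Ideal.Quotient.eq).1 h1.symm)
      exact ⟨d, c, by rw [← hc]; ring⟩
    · rintro ⟨d, c, hb⟩
      refine ⟨Ideal.Quotient.mk _ d, trivial, ?_⟩
      change Ideal.Quotient.mk (Ideal.span {x}) (y ^ i * d) = _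
      refine (Ideal.Quotient.eq).2 (Ideal.mem_span_singleton.2 ⟨-c, ?_⟩)
      rw [hb]; ring
  have hex : ∃ i, ¬ ∃ d c, b = y ^ i * d + x * c := by
    by_contra hcon
    push Not at hcon
    have : Ideal.Quotient.mk (Ideal.span {x}) b ∈ (⊥ : Submodule A (A ⧸ Ideal.span {x})) := by
      rw [← key, Submodule.mem_iInf]
      exact fun i => (hmem i).2 (hcon i)
    rw [Submodule.mem_bot, Ideal.Quotient.eq_zero_iff_mem, Ideal.mem_span_singleton] at this
    exact hb this
  classical
  have hspec := Nat.find_spec hex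
  rcases hk : Nat.find hex with _ | k
  · rw [hk] at hspec
    exact absurd ⟨b, 0, by simp⟩ hspec
  rw [hk] at hspec
  obtain ⟨d, c, hdc⟩ := not_not.1 (Nat.find_min hex (m := k) (by omega))
  refine ⟨k, d, c, ?_, by rw [hdc]; ring⟩
  by_contra hd
  have hd' : d ∈ maximalIdeal A := (mem_maximalIdeal _).2 hd
  rw [h, Ideal.mem_span_pair] at hd'
  obtain ⟨p, q, hpq⟩ := hd'
  exact hspec ⟨q, c + y ^ k * p, by rw [hdc, ← hpq]; ring⟩

/-- Modulo `x` every nonzero element is a unit times a power of `y`, so only products of powers of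
`y` have to be tested. -/
theorem prime_of_not_dvd_pow (h : maximalIdeal A = Ideal.span {x, y}) (hx : x ≠ 0)
    (hp : ∀ N, ¬ x ∣ y ^ N) : Prime x := by
  have hx' : x ∈ maximalIdeal A := by rw [h]; exact Ideal.subset_span (by simp)
  refine ⟨hx, (mem_maximalIdeal _).1 hx', fun a b hab => ?_⟩
  by_contra hcon
  push Not at hcon
  obtain ⟨k, u, c, hu, rfl⟩ := exists_unit_mul_pow_add h hcon.1
  obtain ⟨l, v, d, hv, rfl⟩ := exists_unit_mul_pow_add h hcon.2
  refine hp (k + l) ((hu.mul hv).dvd_mul_left.1 ?_)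
  have : (u * y ^ k + x * c) * (v * y ^ l + x * d) =
      u * v * y ^ (k + l) + x * (c * (v * y ^ l + x * d) + u * y ^ k * d) := by ring
  rw [this] at hab
  exact (dvd_add_left (dvd_mul_right _ _)).1 hab

omit [IsNoetherianRing A] in
theorem RegPair.not_dvd_pow (h : RegPair x y) (N : ℕ) : ¬ x ∣ y ^ N := fun hd =>
  h.not_dvd (h.prime.dvd_of_dvd_pow hd)

/-- In an equation `y c = x ^ (N + 1)` the prime `x` divides `c`, so a factor `x` cancels;
descending to `N = 0` would make `y` a unit. Hence `prime_of_not_dvd_pow` applies with the roles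
exchanged. -/
theorem RegPair.symm [IsDomain A] (h : RegPair x y) : RegPair y x := by
  have hmax : maximalIdeal A = Ideal.span {y, x} := by rw [h.max, Set.pair_comm]
  have hy0 : y ≠ 0 := fun e => h.not_dvd (e ▸ dvd_zero _)
  have hpow : ∀ N, ¬ y ∣ x ^ N := by
    intro N
    induction N with
    | zero =>
      intro hd
      have : y ∈ maximalIdeal A := by rw [h.max]; exact Ideal.subset_span (by simp)
      exact (mem_maximalIdeal _).1 this (isUnit_of_dvd_one (by simpa using hd))
    | succ N ih =>
      rintro ⟨c, hc⟩
      have h1 : x ∣ y * c := ⟨x ^ N, by rw [← hc]; ring⟩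
      obtain ⟨c', rfl⟩ := (h.prime.dvd_or_dvd h1).resolve_left h.not_dvd
      exact ih ⟨c', mul_left_cancel₀ h.prime.ne_zero (by rw [← pow_succ', hc]; ring)⟩
  exact ⟨hmax, prime_of_not_dvd_pow hmax hy0 hpow, by simpa using hpow 1⟩

omit [IsNoetherianRing A] in
theorem RegPair.left_mem (h : RegPair x y) : x ∈ maximalIdeal A := by
  rw [h.max]; exact Ideal.subset_span (by simp)

omit [IsNoetherianRing A] in
theorem RegPair.right_mem (h : RegPair x y) : y ∈ maximalIdeal A := by
  rw [h.max]; exact Ideal.subset_span (by simp)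

/-- Choose `π` in `P` whose class modulo `x` has the least order in `y`. Subtracting multiples of
`π` from an element of `P` leaves a multiple of `x`, which lies in `xP` because `x ∉ P`. Nakayama's
lemma then gives `P = (π)`. -/
theorem RegPair.exists_span_eq [IsDomain A] (h : RegPair x y) {P : Ideal A} (hP : P.IsPrime)
    (hP0 : P ≠ ⊥) (hx : x ∉ P) : ∃ π, Prime π ∧ P = Ideal.span {π} := by
  classical
  have hfg : P.FG := IsNoetherian.noetherian P
  have hjac : maximalIdeal A ≤ Ideal.jacobson ⊥ := (IsLocalRing.jacobson_eq_maximalIdeal _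
    bot_ne_top).ge
  have hxP : ∀ b, x * b ∈ P → b ∈ P := fun b hb => (hP.mem_or_mem hb).resolve_left hx
  have hex : ∃ k, ∃ π ∈ P, ∃ u c, IsUnit u ∧ π = u * y ^ k + x * c := by
    by_contra hcon
    push Not at hcon
    refine hP0 (Submodule.eq_bot_of_le_smul_of_le_jacobson_bot (maximalIdeal A) P hfg ?_ hjac)
    intro b hb
    by_cases hxb : x ∣ b
    · obtain ⟨c, rfl⟩ := hxb
      exact Submodule.smul_mem_smul h.left_mem (hxP c hb)
    · obtain ⟨k, u, c, hu, e⟩ := exists_unit_mul_pow_add h.max hxb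
      exact absurd e (hcon k b hb u c hu)
  obtain ⟨π, hπ, u, c, hu, e⟩ := Nat.find_spec hex
  have hle : P ≤ Ideal.span {π} := by
    refine Submodule.le_of_le_smul_of_le_jacobson_bot hfg hjac ?_
    intro b hb
    by_cases hxb : x ∣ b
    · obtain ⟨c, rfl⟩ := hxb
      exact Submodule.mem_sup_right (Submodule.smul_mem_smul h.left_mem (hxP c hb))
    · obtain ⟨l, v, d, hv, e'⟩ := exists_unit_mul_pow_add h.max hxb
      have hl : Nat.find hex ≤ l := Nat.find_min' hex ⟨b, hb, v, d, hv, e'⟩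
      obtain ⟨w, hw⟩ := hu.exists_left_inv
      have e2 : b = v * w * y ^ (l - Nat.find hex) * π +
          x * (d - v * w * y ^ (l - Nat.find hex) * c) := by
        have : v * w * y ^ (l - Nat.find hex) * π = v * (w * u) *
            (y ^ (l - Nat.find hex) * y ^ (Nat.find hex)) +
            x * (v * w * y ^ (l - Nat.find hex) * c) := by
          conv_lhs => rw [e]
          ring
        rw [this, ← pow_add, Nat.sub_add_cancel hl, hw, e']
        ring
      have h3 : x * (d - v * w * y ^ (l - Nat.find hex) * c) ∈ P := by
        have : x * (d - v * w * y ^ (l - Nat.find hex) * c) =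
          b - v * w * y ^ (l - Nat.find hex) * π := by rw [eq_sub_iff_add_eq, add_comm]; exact e2.symm
        rw [this]
        exact P.sub_mem hb (P.mul_mem_left _ hπ)
      rw [e2]
      exact Submodule.add_mem_sup (Ideal.mul_mem_left _ _ (Ideal.mem_span_singleton_self _))
        (Submodule.smul_mem_smul h.left_mem (hxP _ h3))
  have heq : P = Ideal.span {π} := le_antisymm hle ((Ideal.span_singleton_le_iff_mem _).2 hπ)
  have hπ0 : π ≠ 0 := by
    rintro rfl
    exact hP0 (by rw [heq]; simp)
  exact ⟨π, (Ideal.span_singleton_prime hπ0).1 (heq ▸ hP), heq⟩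

/-- Kaplansky's criterion: every nonzero prime ideal contains a prime element, namely `x` or a
generator. -/
theorem RegPair.uniqueFactorizationMonoid [IsDomain A] (h : RegPair x y) :
    UniqueFactorizationMonoid A := by
  refine UniqueFactorizationMonoid.iff_exists_prime_mem_of_isPrime.2 fun P hP0 hP => ?_
  by_cases hx : x ∈ P
  · exact ⟨x, hx, h.prime⟩
  · obtain ⟨π, hπ, e⟩ := h.exists_span_eq hP hP0 hx
    exact ⟨π, e ▸ Ideal.mem_span_singleton_self _, hπ⟩

/-- A prime over `I` that misses `x` or `y` would be principal, and its generator a forbidden common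
divisor. So all primes over `I` contain both `x` and `y`. -/
theorem RegPair.exists_pow_le_of_forall_le_span [IsDomain A] (h : RegPair x y) {I : Ideal A}
    (hI : ∀ c, I ≤ Ideal.span {c} → IsUnit c) : ∃ N, maximalIdeal A ^ N ≤ I := by
  have hm : maximalIdeal A ≤ I.radical := by
    rw [Ideal.radical_eq_sInf]
    refine le_sInf ?_
    rintro P ⟨hIP, hP⟩
    have hP0 : P ≠ ⊥ := by
      rintro rfl
      exact not_isUnit_zero (hI 0 (hIP.trans bot_le))
    have aux : ∀ π, Prime π → P ≠ Ideal.span {π} := fun π hπ e => hπ.not_isUnit (hI π (e ▸ hIP))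
    rw [h.max, Ideal.span_le]
    rintro z (rfl | rfl)
    · by_contra hz
      obtain ⟨π, hπ, e⟩ := h.exists_span_eq hP hP0 hz
      exact aux π hπ e
    · by_contra hz
      obtain ⟨π, hπ, e⟩ := h.symm.exists_span_eq hP hP0 hz
      exact aux π hπ e
  exact Ideal.exists_pow_le_of_le_radical_of_fg hm (IsNoetherian.noetherian _)

theorem RegPair.exists_pow_le_of_mem (h : RegPair x y) {I : Ideal A} {M : ℕ} (hM : x ^ M ∈ I)
    {w : A} (hw : w ∈ I) (hxw : ¬ x ∣ w) : ∃ N, maximalIdeal A ^ N ≤ I := by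
  have hxr : x ∈ I.radical := ⟨M, hM⟩
  have hm : maximalIdeal A ≤ I.radical := by
    rw [h.max, Ideal.span_le]
    rintro z (rfl | rfl)
    · exact hxr
    · obtain ⟨k, u, c, hu, e⟩ := exists_unit_mul_pow_add h.max hxw
      obtain ⟨v, hv⟩ := hu.exists_left_inv
      have : z ^ k = v * (w - x * c) := by
        rw [e]; linear_combination (-z ^ k) * hv
      refine I.radical_isRadical ⟨k, ?_⟩
      rw [this]
      exact Ideal.mul_mem_left _ _ (sub_mem (Ideal.le_radical hw) (Ideal.mul_mem_right _ _ hxr))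
  exact Ideal.exists_pow_le_of_le_radical_of_fg hm (IsNoetherian.noetherian _)

omit [IsNoetherianRing A] in
-- A divisor of `x ^ N` is associated to a power of `x`, and only the zeroth power can divide `y ^
-- N`.
theorem RegPair.isUnit_of_pow_le_span [IsDomain A] (h : RegPair x y) {N : ℕ}
    {c : A} (hc : maximalIdeal A ^ N ≤ Ideal.span {c}) : IsUnit c := by
  have hxc : c ∣ x ^ N := Ideal.mem_span_singleton.1 (hc (Ideal.pow_mem_pow h.left_mem _))
  have hyc : c ∣ y ^ N := Ideal.mem_span_singleton.1 (hc (Ideal.pow_mem_pow h.right_mem _))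
  obtain ⟨i, -, hi⟩ := (dvd_prime_pow h.prime _).1 hxc
  rcases i with _ | i
  · exact associated_one_iff_isUnit.1 (by simpa using hi)
  · exact absurd ((dvd_pow_self x i.succ_ne_zero).trans (hi.symm.dvd.trans hyc))
      (h.not_dvd_pow N)

end RegPair

end AdjointIdeals

end

/-! ### Localizations inside the fraction field and the blow-up charts `B[y/x]`. -/

section

open IsLocalRing Polynomial

namespace AdjointIdeals

variable {K : Type*} [Field K]

section General

theorem isFractionRing_of_le {A A' : Subring K} [IsFractionRing A K] (h : A ≤ A') :
    IsFractionRing A' K := by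
  refine IsFractionRing.of_field _ _ fun z => ?_
  obtain ⟨a, b, -, e⟩ := IsFractionRing.div_surjective A z
  exact ⟨⟨a, h a.2⟩, ⟨b, h b.2⟩, e.symm⟩

/-- The localization of a subring of a field at a prime ideal, as a subring of the field. -/
def locSub (A : Subring K) (n : Ideal A) [hn : n.IsPrime] : Subring K where
  carrier := {f | ∃ g h : A, h ∉ n ∧ f = g / h}
  zero_mem' := ⟨0, 1, fun h => hn.ne_top ((Ideal.eq_top_iff_one _).2 h), by simp⟩
  one_mem' := ⟨1, 1, fun h => hn.ne_top ((Ideal.eq_top_iff_one _).2 h), by simp⟩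
  add_mem' := by
    rintro _ _ ⟨g, h, hh, rfl⟩ ⟨g', h', hh', rfl⟩
    have h0 : (h : K) ≠ 0 := fun e => hh (by rw [show h = 0 from Subtype.ext e]; exact n.zero_mem)
    have h0' : (h' : K) ≠ 0 :=
      fun e => hh' (by rw [show h' = 0 from Subtype.ext e]; exact n.zero_mem)
    exact ⟨g * h' + h * g', h * h', fun e => (hn.mem_or_mem e).elim hh hh', by
      push_cast; field_simp⟩
  mul_mem' := by
    rintro _ _ ⟨g, h, hh, rfl⟩ ⟨g', h', hh', rfl⟩
    exact ⟨g * g', h * h', fun e => (hn.mem_or_mem e).elim hh hh', by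
      push_cast; rw [div_mul_div_comm]⟩
  neg_mem' := by
    rintro _ ⟨g, h, hh, rfl⟩
    exact ⟨-g, h, hh, by push_cast; rw [neg_div]⟩

variable (A : Subring K) (n : Ideal A) [hn : n.IsPrime]

theorem le_locSub : A ≤ locSub A n := fun a ha =>
  ⟨⟨a, ha⟩, 1, fun h => hn.ne_top ((Ideal.eq_top_iff_one _).2 h), by simp⟩

instance : Algebra A (locSub A n) := (Subring.inclusion (le_locSub A n)).toAlgebra

@[simp] theorem coe_algebraMap_locSub (a : A) : ((algebraMap A (locSub A n) a : locSub A n) : K) = a :=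
  rfl

theorem algebraMap_locSub_injective : Function.Injective (algebraMap A (locSub A n)) :=
  Subring.inclusion_injective (le_locSub A n)

variable {A n} in
omit hn in
theorem ne_zero_of_notMem {a : A} (ha : a ∉ n) : (a : K) ≠ 0 := fun e =>
  ha (by rw [show a = 0 from Subtype.ext e]; exact n.zero_mem)

variable {A n} in
theorem inv_mem_locSub {a : A} (ha : a ∉ n) : (a : K)⁻¹ ∈ locSub A n := ⟨1, a, ha, by simp⟩

instance : IsLocalization.AtPrime (locSub A n) n where
  map_units := by
    rintro ⟨a, ha⟩
    refine IsUnit.of_mul_eq_one ⟨(a : K)⁻¹, inv_mem_locSub ha⟩ (Subtype.ext ?_)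
    exact mul_inv_cancel₀ (ne_zero_of_notMem (n := n) (a := a) ha)
  surj := by
    rintro ⟨_, g, h, hh, rfl⟩
    exact ⟨(g, ⟨h, hh⟩), Subtype.ext (div_mul_cancel₀ _ (ne_zero_of_notMem hh))⟩
  exists_of_eq := by
    intro a b e
    exact ⟨1, by rw [algebraMap_locSub_injective A n e]⟩

instance : IsLocalRing (locSub A n) := IsLocalization.AtPrime.isLocalRing _ n

instance [IsNoetherianRing A] : IsNoetherianRing (locSub A n) :=
  IsLocalization.isNoetherianRing n.primeCompl _ inferInstance

instance [IsFractionRing A K] : IsFractionRing (locSub A n) K :=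
  isFractionRing_of_le (le_locSub A n)

theorem maximalIdeal_locSub : maximalIdeal (locSub A n) = n.map (algebraMap A (locSub A n)) :=
  (IsLocalization.AtPrime.map_eq_maximalIdeal n _).symm

theorem algebraMap_mem_maximalIdeal_locSub {a : A} :
    algebraMap A (locSub A n) a ∈ maximalIdeal (locSub A n) ↔ a ∈ n :=
  IsLocalization.AtPrime.to_map_mem_maximal_iff _ n a

theorem prime_algebraMap_locSub {a : A} (ha : Prime a) (han : a ∈ n) :
    Prime (algebraMap A (locSub A n) a) := by
  have h1 : (Ideal.span {a}).IsPrime := (Ideal.span_singleton_prime ha.ne_zero).2 ha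
  have h2 := IsLocalization.isPrime_of_isPrime_disjoint n.primeCompl (locSub A n) _ h1 (by
    rw [Set.disjoint_left]
    intro b hb hb'
    exact hb ((Ideal.span_singleton_le_iff_mem _).2 han hb'))
  rw [Ideal.map_span, Set.image_singleton] at h2
  exact (Ideal.span_singleton_prime fun e => ha.ne_zero
    (algebraMap_locSub_injective A n (by rw [e, map_zero]))).1 h2

theorem dvd_of_algebraMap_dvd_locSub {a b : A} (ha : Prime a) (han : a ∈ n)
    (h : algebraMap A (locSub A n) a ∣ algebraMap A (locSub A n) b) : a ∣ b := by
  obtain ⟨⟨_, g, c, hc, rfl⟩, e⟩ := h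
  have e' : (b : K) = a * (g / c) := congrArg Subtype.val e
  have hc0 := ne_zero_of_notMem hc
  have : b * c = a * g := Subtype.ext (by push_cast; rw [e']; field_simp)
  refine (ha.dvd_or_dvd (⟨g, this⟩ : a ∣ b * c)).resolve_right fun hd => hc ?_
  obtain ⟨d, rfl⟩ := hd
  exact n.mul_mem_right _ han

end General

section Chart

/-- The subring `B[z]` of a field. -/
noncomputable def chart (B : Subring K) (z : K) : Subring K := (eval₂RingHom B.subtype z).range

variable {B : Subring K} {z : K}

theorem mem_chart {f : K} : f ∈ chart B z ↔ ∃ p : B[X], p.eval₂ B.subtype z = f := Iff.rfl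

theorem le_chart : B ≤ chart B z := fun b hb => ⟨C ⟨b, hb⟩, by simp⟩

theorem mem_chart_self : z ∈ chart B z := ⟨X, by simp⟩

theorem chart_le {V : Subring K} (hB : B ≤ V) (hz : z ∈ V) : chart B z ≤ V := by
  rintro _ ⟨p, rfl⟩
  rw [coe_eval₂RingHom, eval₂_eq_sum_range]
  exact sum_mem fun i _ => V.mul_mem (hB (p.coeff i).2) (V.pow_mem hz _)

instance [IsNoetherianRing B] : IsNoetherianRing (chart B z) := by
  unfold chart; infer_instance

instance [IsFractionRing B K] : IsFractionRing (chart B z) K := isFractionRing_of_le le_chart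

variable [IsLocalRing B] {x y : B}

/-- Homogenization: `x ^ k * p(y/x)` is a form of degree `k` in `x` and `y`. -/
theorem exists_mem_pow_eq_pow_mul_eval₂ (h : RegPair x y) (hz : (x : K) * z = y) {k : ℕ} (p : B[X])
    (hp : p.natDegree ≤ k) : ∃ b ∈ maximalIdeal B ^ k, (x : K) ^ k * p.eval₂ B.subtype z = b := by
  refine ⟨∑ i ∈ Finset.range (k + 1), p.coeff i * (x ^ (k - i) * y ^ i), ?_, ?_⟩
  · refine Ideal.sum_mem _ fun i hi => Ideal.mul_mem_left _ _ ?_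
    have hi' : k - i + i = k := by have := Finset.mem_range.1 hi; omega
    rw [← hi', pow_add (maximalIdeal B), hi']
    exact Ideal.mul_mem_mul (Ideal.pow_mem_pow h.left_mem _) (Ideal.pow_mem_pow h.right_mem _)
  · rw [eval₂_eq_sum_range' _ (Nat.lt_succ_of_le hp), Finset.mul_sum]
    push_cast
    refine Finset.sum_congr rfl fun i hi => ?_
    have hi' : k - i + i = k := by have := Finset.mem_range.1 hi; omega
    have e : (x : K) ^ k = x ^ (k - i) * x ^ i := by rw [← pow_add, hi']
    rw [e, ← hz, Subring.subtype_apply]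
    ring

/-- The kernel of evaluation at `y/x` is generated by `xX - y`. Clearing denominators in `p(z) = 0`
shows that `x` divides the leading coefficient times a power of `y`, hence the leading coefficient;
a multiple of `xX - y` then lowers the degree. -/
theorem dvd_of_eval₂_eq_zero (h : RegPair x y) (hz : (x : K) * z = y) (p : B[X])
    (hp : p.eval₂ B.subtype z = 0) : (C x * X - C y) ∣ p := by
  induction hn : p.natDegree using Nat.strong_induction_on generalizing p with
  | _ n ih =>
  subst hn
  have hx0 : (x : K) ≠ 0 := fun e => h.prime.ne_zero (Subtype.ext e)
  rcases Nat.eq_zero_or_pos p.natDegree with h0 | hpos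
  · rw [eq_C_of_natDegree_eq_zero h0, eval₂_C] at hp
    rw [eq_C_of_natDegree_eq_zero h0, show p.coeff 0 = 0 from Subtype.ext hp]
    simp
  obtain ⟨n, hn⟩ : ∃ n, p.natDegree = n + 1 := ⟨p.natDegree - 1, by omega⟩
  obtain ⟨b, -, hb⟩ := exists_mem_pow_eq_pow_mul_eval₂ h hz (k := n) p.eraseLead (by
    have := p.eraseLead_natDegree_le; omega)
  have hx : x ∣ p.leadingCoeff * y ^ (n + 1) := by
    refine ⟨-b, Subtype.ext ?_⟩
    have e1 := p.eraseLead_add_C_mul_X_pow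
    rw [← e1, eval₂_add, eval₂_mul, eval₂_C, eval₂_X_pow, hn] at hp
    push_cast
    rw [← hb, ← hz]
    simp only [Subring.subtype_apply] at hp
    linear_combination (x : K) ^ (n + 1) * hp
  obtain ⟨d, hd⟩ := (h.prime.dvd_or_dvd hx).resolve_right (h.not_dvd_pow _)
  have hev : (C d * X ^ n * (C x * X - C y)).eval₂ B.subtype z = 0 := by
    simp [eval₂_mul, eval₂_sub, hz]
  suffices hs : (C x * X - C y) ∣ p - C d * X ^ n * (C x * X - C y) by
    exact (dvd_sub_left (dvd_mul_left _ _)).1 hs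
  by_cases hq : p - C d * X ^ n * (C x * X - C y) = 0
  · rw [hq]; exact dvd_zero _
  refine ih _ ?_ _ ?_ rfl
  · have e2 : p - C d * X ^ n * (C x * X - C y) = p.eraseLead + C (d * y) * X ^ n := by
      conv_lhs => rw [← p.eraseLead_add_C_mul_X_pow, hn, hd]
      simp only [C_mul]
      ring
    rw [e2]
    have h3 : (C (d * y) * X ^ n).natDegree ≤ n := natDegree_C_mul_X_pow_le _ _
    have h4 := p.eraseLead_natDegree_le
    have h5 := natDegree_add_le p.eraseLead (C (d * y) * X ^ n)
    have : max p.eraseLead.natDegree (C (d * y) * X ^ n).natDegree ≤ n := max_le (by omega) h3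
    omega
  · rw [eval₂_sub, hp, hev, sub_zero]

theorem map_residue_eq_zero_of_eval₂_eq_zero (h : RegPair x y) (hz : (x : K) * z = y) {p : B[X]}
    (hp : p.eval₂ B.subtype z = 0) : p.map (residue B) = 0 := by
  obtain ⟨q, rfl⟩ := dvd_of_eval₂_eq_zero h hz p hp
  have hx : residue B x = 0 := Ideal.Quotient.eq_zero_iff_mem.2 h.left_mem
  have hy : residue B y = 0 := Ideal.Quotient.eq_zero_iff_mem.2 h.right_mem
  simp [Polynomial.map_mul, hx, hy]

/-- The reduction of `B[y/x]` modulo `x`. -/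
noncomputable def chartResidue (h : RegPair x y) (hz : (x : K) * z = y) :
    chart B z →+* (ResidueField B)[X] :=
  (eval₂RingHom B.subtype z).rangeRestrict.liftOfRightInverse
    (Function.surjInv (RingHom.rangeRestrict_surjective _))
    (Function.rightInverse_surjInv _)
    ⟨mapRingHom (residue B), fun _ hp => map_residue_eq_zero_of_eval₂_eq_zero h hz
      (congrArg Subtype.val hp)⟩

theorem chartResidue_eval₂ (h : RegPair x y) (hz : (x : K) * z = y) (p : B[X])
    (hp : p.eval₂ B.subtype z ∈ chart B z) :
    chartResidue h hz ⟨p.eval₂ B.subtype z, hp⟩ = p.map (residue B) :=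
  RingHom.liftOfRightInverse_comp_apply _ _ _ ⟨mapRingHom (residue B), _⟩ p

theorem chartResidue_surjective (h : RegPair x y) (hz : (x : K) * z = y) :
    Function.Surjective (chartResidue h hz) := fun q => by
  obtain ⟨p, rfl⟩ := Polynomial.map_surjective _ residue_surjective q
  exact ⟨⟨_, mem_chart.2 ⟨p, rfl⟩⟩, chartResidue_eval₂ h hz p _⟩

/-- An element of `B` as an element of `B[z]`. -/
def toChart (z : K) (b : B) : chart B z := ⟨b, le_chart b.2⟩

omit [IsLocalRing B] in
@[simp] theorem coe_toChart (b : B) : (toChart z b : K) = b := rfl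

omit [IsLocalRing B] in
theorem toChart_injective : Function.Injective (toChart z : B → chart B z) :=
  Subring.inclusion_injective le_chart

theorem chartResidue_toChart (h : RegPair x y) (hz : (x : K) * z = y) (b : B) :
    chartResidue h hz (toChart z b) = C (residue B b) := by
  have := chartResidue_eval₂ h hz (C b) (mem_chart.2 ⟨_, rfl⟩)
  rw [Polynomial.map_C] at this
  rw [← this]
  exact congrArg _ (Subtype.ext (by simp))

/-- The kernel consists of values of polynomials with coefficients in `m`, and `m` becomes generated
by `x` in the chart since `y = xz`. -/
theorem chartResidue_eq_zero_iff (h : RegPair x y) (hz : (x : K) * z = y) {a : chart B z} :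
    chartResidue h hz a = 0 ↔ toChart z x ∣ a := by
  constructor
  · obtain ⟨_, p, rfl⟩ := a
    intro e
    replace e : p.map (residue B) = 0 := (chartResidue_eval₂ h hz p (mem_chart.2 ⟨p, rfl⟩)).symm.trans e
    have hp : p ∈ Ideal.map C (maximalIdeal B) := by
      rw [Ideal.mem_map_C_iff]
      intro i
      have := congrArg (fun q => q.coeff i) e
      simpa [coeff_map, residue_eq_zero_iff] using this
    rw [h.max, Ideal.map_span, Set.image_pair, Ideal.mem_span_pair] at hp
    obtain ⟨r, s, rfl⟩ := hp
    refine ⟨⟨_, mem_chart.2 ⟨r + X * s, rfl⟩⟩, Subtype.ext ?_⟩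
    simp [eval₂_add, eval₂_mul, ← hz]
    ring
  · rintro ⟨b, rfl⟩
    rw [map_mul, chartResidue_toChart, (residue_eq_zero_iff _).2 h.left_mem]
    simp

theorem prime_toChart (h : RegPair x y) (hz : (x : K) * z = y) : Prime (toChart z x) := by
  have hx0 : toChart z x ≠ 0 := fun e => h.prime.ne_zero (toChart_injective (by rw [e]; rfl))
  rw [← Ideal.span_singleton_prime hx0]
  have : Ideal.span {toChart z x} = RingHom.ker (chartResidue h hz) := by
    ext a
    rw [Ideal.mem_span_singleton, RingHom.mem_ker, chartResidue_eq_zero_iff]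
  rw [this]
  exact RingHom.ker_isPrime _

/-- Lift a generator of the image of `n` in the principal ideal ring `k[X]`, the quotient of the
chart by `x`. -/
theorem exists_chart_ideal_eq (h : RegPair x y) (hz : (x : K) * z = y) {n : Ideal (chart B z)}
    (_ : n.IsPrime) (hxn : toChart z x ∈ n) (hne : n ≠ Ideal.span {toChart z x}) :
    ∃ f, n = Ideal.span {toChart z x, f} ∧ ¬ toChart z x ∣ f := by
  set ρ := chartResidue h hz
  have hker : RingHom.ker ρ ≤ n := by
    intro a ha
    obtain ⟨b, rfl⟩ := (chartResidue_eq_zero_iff h hz).1 ha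
    exact n.mul_mem_right _ hxn
  have hρ := chartResidue_surjective h hz
  obtain ⟨π, hπ⟩ := (IsPrincipalIdealRing.principal (n.map ρ)).principal
  obtain ⟨f, rfl⟩ := hρ π
  have hmem : ∀ a, a ∈ n ↔ ρ a ∈ n.map ρ := fun a =>
    ⟨Ideal.mem_map_of_mem _, fun ha => by
      have : a ∈ (n.map ρ).comap ρ := ha
      rwa [Ideal.comap_map_of_surjective' _ hρ, sup_eq_left.2 hker] at this⟩
  have hfn : f ∈ n := by
    rw [hmem, hπ]; exact Ideal.mem_span_singleton_self _
  have hle : n = Ideal.span {toChart z x, f} := by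
    refine le_antisymm (fun a ha => ?_) ?_
    · rw [hmem, hπ] at ha
      obtain ⟨q, hq⟩ := Ideal.mem_span_singleton'.1 ha
      obtain ⟨q, rfl⟩ := hρ q
      have : ρ (a - q * f) = 0 := by rw [map_sub, map_mul, hq, sub_self]
      obtain ⟨c, hc⟩ := (chartResidue_eq_zero_iff h hz).1 this
      rw [Ideal.mem_span_pair]
      exact ⟨c, q, by linear_combination -hc⟩
    · rw [Ideal.span_le]
      rintro _ (rfl | rfl)
      exacts [hxn, hfn]
  refine ⟨f, hle, fun hd => hne ?_⟩
  rw [hle]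
  refine le_antisymm ?_ (Ideal.span_mono (by simp))
  rw [Ideal.span_le]
  rintro _ (rfl | rfl)
  exacts [Ideal.mem_span_singleton_self _, Ideal.mem_span_singleton.2 hd]

/-- The points of the exceptional fibre other than its generic point are again two-dimensional
regular, with `x` as one of the parameters. This makes induction along blow-ups possible. -/
theorem exists_regPair_locSub (h : RegPair x y) (hz : (x : K) * z = y) (n : Ideal (chart B z))
    [hn : n.IsPrime] (hxn : toChart z x ∈ n) (hne : n ≠ Ideal.span {toChart z x}) :
    ∃ f, RegPair (algebraMap _ (locSub (chart B z) n) (toChart z x)) f := by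
  obtain ⟨f, hf, hxf⟩ := exists_chart_ideal_eq h hz hn hxn hne
  refine ⟨algebraMap _ _ f, ?_, ?_, ?_⟩
  · rw [maximalIdeal_locSub, ← Set.image_pair, ← Ideal.map_span, ← hf]
  · exact prime_algebraMap_locSub _ _ (prime_toChart h hz) hxn
  · exact fun hd => hxf (dvd_of_algebraMap_dvd_locSub _ _ (prime_toChart h hz) hxn hd)

end Chart

end AdjointIdeals

end

/-! ### Zeroth Fitting ideals under division by a cyclic submodule. -/

section

open IsLocalRing

namespace AdjointIdeals

section Fitting

variable {V M M' : Type*} [CommRing V] [AddCommGroup M] [Module V M] [AddCommGroup M'] [Module V M']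

theorem det_mem_fittingIdealZero {n : ℕ} (g : Fin n → M) (P : Matrix (Fin n) (Fin n) V)
    (hg : Submodule.span V (Set.range g) = ⊤) (hP : ∀ i, ∑ j, P i j • g j = 0) :
    P.det ∈ fittingIdealZero V M :=
  Ideal.subset_span ⟨n, g, P, hg, hP, rfl⟩

theorem fittingIdealZero_le_of_surjective (π : M →ₗ[V] M') (hπ : Function.Surjective π) :
    fittingIdealZero V M ≤ fittingIdealZero V M' := by
  refine Ideal.span_le.2 ?_
  rintro _ ⟨n, g, P, hg, hP, rfl⟩
  refine det_mem_fittingIdealZero (π ∘ g) P ?_ fun i => ?_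
  · rw [Set.range_comp, Submodule.span_image, hg, Submodule.map_top, LinearMap.range_eq_top.2 hπ]
  · simpa using congrArg π (hP i)

theorem fittingIdealZero_eq_of_linearEquiv (e : M ≃ₗ[V] M') :
    fittingIdealZero V M = fittingIdealZero V M' :=
  le_antisymm (fittingIdealZero_le_of_surjective e.toLinearMap e.surjective)
    (fittingIdealZero_le_of_surjective e.symm.toLinearMap e.symm.surjective)

theorem fittingIdealZero_eq_top_of_subsingleton [Subsingleton M] : fittingIdealZero V M = ⊤ := by
  rw [Ideal.eq_top_iff_one]
  have := det_mem_fittingIdealZero (V := V) (M := M) Fin.elim0 (0 : Matrix (Fin 0) (Fin 0) V)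
    (Subsingleton.elim _ _) (fun i => i.elim0)
  simpa using this

/-- Lifting the generators of `M'` and adding `w` to them, a relation matrix `P` of `M'` extends to
a block triangular one with corner `x`, of determinant `x * det P`. -/
theorem span_singleton_mul_fittingIdealZero_le (π : M →ₗ[V] M') (hπ : Function.Surjective π)
    {w : M} (hker : LinearMap.ker π ≤ Submodule.span V {w}) {x : V} (hx : x • w = 0) :
    Ideal.span {x} * fittingIdealZero V M' ≤ fittingIdealZero V M := by
  unfold fittingIdealZero
  rw [Ideal.span_mul_span', Set.singleton_mul, Ideal.span_le]
  rintro _ ⟨_, ⟨n, g, P, hg, hP, rfl⟩, rfl⟩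
  choose G hG using fun i => hπ (g i)
  have hc : ∀ i, ∃ c : V, ∑ j, P i j • G j = c • w := fun i => by
    have : ∑ j, P i j • G j ∈ LinearMap.ker π := by
      simp [LinearMap.mem_ker, hG, hP i]
    obtain ⟨c, hc⟩ := Submodule.mem_span_singleton.1 (hker this)
    exact ⟨c, hc.symm⟩
  choose c hc using hc
  set Q : Matrix (Fin (n + 1)) (Fin (n + 1)) V :=
    Matrix.of (Fin.cons (Fin.cons x 0) fun i => Fin.cons (-c i) (P i)) with hQ
  have hdet : Q.det = x * P.det := by
    rw [Matrix.det_succ_row_zero, Finset.sum_eq_single 0]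
    · have : Q.submatrix Fin.succ (Fin.succAbove 0) = P := by
        ext i j; simp [hQ]
      rw [this]; simp [hQ]
    · intro j _ hj
      obtain ⟨j, rfl⟩ := Fin.exists_succ_eq.2 hj
      simp [hQ]
    · simp
  change x * P.det ∈ fittingIdealZero V M
  rw [← hdet]
  refine det_mem_fittingIdealZero (Fin.cons w G : Fin (n + 1) → M) Q ?_ fun i => ?_
  · rw [eq_top_iff]
    rintro m -
    have hm : π m ∈ Submodule.span V (Set.range g) := hg ▸ Submodule.mem_top
    obtain ⟨a, ha⟩ := (Submodule.mem_span_range_iff_exists_fun V).1 hm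
    have h1 : m - ∑ i, a i • G i ∈ LinearMap.ker π := by
      simp [LinearMap.mem_ker, hG, ha]
    have h2 : ∑ i, a i • G i ∈ Submodule.span V (Set.range (Fin.cons w G : Fin (n + 1) → M)) :=
      Submodule.sum_mem _ fun i _ => Submodule.smul_mem _ _ (Submodule.subset_span ⟨i.succ, rfl⟩)
    have h3 : Submodule.span V {w} ≤ Submodule.span V (Set.range (Fin.cons w G : Fin (n + 1) → M)) :=
      Submodule.span_mono (by rintro _ rfl; exact ⟨0, rfl⟩)
    simpa using add_mem (h3 (hker h1)) h2
  · rw [Fin.sum_univ_succ]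
    refine Fin.cases ?_ (fun i => ?_) i
    · simp [hQ, hx]
    · simp [hQ, hc i]

/-- For a relation matrix `P` of `M` with nonzero determinant, the relations of the images in `M'`
form a free lattice of full rank, with basis the rows of some `Q`. Thus `P = C * Q` with `det Q` in
the Fitting ideal of `M'`, and it remains to see that `x` divides `det C`. The rows of `Q` evaluate
in `M` to multiples `κ i • w`, and `C κ` vanishes modulo `x` because the rows of `P` are relations
in `M`. -/
theorem fittingIdealZero_le_span_singleton_mul [IsDomain V] [IsPrincipalIdealRing V]
    [IsLocalRing V] (π : M →ₗ[V] M') (hπ : Function.Surjective π) {w : M}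
    (hker : LinearMap.ker π = Submodule.span V {w}) {x : V} (hxm : x ∈ maximalIdeal V)
    (hx : ∀ c : V, c • w = 0 → x ∣ c) :
    fittingIdealZero V M ≤ Ideal.span {x} * fittingIdealZero V M' := by
  refine Ideal.span_le.2 ?_
  rintro _ ⟨n, g, P, hg, hP, rfl⟩
  by_cases hd : P.det = 0
  · rw [hd]; exact Submodule.zero_mem _
  set L : (Fin n → V) →ₗ[V] M := Fintype.linearCombination V g
  have hL : ∀ c, L c = ∑ j, c j • g j := fun c => Fintype.linearCombination_apply V g c
  set Λ : Submodule V (Fin n → V) := LinearMap.ker (π ∘ₗ L)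
  have hPΛ : ∀ i, P i ∈ Λ := fun i => by
    rw [LinearMap.mem_ker, LinearMap.comp_apply, hL, hP i, map_zero]
  obtain ⟨k, b⟩ := Submodule.basisOfPid (Pi.basisFun V (Fin n)) Λ
  have hk : k = n := by
    have h1 := Module.finrank_eq_card_basis b
    rw [Fintype.card_fin] at h1
    refine le_antisymm ?_ ?_
    · rw [← h1]; simpa using Submodule.finrank_le Λ
    · have hli : LinearIndependent V fun i => (⟨P i, hPΛ i⟩ : Λ) := by
        refine LinearIndependent.of_comp Λ.subtype ?_
        exact Matrix.linearIndependent_rows_of_det_ne_zero hd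
      have := hli.fintype_card_le_finrank
      rwa [h1, Fintype.card_fin] at this
  subst hk
  set Q : Matrix (Fin k) (Fin k) V := Matrix.of fun i => (b i : Fin k → V) with hQ
  set C : Matrix (Fin k) (Fin k) V := Matrix.of fun l i => b.repr ⟨P l, hPΛ l⟩ i with hC
  have hrep : ∀ c : Λ, (c : Fin k → V) = ∑ i, b.repr c i • (b i : Fin k → V) := fun c => by
    have := congrArg Subtype.val (b.sum_repr c)
    rw [AddSubmonoidClass.coe_finsetSum] at this
    exact this.symm
  have hPC : P = C * Q := by
    ext l j
    have := congrFun (hrep ⟨P l, hPΛ l⟩) j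
    simpa [Matrix.mul_apply, hC, hQ] using this
  have hκ : ∀ i, ∃ κ : V, L (b i) = κ • w := fun i => by
    have : L (b i) ∈ LinearMap.ker π := (b i).2
    rw [hker] at this
    obtain ⟨c, hc⟩ := Submodule.mem_span_singleton.1 this
    exact ⟨c, hc.symm⟩
  choose κ hκ using hκ
  have hLc : ∀ c : Λ, L c = (∑ i, b.repr c i * κ i) • w := fun c => by
    conv_lhs => rw [hrep c]
    simp [map_sum, hκ, Finset.sum_smul, mul_smul]
  have hCκ : ∀ l, x ∣ (C.mulVec κ) l := fun l => by
    refine hx _ ?_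
    have h1 := hLc ⟨P l, hPΛ l⟩
    rw [hL, hP l] at h1
    exact h1.symm
  -- If every `κ i` were a nonunit, an expression of `w` in the generators would read `w = a • w`
  -- with `a` in the maximal ideal, although `1 - a` cannot be divisible by `x`.
  have hunit : ∃ i, IsUnit (κ i) := by
    by_contra hcon
    push Not at hcon
    have hw : w ∈ Submodule.span V (Set.range g) := hg ▸ Submodule.mem_top
    obtain ⟨c, hc⟩ := (Submodule.mem_span_range_iff_exists_fun V).1 hw
    have hcL : L c = w := by rw [hL, hc]
    have hcΛ : c ∈ Λ := by
      rw [LinearMap.mem_ker, LinearMap.comp_apply, hcL, ← LinearMap.mem_ker, hker]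
      exact Submodule.mem_span_singleton_self w
    have h1 := hLc ⟨c, hcΛ⟩
    change L c = _ at h1
    rw [hcL] at h1
    have h2 := hx (∑ i, b.repr ⟨c, hcΛ⟩ i * κ i - 1) (by rw [sub_smul, ← h1, one_smul, sub_self])
    have h3 : ∑ i, b.repr ⟨c, hcΛ⟩ i * κ i ∈ maximalIdeal V :=
      Ideal.sum_mem _ fun i _ => Ideal.mul_mem_left _ _ ((mem_maximalIdeal _).2 (hcon i))
    have h4 : (1 : V) ∈ maximalIdeal V := by
      have := sub_mem h3 (Ideal.mem_of_dvd _ h2 hxm)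
      rwa [sub_sub_cancel] at this
    exact (Ideal.ne_top_iff_one _).1 (Ideal.IsPrime.ne_top inferInstance) h4
  obtain ⟨i, hi⟩ := hunit
  -- Cramer's rule: the adjugate of `C` carries `C κ` to `det C • κ`, and one entry of `κ` is a
  -- unit.
  have hdC : x ∣ C.det := by
    have h1 : C.adjugate.mulVec (C.mulVec κ) = C.det • κ := by
      rw [Matrix.mulVec_mulVec, Matrix.adjugate_mul, Matrix.smul_mulVec, Matrix.one_mulVec]
    have h2 : x ∣ C.det * κ i := by
      rw [← smul_eq_mul, ← Pi.smul_apply, ← h1]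
      change x ∣ ∑ l, C.adjugate i l * (C.mulVec κ) l
      exact Finset.dvd_sum fun l _ => (hCκ l).mul_left _
    exact hi.dvd_mul_right.1 h2
  rw [hPC, Matrix.det_mul]
  refine Ideal.mul_mem_mul (Ideal.mem_span_singleton.2 hdC)
    (det_mem_fittingIdealZero (π ∘ g) Q ?_ fun l => ?_)
  · rw [Set.range_comp, Submodule.span_image, hg, Submodule.map_top, LinearMap.range_eq_top.2 hπ]
  · have : (π ∘ₗ L) (b l) = 0 := (b l).2
    rw [LinearMap.comp_apply, hL] at this
    simpa [hQ] using this

end Fitting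

end AdjointIdeals

end

/-! ### Centers of valuation rings and the order valuation. -/

section

open IsLocalRing Polynomial

namespace AdjointIdeals

variable {K : Type*} [Field K]

section Center

/-- The valuation ring `V` dominates the local ring `S`. -/
structure Dominates (V : ValuationSubring K) (S : Subring K) [IsLocalRing S] : Prop where
  le : S ≤ V.toSubring
  lt_one : ∀ a : S, a ∈ maximalIdeal S → V.valuation a < 1

theorem Dominates.valuation_eq_one_iff {V : ValuationSubring K} {S : Subring K} [IsLocalRing S]
    (h : Dominates V S) (a : S) : V.valuation a = 1 ↔ a ∉ maximalIdeal S := by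
  constructor
  · intro e ha
    exact absurd e (h.lt_one a ha).ne
  · intro ha
    obtain ⟨u, rfl⟩ := not_not.1 fun hn => ha ((mem_maximalIdeal a).2 hn)
    refine le_antisymm ((V.valuation_le_one_iff _).2 (h.le (u : S).2)) ?_
    have h1 : V.valuation ((u⁻¹ : Sˣ) : S) ≤ 1 := (V.valuation_le_one_iff _).2 (h.le ((u⁻¹ : Sˣ) : S).2)
    have h2 : V.valuation (u : S) * V.valuation ((u⁻¹ : Sˣ) : S) = 1 := by
      rw [← map_mul, ← Subring.coe_mul, Units.mul_inv, Subring.coe_one, map_one]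
    calc (1 : V.ValueGroup) = V.valuation (u : S) * V.valuation ((u⁻¹ : Sˣ) : S) := h2.symm
      _ ≤ V.valuation (u : S) * 1 := by gcongr
      _ = _ := mul_one _

theorem Dominates.inv_mem {V : ValuationSubring K} {S : Subring K} [IsLocalRing S]
    (h : Dominates V S) {a : K} (ha : a ∈ S) (hv : V.valuation a = 1) : a⁻¹ ∈ S := by
  have h1 := (h.valuation_eq_one_iff ⟨a, ha⟩).1 hv
  obtain ⟨u, hu⟩ := not_not.1 fun hn => h1 ((mem_maximalIdeal _).2 hn)
  have h2 : a * ((u⁻¹ : Sˣ) : S) = 1 := by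
    have := congrArg Subtype.val (Units.mul_inv u)
    rw [hu] at this
    exact this
  rw [← eq_inv_of_mul_eq_one_right h2]
  exact ((u⁻¹ : Sˣ) : S).2

/-- The center of a valuation ring on a subring. -/
def center (V : ValuationSubring K) {S : Subring K} (hS : S ≤ V.toSubring) : Ideal S where
  carrier := {a | V.valuation a < 1}
  zero_mem' := by simp
  add_mem' := fun ha hb => by
    simp only [Set.mem_ofPred_eq, Subring.coe_add] at *
    exact V.valuation.map_add_lt ha hb
  smul_mem' := fun c a ha => by
    simp only [Set.mem_ofPred_eq, smul_eq_mul, Subring.coe_mul, map_mul] at *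
    exact (mul_le_of_le_one_left' ((V.valuation_le_one_iff _).2 (hS c.2))).trans_lt ha

theorem mem_center {V : ValuationSubring K} {S : Subring K} {hS : S ≤ V.toSubring} {a : S} :
    a ∈ center V hS ↔ V.valuation a < 1 := Iff.rfl

theorem notMem_center {V : ValuationSubring K} {S : Subring K} {hS : S ≤ V.toSubring} {a : S} :
    a ∉ center V hS ↔ V.valuation a = 1 := by
  rw [mem_center, not_lt]
  exact ⟨fun h => le_antisymm ((V.valuation_le_one_iff _).2 (hS a.2)) h, fun h => h.ge⟩

instance (V : ValuationSubring K) {S : Subring K} (hS : S ≤ V.toSubring) :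
    (center V hS).IsPrime := by
  refine Ideal.isPrime_iff.2 ⟨fun e => ?_, fun {a b} hab => ?_⟩
  · have : (1 : S) ∈ center V hS := e ▸ Submodule.mem_top
    simp [mem_center] at this
  · by_contra hcon
    push Not at hcon
    rw [notMem_center, notMem_center] at hcon
    rw [mem_center, Subring.coe_mul, map_mul, hcon.1, hcon.2, one_mul] at hab
    exact lt_irrefl _ hab

theorem locSub_le {V : ValuationSubring K} {S : Subring K} (hS : S ≤ V.toSubring) {n : Ideal S}
    [n.IsPrime] (hn : center V hS ≤ n) : locSub S n ≤ V.toSubring := by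
  rintro _ ⟨g, h, hh, rfl⟩
  have : V.valuation h = 1 := notMem_center.1 fun e => hh (hn e)
  refine (V.valuation_le_one_iff _).1 ?_
  rw [map_div₀, this, div_one]
  exact (V.valuation_le_one_iff _).2 (hS g.2)

theorem dominates_locSub_center {V : ValuationSubring K} {S : Subring K} (hS : S ≤ V.toSubring) :
    Dominates V (locSub S (center V hS)) where
  le := locSub_le hS le_rfl
  lt_one := by
    rintro ⟨_, g, h, hh, rfl⟩ ha
    have h1 : algebraMap S (locSub S (center V hS)) g ∈ maximalIdeal _ := by
      have := Ideal.mul_mem_right (algebraMap S (locSub S (center V hS)) h) _ ha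
      convert! this
      exact Subtype.ext (div_mul_cancel₀ _ (ne_zero_of_notMem hh)).symm
    rw [algebraMap_mem_maximalIdeal_locSub, mem_center] at h1
    rw [map_div₀, notMem_center.1 hh, div_one]
    exact h1

end Center

section OrderValuation

theorem mem_or_inv_mem_of_isPrincipal {T : Subring K} [IsLocalRing T] [IsNoetherianRing T]
    [IsFractionRing T K] (hmax : (maximalIdeal T).IsPrincipal) (f : K) : f ∈ T ∨ f⁻¹ ∈ T := by
  have hval : ValuationRing T :=
    ((tfae_of_isNoetherianRing_of_isLocalRing_of_isDomain T).out 1 4).2 hmax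
  obtain ⟨a, b, hb, rfl⟩ := IsFractionRing.div_surjective T f
  have hb0 : (b : K) ≠ 0 := fun e => nonZeroDivisors.ne_zero hb (Subtype.ext e)
  obtain ⟨c, hc | hc⟩ := ValuationRing.cond a b
  · right
    by_cases ha : (a : K) = 0
    · rw [show algebraMap T K a = 0 from ha]; simp [T.zero_mem]
    · have : (a : K) * c = b := congrArg Subtype.val hc
      have e : (algebraMap T K a / algebraMap T K b)⁻¹ = c := by
        change ((a : K) / b)⁻¹ = c
        rw [← this]; field_simp
      rw [e]; exact c.2
  · left
    have : (b : K) * c = a := congrArg Subtype.val hc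
    have e : (algebraMap T K a / algebraMap T K b) = c := by
      change ((a : K) / b) = c
      rw [← this]; field_simp
    rw [e]; exact c.2

variable {B : Subring K} [IsLocalRing B] [IsNoetherianRing B] [IsFractionRing B K] {x y : B} {z : K}

omit [IsLocalRing B] in
theorem locSub_span_mem_or_inv_mem [(Ideal.span {toChart z x}).IsPrime] (f : K) :
    f ∈ locSub (chart B z) (Ideal.span {toChart z x}) ∨
      f⁻¹ ∈ locSub (chart B z) (Ideal.span {toChart z x}) := by
  refine mem_or_inv_mem_of_isPrincipal ?_ f
  rw [maximalIdeal_locSub, Ideal.map_span, Set.image_singleton]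
  exact ⟨⟨_, rfl⟩⟩

/-- The order valuation ring of a two-dimensional regular local ring. -/
noncomputable def ordVal (h : RegPair x y) (hz : (x : K) * z = y) : ValuationSubring K :=
  haveI : (Ideal.span {toChart z x}).IsPrime :=
    (Ideal.span_singleton_prime (prime_toChart h hz).ne_zero).2 (prime_toChart h hz)
  ValuationSubring.ofSubring (locSub (chart B z) (Ideal.span {toChart z x}))
    locSub_span_mem_or_inv_mem

theorem ordVal_toSubring (h : RegPair x y) (hz : (x : K) * z = y)
    [(Ideal.span {toChart z x}).IsPrime] :
    (ordVal h hz).toSubring = locSub (chart B z) (Ideal.span {toChart z x}) := rfl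

/-- `V` contains the localization of the chart at its center, which is here already a valuation
ring. If `f` lies in `V` and `f⁻¹` in the localization, the numerator of `f⁻¹` has value one and can
be inverted. -/
theorem eq_ordVal (h : RegPair x y) (hz : (x : K) * z = y) {V : ValuationSubring K}
    (hV : chart B z ≤ V.toSubring) (hc : center V hV = Ideal.span {toChart z x}) :
    V = ordVal h hz := by
  have hp : (Ideal.span {toChart z x}).IsPrime := hc ▸ inferInstance
  have hle : locSub (chart B z) (Ideal.span {toChart z x}) ≤ V.toSubring := locSub_le hV hc.le
  apply ValuationSubring.toSubring_injective
  rw [ordVal_toSubring]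
  refine le_antisymm (fun f hf => ?_) hle
  refine (locSub_span_mem_or_inv_mem f).elim id fun hi => ?_
  by_cases hf0 : f = 0
  · rw [hf0]; exact Subring.zero_mem _
  obtain ⟨g, d, hd, e⟩ := hi
  have h1 : V.valuation d = 1 := notMem_center.1 (hc ▸ hd)
  have h2 : V.valuation f⁻¹ = V.valuation g := by rw [e, map_div₀, h1, div_one]
  have h3 : V.valuation g = 1 := by
    refine le_antisymm ((V.valuation_le_one_iff _).2 (hV g.2)) ?_
    rw [← h2, map_inv₀]
    refine (one_le_inv₀ ?_).2 ((V.valuation_le_one_iff _).2 hf)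
    exact zero_lt_iff.2 ((_root_.map_ne_zero _).2 hf0)
  have hg : g ∉ Ideal.span {toChart z x} := hc ▸ notMem_center.2 h3
  exact ⟨d, g, hg, by rw [← inv_inv f, e, inv_div]⟩

end OrderValuation

end AdjointIdeals

end

/-! ### Extension of derivations along quadratic transforms. -/

section

open IsLocalRing Polynomial

namespace AdjointIdeals

variable {K : Type*} [Field K]

section Extension

variable {V : ValuationSubring K} {E : Type*} [AddCommGroup E] [Module V E] [Module Vᵐᵒᵖ E]
  [IsCentralScalar V E]

/-- A ring homomorphism `S → V ⊕ εE` lifting the inclusion `S ≤ V`, i.e. a derivation `S → E`. -/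
structure DerLift (V : ValuationSubring K) (E : Type*) [AddCommGroup E] [Module V E] [Module Vᵐᵒᵖ E]
    [IsCentralScalar V E] (S : Subring K) where
  hom : S →+* TrivSqZeroExt V E
  fst_coe : ∀ s, ((hom s).fst : K) = s

/-- Since all relations of `z` over `S` come from `xz = y`, a derivation extends to `S[z]` once a
value of `dz` with `x dz = dy - z dx` is chosen. It passes to the localization because an element of
`V ⊕ εE` is a unit as soon as its first component is. -/
theorem exists_derLift_locSub {S : Subring K} [IsLocalRing S] {x y : S} {z : K} (h : RegPair x y)
    (hz : (x : K) * z = y) (φ : DerLift V E S) (hzV : z ∈ V) (e : E)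
    (he : (φ.hom x).fst • e = (φ.hom y).snd - (⟨z, hzV⟩ : V) • (φ.hom x).snd)
    (hS : chart S z ≤ V.toSubring) :
    ∃ ψ : DerLift V E (locSub (chart S z) (center V hS)),
      (∀ s : S, ψ.hom (algebraMap _ _ (toChart z s)) = φ.hom s) ∧
      ψ.hom (algebraMap _ _ (⟨z, mem_chart_self⟩ : chart S z)) = (TrivSqZeroExt.inl ⟨z, hzV⟩ + TrivSqZeroExt.inr e) := by
  set ζ : TrivSqZeroExt V E := TrivSqZeroExt.inl ⟨z, hzV⟩ + TrivSqZeroExt.inr e with hζ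
  have hx : (φ.hom x).fst * (⟨z, hzV⟩ : V) = (φ.hom y).fst := Subtype.ext (by
    push_cast; rw [φ.fst_coe, φ.fst_coe, hz])
  have hrel : φ.hom x * ζ = φ.hom y := by
    ext
    · simp [hζ, φ.fst_coe, hz]
    · rw [TrivSqZeroExt.snd_mul]
      simp only [hζ, TrivSqZeroExt.snd_add, TrivSqZeroExt.snd_inl, TrivSqZeroExt.snd_inr, zero_add,
        TrivSqZeroExt.fst_add, TrivSqZeroExt.fst_inl, TrivSqZeroExt.fst_inr, add_zero, op_smul_eq_smul]
      rw [he, sub_add_cancel]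
  have hkill : ∀ p : S[X], p.eval₂ S.subtype z = 0 → p.eval₂ φ.hom ζ = 0 := by
    intro p hp
    obtain ⟨q, rfl⟩ := dvd_of_eval₂_eq_zero h hz p hp
    simp [eval₂_mul, eval₂_sub, hrel]
  have hfst : ∀ p : S[X], ((p.eval₂ φ.hom ζ).fst : K) = p.eval₂ S.subtype z := by
    intro p
    let f : S[X] →+* K := (V.subtype.comp (TrivSqZeroExt.fstHom V V E : _ →+* V)).comp
      (eval₂RingHom φ.hom ζ)
    have : f = eval₂RingHom S.subtype z := by
      ext a
      · simp [f, φ.fst_coe]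
      · simp [f, hζ]
    exact congrArg (fun g => g p) this
  let χ : chart S z →+* TrivSqZeroExt V E :=
    (eval₂RingHom S.subtype z).rangeRestrict.liftOfRightInverse
    (Function.surjInv (RingHom.rangeRestrict_surjective _))
    (Function.rightInverse_surjInv _)
    ⟨eval₂RingHom φ.hom ζ, fun p hp => hkill p (congrArg Subtype.val hp)⟩
  have hχ : ∀ (p : S[X]) (hp : p.eval₂ S.subtype z ∈ chart S z),
      χ ⟨p.eval₂ S.subtype z, hp⟩ = p.eval₂ φ.hom ζ := fun p _ =>
    RingHom.liftOfRightInverse_comp_apply _ _ _ ⟨eval₂RingHom φ.hom ζ, _⟩ p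
  have hχfst : ∀ a : chart S z, ((χ a).fst : K) = a := by
    rintro ⟨_, p, rfl⟩
    exact (congrArg (fun t : TrivSqZeroExt V E => (t.fst : K)) (hχ p (mem_chart.2 ⟨p, rfl⟩))).trans
      (hfst p)
  have hunit : ∀ a : (center V hS).primeCompl, IsUnit (χ a) := by
    rintro ⟨a, ha⟩
    rw [TrivSqZeroExt.isUnit_iff_isUnit_fst, ValuationSubring.valuation_eq_one_iff, hχfst]
    exact notMem_center.1 ha
  refine ⟨⟨IsLocalization.lift (M := (center V hS).primeCompl) hunit, ?_⟩, fun s => ?_, ?_⟩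
  · rintro s
    obtain ⟨⟨a, b⟩, hab⟩ := IsLocalization.surj (M := (center V hS).primeCompl) s
    have h1 := congrArg (IsLocalization.lift (M := (center V hS).primeCompl) hunit) hab
    rw [map_mul, IsLocalization.lift_eq, IsLocalization.lift_eq] at h1
    have h2 := congrArg (fun t : TrivSqZeroExt V E => (t.fst : K)) h1
    simp only [TrivSqZeroExt.fst_mul, MulMemClass.coe_mul, hχfst] at h2
    have h3 : (s : K) * (b : chart S z) = a := congrArg Subtype.val hab
    rw [← h3] at h2
    exact mul_right_cancel₀ (ne_zero_of_notMem b.2) h2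
  · rw [IsLocalization.lift_eq]
    have := hχ (C s) (mem_chart.2 ⟨_, rfl⟩)
    refine (Eq.trans ?_ this).trans (eval₂_C _ _)
    exact congrArg χ (Subtype.ext (by simp))
  · rw [IsLocalization.lift_eq]
    have := hχ X (mem_chart.2 ⟨_, rfl⟩)
    refine (Eq.trans ?_ this).trans (eval₂_X _ _)
    exact congrArg χ (Subtype.ext (by simp))

/-- `V` is a localization of a finitely generated `B`-algebra. -/
def EssFin (B : Subring K) (V : ValuationSubring K) : Prop :=
  ∃ F : Finset K, (∀ f ∈ F, f ∈ V) ∧ ∀ v ∈ V, ∃ g ∈ Subring.closure (B ∪ F : Set K), ∃ h ∈ Subring.closure (B ∪ F : Set K),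
    V.valuation h = 1 ∧ v = g / h

theorem exists_derLift_of_le {S : Subring K} (φ : DerLift V E S) (hV : V.toSubring ≤ S) :
    ∃ ψ : V →+* TrivSqZeroExt V E, (∀ v, (ψ v).fst = v) ∧
      ∀ (s : S) (hs : (s : K) ∈ V), ψ ⟨s, hs⟩ = φ.hom s :=
  ⟨φ.hom.comp (Subring.inclusion hV : V.toSubring →+* S), fun _ => Subtype.ext (φ.fst_coe _),
    fun _ _ => rfl⟩

theorem exists_coordinate {S : Subring K} [IsLocalRing S] [IsNoetherianRing S] {x y : S}
    (h : RegPair x y) (V : ValuationSubring K) :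
    ∃ (x' y' : S) (z : K), RegPair x' y' ∧ (x' : K) * z = y' ∧ z ∈ V ∧
      ((x' = x ∧ y' = y) ∨ (x' = y ∧ y' = x)) := by
  have hx0 : (x : K) ≠ 0 := fun e => h.prime.ne_zero (Subtype.ext e)
  have hy0 : (y : K) ≠ 0 := fun e => h.symm.prime.ne_zero (Subtype.ext e)
  rcases V.mem_or_inv_mem ((y : K) / x) with hz | hz
  · exact ⟨x, y, y / x, h, mul_div_cancel₀ _ hx0, hz, Or.inl ⟨rfl, rfl⟩⟩
  · exact ⟨y, x, x / y, h.symm, mul_div_cancel₀ _ hy0, by rwa [inv_div] at hz, Or.inr ⟨rfl, rfl⟩⟩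

/-- Follow the quadratic transforms of `S` along `V`. The equation for the new `dz` is solvable at
each stage because `E` is divisible. The number `N` bounds the values of denominators in `S` of the
generators `F` of `V`; it drops at each transform, and at `N = 0` the ring `S` contains `F`, hence
all of `V`. -/
theorem exists_extension_of_pow {ϖ : K} (hϖ0 : ϖ ≠ 0) (hϖV : ϖ ∈ V)
    (hϖ : ∀ v : K, V.valuation v < 1 → v / ϖ ∈ V)
    (hdiv : ∀ (v : V) (e : E), v ≠ 0 → ∃ e', v • e' = e) {F : Finset K} (hFV : ∀ f ∈ F, f ∈ V)
    (N : ℕ) : ∀ (S : Subring K) [IsLocalRing S] [IsNoetherianRing S] [IsFractionRing S K]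
      (x y : S) (_ : RegPair x y) (_ : Dominates V S) (φ : DerLift V E S)
      (_ : ∀ v ∈ V, ∃ g ∈ Subring.closure (S ∪ F : Set K), ∃ h ∈ Subring.closure (S ∪ F : Set K),
        V.valuation h = 1 ∧ v = g / h)
      (_ : ∀ f ∈ F, ∃ c ∈ S, c ≠ 0 ∧ c * f ∈ S ∧ ϖ ^ N / c ∈ V),
      ∃ ψ : V →+* TrivSqZeroExt V E, (∀ v, (ψ v).fst = v) ∧
        ∀ (s : S) (hs : (s : K) ∈ V), ψ ⟨s, hs⟩ = φ.hom s := by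
  induction N with
  | zero =>
    intro S _ _ _ x y h hdom φ hgen hF
    have hFS : (F : Set K) ⊆ S := by
      intro f hf
      obtain ⟨c, hc, hc0, hcf, hcV⟩ := hF f hf
      have h1 : V.valuation c = 1 := by
        refine le_antisymm ((V.valuation_le_one_iff _).2 (hdom.le hc)) ?_
        rw [pow_zero, one_div, ← V.valuation_le_one_iff, map_inv₀] at hcV
        exact (inv_le_one₀ (zero_lt_iff.2 ((_root_.map_ne_zero _).2 hc0))).1 hcV
      have h2 := S.mul_mem (hdom.inv_mem hc h1) hcf
      rwa [inv_mul_cancel_left₀ hc0] at h2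
    have hcl : Subring.closure (S ∪ F : Set K) ≤ S :=
      Subring.closure_le.2 (Set.union_subset le_rfl hFS)
    refine exists_derLift_of_le φ fun v hv => ?_
    obtain ⟨g, hg, d, hd, hd1, rfl⟩ := hgen v hv
    rw [div_eq_mul_inv]
    exact S.mul_mem (hcl hg) (hdom.inv_mem (hcl hd) hd1)
  | succ N ih =>
    intro S _ _ _ x y h hdom φ hgen hF
    obtain ⟨x, y, z, h, hz, hzV, -⟩ := exists_coordinate h V
    have hx0 : (x : K) ≠ 0 := fun e => h.prime.ne_zero (Subtype.ext e)
    have hS : chart S z ≤ V.toSubring := chart_le hdom.le hzV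
    obtain ⟨e, he⟩ := hdiv (φ.hom x).fst ((φ.hom y).snd - (⟨z, hzV⟩ : V) • (φ.hom x).snd)
      (fun e => hx0 (by rw [← φ.fst_coe, e]; rfl))
    obtain ⟨φ', hφ', -⟩ := exists_derLift_locSub h hz φ hzV e he hS
    have hext : (∃ ψ : V →+* TrivSqZeroExt V E, (∀ v, (ψ v).fst = v) ∧
        ∀ (s : locSub (chart S z) (center V hS)) (hs : (s : K) ∈ V), ψ ⟨s, hs⟩ = φ'.hom s) →
        ∃ ψ : V →+* TrivSqZeroExt V E, (∀ v, (ψ v).fst = v) ∧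
        ∀ (s : S) (hs : (s : K) ∈ V), ψ ⟨s, hs⟩ = φ.hom s := by
      rintro ⟨ψ, h1, h2⟩
      refine ⟨ψ, h1, fun s hs => ?_⟩
      rw [← hφ']
      exact h2 (algebraMap _ _ (toChart z s)) hs
    refine hext ?_
    have hdom' := dominates_locSub_center hS
    have hxc : toChart z x ∈ center V hS := hdom.lt_one x h.left_mem
    -- If the center is the generic point of the exceptional fibre, the new local ring is `V`
    -- itself; otherwise it is again regular of dimension two.
    by_cases hc : center V hS = Ideal.span {toChart z x}
    · refine exists_derLift_of_le φ' ?_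
      have hp : (Ideal.span {toChart z x}).IsPrime := hc ▸ inferInstance
      have h3 := eq_ordVal h hz hS hc
      intro v hv
      have h4 : v ∈ (ordVal h hz).toSubring := h3 ▸ hv
      rw [ordVal_toSubring] at h4
      obtain ⟨g, d, hd, e⟩ := h4
      exact ⟨g, d, hc ▸ hd, e⟩
    obtain ⟨f, hf⟩ := exists_regPair_locSub h hz (center V hS) hxc hc
    have hSS : S ≤ locSub (chart S z) (center V hS) := le_chart.trans (le_locSub _ _)
    refine ih _ _ _ hf hdom' φ' (fun v hv => ?_) (fun f hf => ?_)
    · obtain ⟨g, hg, d, hd, hd1, e⟩ := hgen v hv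
      have hmono : Subring.closure (S ∪ F : Set K) ≤
          Subring.closure (locSub (chart S z) (center V hS) ∪ F : Set K) :=
        Subring.closure_mono (Set.union_subset_union_left _ hSS)
      exact ⟨g, hmono hg, d, hmono hd, hd1, e⟩
    · obtain ⟨c, hc, hc0, hcf, hcV⟩ := hF f hf
      -- If `c` is a nonunit then so is `c * f`, as `f` lies in `V`. Both become divisible by `x` in
      -- the next ring, which uses up one factor `ϖ`. If `c` is a unit, `f` already lies in `S` and
      -- the denominator `1` serves.
      by_cases hcm : (⟨c, hc⟩ : S) ∈ maximalIdeal S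
      · have hdivx : ∀ b : S, b ∈ maximalIdeal S → (b : K) / x ∈ locSub (chart S z) (center V hS) := by
          intro b hb
          rw [h.max, Ideal.mem_span_pair] at hb
          obtain ⟨p, q, rfl⟩ := hb
          have : ((p * x + q * y : S) : K) / x = p + q * z := by
            push_cast; rw [← hz]; field_simp
          rw [this]
          exact le_locSub _ _ (add_mem (le_chart p.2) (mul_mem (le_chart q.2) mem_chart_self))
        have hfm : (⟨c * f, hcf⟩ : S) ∈ maximalIdeal S := by
          by_contra hcon
          have h5 := (hdom.valuation_eq_one_iff _).2 hcon
          have h6 := hdom.lt_one _ hcm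
          have h7 := (V.valuation_le_one_iff _).2 (hFV f hf)
          change V.valuation (c * f) = 1 at h5
          rw [map_mul] at h5
          exact absurd h5 ((mul_le_of_le_one_right' h7).trans_lt h6).ne
        refine ⟨c / x, hdivx _ hcm, div_ne_zero hc0 hx0, ?_, ?_⟩
        · have := hdivx _ hfm
          convert! this using 1
          exact div_mul_eq_mul_div _ _ _
        · have h8 := V.mul_mem _ _ hcV (hϖ x (hdom.lt_one x h.left_mem))
          convert! h8 using 1
          field_simp
          ring
      · refine ⟨1, one_mem _, one_ne_zero, ?_, ?_⟩
        · have h1 := (hdom.valuation_eq_one_iff _).2 hcm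
          have h2 := S.mul_mem (hdom.inv_mem hc h1) hcf
          rw [inv_mul_cancel_left₀ hc0] at h2
          rw [one_mul]; exact hSS h2
        · rw [div_one]; exact pow_mem hϖV N

theorem valuation_coe_lt_one_iff {V : ValuationSubring K} {v : V} :
    V.valuation v < 1 ↔ v ∈ maximalIdeal V := (V.valuation_lt_one_iff v).symm

/-- The first blow-up is separated from the others: there `dx = dy = 0`, so `dz` may be prescribed
as any `e` killed by `x`. The values chosen at the later stages do not matter. -/
theorem exists_extension {B : Subring K} [IsLocalRing B] [IsNoetherianRing B] [IsFractionRing B K]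
    {x y : B} {z : K} (h : RegPair x y) (hz : (x : K) * z = y) [IsNoetherianRing V]
    (hdom : Dominates V B) (hV : EssFin B V) (hzV : z ∈ V)
    (hdiv : ∀ (v : V) (e : E), v ≠ 0 → ∃ e', v • e' = e) (e : E)
    (he : (⟨x, hdom.le x.2⟩ : V) • e = 0) :
    ∃ ψ : V →+* TrivSqZeroExt V E, (∀ v, (ψ v).fst = v) ∧
      (∀ (b : B), ψ ⟨b, hdom.le b.2⟩ = TrivSqZeroExt.inl ⟨b, hdom.le b.2⟩) ∧
      (ψ ⟨z, hzV⟩).snd = e := by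
  have hx0 : (x : K) ≠ 0 := fun e => h.prime.ne_zero (Subtype.ext e)
  obtain ⟨F, hFV, hgen⟩ := hV
  have hS : chart B z ≤ V.toSubring := chart_le hdom.le hzV
  let φ : DerLift V E B := ⟨(TrivSqZeroExt.inlHom V E).comp (Subring.inclusion hdom.le : B →+* V.toSubring),
    fun _ => rfl⟩
  have hφ : ∀ b, φ.hom b = TrivSqZeroExt.inl ⟨b, hdom.le b.2⟩ := fun _ => rfl
  obtain ⟨φ', hφ', hφz⟩ := exists_derLift_locSub h hz φ hzV e (by
    simp only [hφ, TrivSqZeroExt.fst_inl, TrivSqZeroExt.snd_inl, smul_zero, sub_zero]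
    exact he) hS
  suffices hext : ∃ ψ : V →+* TrivSqZeroExt V E, (∀ v, (ψ v).fst = v) ∧
      ∀ (s : locSub (chart B z) (center V hS)) (hs : (s : K) ∈ V), ψ ⟨s, hs⟩ = φ'.hom s by
    obtain ⟨ψ, h1, h2⟩ := hext
    refine ⟨ψ, h1, fun b => ?_, ?_⟩
    · rw [← hφ, ← hφ']
      exact h2 (algebraMap _ _ (toChart z b)) (hdom.le b.2)
    · have := h2 (algebraMap _ _ (⟨z, mem_chart_self⟩ : chart B z)) hzV
      rw [hφz] at this
      have h3 := congrArg TrivSqZeroExt.snd this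
      simpa using h3
  have hxc : toChart z x ∈ center V hS := hdom.lt_one x h.left_mem
  by_cases hc : center V hS = Ideal.span {toChart z x}
  · refine exists_derLift_of_le φ' ?_
    have hp : (Ideal.span {toChart z x}).IsPrime := hc ▸ inferInstance
    have h3 := eq_ordVal h hz hS hc
    intro v hv
    have h4 : v ∈ (ordVal h hz).toSubring := h3 ▸ hv
    rw [ordVal_toSubring] at h4
    obtain ⟨g, d, hd, e⟩ := h4
    exact ⟨g, d, hc ▸ hd, e⟩
  obtain ⟨f, hf⟩ := exists_regPair_locSub h hz (center V hS) hxc hc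
  have hSS : B ≤ locSub (chart B z) (center V hS) := le_chart.trans (le_locSub _ _)
  have hpid : IsPrincipalIdealRing V :=
    ((tfae_of_isNoetherianRing_of_isLocalRing_of_isDomain V).out 0 1).2 (inferInstance : ValuationRing V)
  have hdvr : IsDiscreteValuationRing V := by
    refine ⟨fun hbot => hx0 ?_⟩
    have h1 : (⟨x, hdom.le x.2⟩ : V) ∈ maximalIdeal V :=
      valuation_coe_lt_one_iff.1 (hdom.lt_one x h.left_mem)
    rw [hbot, Ideal.mem_bot] at h1
    exact congrArg Subtype.val h1
  obtain ⟨ϖ, hϖ⟩ := IsDiscreteValuationRing.exists_irreducible V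
  have hϖ0 : (ϖ : K) ≠ 0 := fun e => hϖ.ne_zero (Subtype.ext e)
  have hmax := hϖ.maximalIdeal_eq
  have hden : ∀ f : K, ∃ N : ℕ, ∀ M, N ≤ M → ∃ c ∈ B, c ≠ 0 ∧ c * f ∈ B ∧ (ϖ : K) ^ M / c ∈ V := by
    intro f
    obtain ⟨b, c, hc, rfl⟩ := IsFractionRing.div_surjective B f
    have hc0 : (c : K) ≠ 0 := fun e => nonZeroDivisors.ne_zero hc (Subtype.ext e)
    obtain ⟨N, u, hu⟩ := IsDiscreteValuationRing.associated_pow_irreducible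
      (x := (⟨c, hdom.le c.2⟩ : V)) (fun e => hc0 (congrArg Subtype.val e)) hϖ
    refine ⟨N, fun M hM => ⟨c, c.2, hc0, ?_, ?_⟩⟩
    · change (c : K) * ((b : K) / c) ∈ B
      rw [mul_div_cancel₀ _ hc0]; exact b.2
    · have h1 : (c : K) * (u : V) = (ϖ : K) ^ N := congrArg Subtype.val hu
      have h2 : (ϖ : K) ^ M / c = (ϖ : K) ^ (M - N) * (u : V) := by
        rw [div_eq_iff hc0, mul_assoc, mul_comm ((u : V) : K), h1, ← pow_add, Nat.sub_add_cancel hM]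
      rw [h2]
      exact V.mul_mem _ _ (pow_mem ϖ.2 _) (u : V).2
  choose N hN using hden
  refine exists_extension_of_pow hϖ0 ϖ.2 (fun v hv => ?_) hdiv hFV (F.sup N) _ _ f hf
    (dominates_locSub_center hS) φ' (fun v hv => ?_) (fun f hf => ?_)
  · have hvV : v ∈ V := (V.valuation_le_one_iff _).1 hv.le
    have h1 : (⟨v, hvV⟩ : V) ∈ maximalIdeal V := valuation_coe_lt_one_iff.1 hv
    rw [hmax, Ideal.mem_span_singleton] at h1
    obtain ⟨w, hw⟩ := h1
    have : v = ϖ * w := congrArg Subtype.val hw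
    rw [this, mul_div_cancel_left₀ _ hϖ0]
    exact w.2
  · obtain ⟨g, hg, d, hd, hd1, e⟩ := hgen v hv
    have hmono : Subring.closure (B ∪ F : Set K) ≤
        Subring.closure (locSub (chart B z) (center V hS) ∪ F : Set K) :=
      Subring.closure_mono (Set.union_subset_union_left _ hSS)
    exact ⟨g, hmono hg, d, hmono hd, hd1, e⟩
  · obtain ⟨c, hc, hc0, hcf, hcV⟩ := hN f _ (Finset.le_sup hf)
    exact ⟨c, hSS hc, hc0, hSS hcf, hcV⟩

end Extension

end AdjointIdeals

end

/-! ### Relative Jacobian ideals and their behaviour under blowing up. -/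

section

open IsLocalRing Polynomial KaehlerDifferential

namespace AdjointIdeals

variable {K : Type*} [Field K]

/-- The submodule of `Ω[V⁄ℤ]` generated by the differentials of the elements of `B`. -/
noncomputable def relSub (V : ValuationSubring K) (B : Subring K) : Submodule V (Ω[V⁄ℤ]) :=
  Submodule.span V {w | ∃ v : V, (v : K) ∈ B ∧ w = D ℤ V v}

/-- The Jacobian ideal of a valuation ring relative to a subring of the field. -/
noncomputable def relJac (V : ValuationSubring K) (B : Subring K) : Ideal V :=
  fittingIdealZero V (Ω[V⁄ℤ] ⧸ relSub V B)

section

variable {V : ValuationSubring K} {B S : Subring K}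

theorem D_mem_relSub {v : V} (hv : (v : K) ∈ B) : D ℤ V v ∈ relSub V B :=
  Submodule.subset_span ⟨v, hv, rfl⟩

theorem relSub_le {N : Submodule V (Ω[V⁄ℤ])} (h : ∀ v : V, (v : K) ∈ B → D ℤ V v ∈ N) :
    relSub V B ≤ N := by
  refine Submodule.span_le.2 ?_
  rintro _ ⟨v, hv, rfl⟩
  exact h v hv

theorem relSub_mono (h : B ≤ S) : relSub V B ≤ relSub V S :=
  relSub_le fun _ hv => D_mem_relSub (h hv)

/-- The subring of elements whose differential lies in a given submodule. -/
noncomputable def constSubring (N : Submodule V (Ω[V⁄ℤ])) : Subring V where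
  carrier := {v | D ℤ V v ∈ N}
  zero_mem' := by simp
  one_mem' := by simp
  add_mem' := fun ha hb => by
    rw [Set.mem_ofPred_eq, map_add]; exact add_mem ha hb
  mul_mem' := fun ha hb => by
    rw [Set.mem_ofPred_eq, Derivation.leibniz]
    exact add_mem (Submodule.smul_mem _ _ hb) (Submodule.smul_mem _ _ ha)
  neg_mem' := fun ha => by
    rw [Set.mem_ofPred_eq, Derivation.map_neg]; exact neg_mem ha

theorem mem_constSubring {N : Submodule V (Ω[V⁄ℤ])} {v : V} : v ∈ constSubring N ↔ D ℤ V v ∈ N :=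
  Iff.rfl

theorem D_mem_of_mem_chart {z : K} (hB : B ≤ V.toSubring) (hz : z ∈ V) {N : Submodule V (Ω[V⁄ℤ])}
    (hN : relSub V B ≤ N) (hzN : D ℤ V ⟨z, hz⟩ ∈ N) {v : V} (hv : (v : K) ∈ chart B z) :
    D ℤ V v ∈ N := by
  obtain ⟨p, hp⟩ := mem_chart.1 hv
  let f : B →+* V := Subring.inclusion hB
  have hf : ∀ b : B, (f b : K) ∈ B := fun b => b.2
  have : v = p.eval₂ f (⟨z, hz⟩ : V) := by
    apply Subtype.ext
    rw [← hp]
    exact (Polynomial.hom_eval₂ p f V.subtype (⟨z, hz⟩ : V)).symm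
  rw [this, ← mem_constSubring, eval₂_eq_sum_range]
  exact sum_mem fun i _ => mul_mem (mem_constSubring.2 (hN (D_mem_relSub (hf _))))
    (pow_mem (mem_constSubring.2 hzN) i)

theorem D_mem_of_mem_locSub {N : Submodule V (Ω[V⁄ℤ])} (hS : S ≤ V.toSubring) {n : Ideal S}
    [n.IsPrime] (hn : center V hS ≤ n) (hN : relSub V S ≤ N) {v : V} (hv : (v : K) ∈ locSub S n) :
    D ℤ V v ∈ N := by
  obtain ⟨g, d, hd, e⟩ := hv
  have h1 : V.valuation d = 1 := notMem_center.1 fun h => hd (hn h)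
  have hu : IsUnit (⟨d, hS d.2⟩ : V) := (V.valuation_eq_one_iff _).2 h1
  have h2 : v * ⟨d, hS d.2⟩ = ⟨g, hS g.2⟩ := Subtype.ext (by
    change (v : K) * d = g
    rw [e, div_mul_cancel₀ _ (ne_zero_of_notMem hd)])
  have h3 := congrArg (D ℤ V) h2
  rw [Derivation.leibniz] at h3
  obtain ⟨u, hu⟩ := hu
  have h4 : (u : V) • D ℤ V v ∈ N := by
    rw [hu, eq_sub_of_add_eq' h3]
    exact sub_mem (hN (D_mem_relSub g.2)) (Submodule.smul_mem _ _ (hN (D_mem_relSub d.2)))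
  have h5 := Submodule.smul_mem N ((u⁻¹ : Vˣ) : V) h4
  rwa [smul_smul, Units.inv_mul, one_smul] at h5

theorem relJac_locSub (hS : S ≤ V.toSubring) {n : Ideal S} [n.IsPrime] (hn : center V hS ≤ n) :
    relSub V (locSub S n) = relSub V S :=
  le_antisymm (relSub_le fun _ hv => D_mem_of_mem_locSub hS hn le_rfl hv)
    (relSub_mono (le_locSub S n))

theorem relJac_self : relJac V V.toSubring = ⊤ := by
  have : relSub V V.toSubring = ⊤ := by
    rw [eq_top_iff, ← span_range_derivation, Submodule.span_le]
    rintro _ ⟨v, rfl⟩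
    exact D_mem_relSub v.2
  have : Subsingleton (Ω[V⁄ℤ] ⧸ relSub V V.toSubring) := by
    rw [this]; infer_instance
  exact fittingIdealZero_eq_top_of_subsingleton

variable [IsLocalRing B] [IsNoetherianRing B] {x y : B} {z : K}

omit [IsLocalRing B] [IsNoetherianRing B] in
theorem ker_factor_relSub_chart (hB : B ≤ V.toSubring) (hzV : z ∈ V) :
    LinearMap.ker (Submodule.factor (relSub_mono (V := V) (le_chart : B ≤ chart B z))) =
      Submodule.span V {(relSub V B).mkQ (D ℤ V ⟨z, hzV⟩)} := by
  apply le_antisymm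
  · intro m hm
    obtain ⟨w, rfl⟩ := (relSub V B).mkQ_surjective m
    have h1 : w ∈ relSub V (chart B z) := by
      have h2 : (relSub V (chart B z)).mkQ w = 0 := hm
      rwa [Submodule.mkQ_apply, Submodule.Quotient.mk_eq_zero] at h2
    have h3 : relSub V (chart B z) ≤ relSub V B ⊔ Submodule.span V {D ℤ V ⟨z, hzV⟩} :=
      relSub_le fun v hv => D_mem_of_mem_chart hB hzV le_sup_left
        (Submodule.mem_sup_right (Submodule.mem_span_singleton_self _)) hv
    obtain ⟨a, ha, b, hb, rfl⟩ := Submodule.mem_sup.1 (h3 h1)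
    obtain ⟨c, rfl⟩ := Submodule.mem_span_singleton.1 hb
    rw [map_add, map_smul, show (relSub V B).mkQ a = 0 from
      (Submodule.Quotient.mk_eq_zero _).2 ha, zero_add]
    exact Submodule.smul_mem _ _ (Submodule.mem_span_singleton_self _)
  · rw [Submodule.span_singleton_le_iff_mem, LinearMap.mem_ker]
    exact (Submodule.Quotient.mk_eq_zero _).2 (D_mem_relSub (mem_chart_self : z ∈ chart B z))

omit [IsLocalRing B] [IsNoetherianRing B] in
theorem smul_mkQ_D_eq_zero (hB : B ≤ V.toSubring) (hzV : z ∈ V) (hz : (x : K) * z = y) :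
    (⟨x, hB x.2⟩ : V) • (relSub V B).mkQ (D ℤ V ⟨z, hzV⟩) = 0 := by
  rw [← map_smul]
  refine (Submodule.Quotient.mk_eq_zero _).2 ?_
  have h1 : (⟨x, hB x.2⟩ : V) * ⟨z, hzV⟩ = ⟨y, hB y.2⟩ := Subtype.ext hz
  have h2 := congrArg (D ℤ V) h1
  rw [Derivation.leibniz] at h2
  rw [eq_sub_of_add_eq h2]
  exact sub_mem (D_mem_relSub y.2) (Submodule.smul_mem _ _ (D_mem_relSub x.2))

omit [IsLocalRing B] [IsNoetherianRing B] in
-- Passing from differentials over `B` to differentials over `B[z]` divides by the submodule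
-- generated by `dz`, and `x dz = dy - z dx` vanishes over `B`.
theorem span_mul_relJac_chart_le (hB : B ≤ V.toSubring) (hzV : z ∈ V) (hz : (x : K) * z = y) :
    Ideal.span {(⟨x, hB x.2⟩ : V)} * relJac V (chart B z) ≤ relJac V B :=
  span_singleton_mul_fittingIdealZero_le _ (Submodule.factor_surjective _)
    (ker_factor_relSub_chart hB hzV).le (smul_mkQ_D_eq_zero hB hzV hz)

omit [IsLocalRing B] [IsNoetherianRing B] in
theorem isPrincipalIdealRing_of_isNoetherianRing [IsNoetherianRing V] : IsPrincipalIdealRing V :=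
  ((tfae_of_isNoetherianRing_of_isLocalRing_of_isDomain V).out 0 1).2 (inferInstance : ValuationRing V)

/-- What has to be shown is that the annihilator of `dz` lies in `(x)`. A derivation into `K/V` that
kills `B` and sends `z` to the class of `1/x` proves it: if `c dz = 0` then `c/x` lies in `V`. -/
theorem relJac_le_span_mul [IsFractionRing B K] [IsNoetherianRing V] (h : RegPair x y)
    (hz : (x : K) * z = y) (hdom : Dominates V B) (hV : EssFin B V) (hzV : z ∈ V) :
    relJac V B ≤ Ideal.span {(⟨x, hdom.le x.2⟩ : V)} * relJac V (chart B z) := by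
  have := isPrincipalIdealRing_of_isNoetherianRing (V := V)
  have hx0 : (x : K) ≠ 0 := fun e => h.prime.ne_zero (Subtype.ext e)
  refine fittingIdealZero_le_span_singleton_mul _ (Submodule.factor_surjective _)
    (ker_factor_relSub_chart hdom.le hzV)
    (valuation_coe_lt_one_iff.1 (hdom.lt_one x h.left_mem)) fun c hc => ?_
  -- The module `K/V` is divisible, as the later transforms demand, and the class of `1/x` is killed
  -- by `x`, as the first one does.
  let E := K ⧸ (1 : Submodule V K)
  let _ : Module Vᵐᵒᵖ E := Module.compHom E ((RingHom.id V).fromOpposite fun _ _ => mul_comm _ _)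
  have : IsCentralScalar V E := ⟨fun _ _ => rfl⟩
  have hdiv : ∀ (v : V) (e : E), v ≠ 0 → ∃ e', v • e' = e := by
    intro v e hv
    obtain ⟨k, rfl⟩ := (1 : Submodule V K).mkQ_surjective e
    refine ⟨(1 : Submodule V K).mkQ ((v : K)⁻¹ * k), ?_⟩
    rw [← map_smul]
    congr 1
    change (v : K) * ((v : K)⁻¹ * k) = k
    exact mul_inv_cancel_left₀ (fun e => hv (Subtype.ext e)) _
  have hmem : ∀ k : K, (1 : Submodule V K).mkQ k = 0 ↔ k ∈ V := by
    intro k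
    rw [Submodule.mkQ_apply, Submodule.Quotient.mk_eq_zero, Submodule.mem_one]
    exact ⟨fun ⟨a, ha⟩ => ha ▸ a.2, fun hk => ⟨⟨k, hk⟩, rfl⟩⟩
  obtain ⟨ψ, hψ1, hψ2, hψ3⟩ := exists_extension (E := E) h hz hdom hV hzV hdiv
    ((1 : Submodule V K).mkQ (x : K)⁻¹) (by
      rw [← map_smul, hmem]
      change (x : K) * (x : K)⁻¹ ∈ V
      rw [mul_inv_cancel₀ hx0]; exact V.one_mem)
  let d : Derivation ℤ V E := Derivation.mk' (AddMonoidHom.toIntLinearMap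
    { toFun := fun v => (ψ v).snd, map_zero' := by simp, map_add' := by simp }) (by
      intro a b
      change (ψ (a * b)).snd = a • (ψ b).snd + b • (ψ a).snd
      rw [map_mul, TrivSqZeroExt.snd_mul, op_smul_eq_smul, hψ1, hψ1])
  have hd : ∀ v, d v = (ψ v).snd := fun _ => rfl
  have hker : relSub V B ≤ LinearMap.ker d.liftKaehlerDifferential := by
    refine relSub_le fun v hv => ?_
    rw [LinearMap.mem_ker, Derivation.liftKaehlerDifferential_comp_D, hd]
    have := hψ2 ⟨v, hv⟩
    change ψ v = _ at this
    rw [this, TrivSqZeroExt.snd_inl]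
  have h1 := congrArg ((relSub V B).liftQ d.liftKaehlerDifferential hker) hc
  rw [map_zero, map_smul, Submodule.mkQ_apply, Submodule.liftQ_apply,
    Derivation.liftKaehlerDifferential_comp_D, hd, hψ3, ← map_smul, hmem] at h1
  exact ⟨⟨_, h1⟩, Subtype.ext (by
    change (c : K) = x * ((c : K) * (x : K)⁻¹)
    field_simp)⟩

end

end AdjointIdeals

end

/-! ### Coefficients of polynomials, Gauss' lemma, and coprimality in separate variables. -/

section

open IsLocalRing Polynomial

namespace AdjointIdeals

section Coefficients

theorem toMvPolynomial_monomial {R σ : Type*} [CommRing R] (i : σ) (n : ℕ) (a : R) :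
    (monomial n a).toMvPolynomial i = MvPolynomial.monomial (Finsupp.single i n) a := by
  rw [← C_mul_X_pow_eq_monomial, map_mul, map_pow, toMvPolynomial_C, toMvPolynomial_X,
    MvPolynomial.C_mul_X_pow_eq_monomial]

theorem coeff_toMvPolynomial_single {R σ : Type*} [CommRing R] (i : σ) (f : R[X]) (k : ℕ) :
    (f.toMvPolynomial i).coeff (Finsupp.single i k) = f.coeff k := by
  classical
  induction f using Polynomial.induction_on' with
  | add p q hp hq => rw [map_add, MvPolynomial.coeff_add, hp, hq, coeff_add]
  | monomial n a =>
    rw [toMvPolynomial_monomial, MvPolynomial.coeff_monomial, coeff_monomial]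
    refine if_congr ⟨fun e => ?_, fun e => by rw [e]⟩ rfl rfl
    simpa using DFunLike.congr_fun e i

theorem coeff_toMvPolynomial_of_ne {R σ : Type*} [CommRing R] (i : σ) (f : R[X]) {m : σ →₀ ℕ}
    (hm : m ≠ Finsupp.single i (m i)) : (f.toMvPolynomial i).coeff m = 0 := by
  classical
  induction f using Polynomial.induction_on' with
  | add p q hp hq => rw [map_add, MvPolynomial.coeff_add, hp, hq, add_zero]
  | monomial n a =>
    rw [toMvPolynomial_monomial, MvPolynomial.coeff_monomial, if_neg]
    rintro rfl
    simp at hm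

theorem map_toMvPolynomial {R S σ : Type*} [CommRing R] [CommRing S] (φ : R →+* S) (i : σ)
    (f : R[X]) : (f.toMvPolynomial i).map φ = (f.map φ).toMvPolynomial i := by
  induction f using Polynomial.induction_on' with
  | add p q hp hq => rw [map_add, map_add, hp, hq, Polynomial.map_add, map_add]
  | monomial n a =>
    rw [toMvPolynomial_monomial, MvPolynomial.map_monomial, map_monomial, toMvPolynomial_monomial]

variable {K : Type*} [Field K] {σ : Type*} {M M' M'' : AddSubgroup K} {P Q : MvPolynomial σ K}

/-- All coefficients of the polynomial lie in the given subgroup. -/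
def CoeffIn (M : AddSubgroup K) (P : MvPolynomial σ K) : Prop := ∀ i, P.coeff i ∈ M

theorem CoeffIn.zero : CoeffIn M (0 : MvPolynomial σ K) := fun i => by
  rw [MvPolynomial.coeff_zero]; exact M.zero_mem

theorem CoeffIn.add (hP : CoeffIn M P) (hQ : CoeffIn M Q) : CoeffIn M (P + Q) := fun i => by
  rw [MvPolynomial.coeff_add]; exact M.add_mem (hP i) (hQ i)

theorem CoeffIn.neg (hP : CoeffIn M P) : CoeffIn M (-P) := fun i => by
  rw [MvPolynomial.coeff_neg]; exact M.neg_mem (hP i)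

theorem CoeffIn.sub (hP : CoeffIn M P) (hQ : CoeffIn M Q) : CoeffIn M (P - Q) := fun i => by
  rw [MvPolynomial.coeff_sub]; exact M.sub_mem (hP i) (hQ i)

theorem CoeffIn.mono (h : M ≤ M') (hP : CoeffIn M P) : CoeffIn M' P := fun i => h (hP i)

theorem CoeffIn.mul (h : ∀ a ∈ M, ∀ b ∈ M', a * b ∈ M'') (hP : CoeffIn M P) (hQ : CoeffIn M' Q) :
    CoeffIn M'' (P * Q) := fun i => by
  classical
  rw [MvPolynomial.coeff_mul]
  exact sum_mem fun k _ => h _ (hP _) _ (hQ _)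

theorem CoeffIn.C_mul {c : K} (h : ∀ a ∈ M, c * a ∈ M') (hP : CoeffIn M P) :
    CoeffIn M' (MvPolynomial.C c * P) := fun i => by
  rw [MvPolynomial.coeff_C_mul]; exact h _ (hP i)

theorem coeffIn_C {c : K} (hc : c ∈ M) : CoeffIn M (MvPolynomial.C c : MvPolynomial σ K) := fun i => by
  classical
  rw [MvPolynomial.coeff_C]
  split_ifs
  exacts [hc, M.zero_mem]

theorem coeffIn_toMvPolynomial {i : σ} {f : K[X]} (hf : ∀ k, f.coeff k ∈ M) :
    CoeffIn M (f.toMvPolynomial i) := fun m => by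
  by_cases hm : m = Finsupp.single i (m i)
  · rw [hm, coeff_toMvPolynomial_single]; exact hf _
  · rw [coeff_toMvPolynomial_of_ne i f hm]; exact M.zero_mem

theorem coeffIn_subring_iff {S : Subring K} :
    CoeffIn S.toAddSubgroup P ↔ ∃ P' : MvPolynomial σ S, P'.map S.subtype = P := by
  constructor
  · intro h
    have : P ∈ (MvPolynomial.map (σ := σ) S.subtype).range := by
      refine MvPolynomial.mem_range_map_iff_coeffs_subset.2 ?_
      rintro c hc
      obtain ⟨i, -, rfl⟩ := MvPolynomial.mem_coeffs_iff.1 hc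
      exact ⟨⟨_, h i⟩, rfl⟩
    exact this
  · rintro ⟨P', rfl⟩ i
    rw [MvPolynomial.coeff_map]
    exact (P'.coeff i).2

theorem CoeffIn.mul_subring {S : Subring K} (hP : CoeffIn S.toAddSubgroup P)
    (hQ : CoeffIn S.toAddSubgroup Q) : CoeffIn S.toAddSubgroup (P * Q) :=
  hP.mul (fun _ ha _ hb => S.mul_mem ha hb) hQ

theorem exists_add_of_coeffIn (h : ∀ i, ∃ a ∈ M, ∃ b ∈ M', P.coeff i = a + b) :
    ∃ P₁ P₂, CoeffIn M P₁ ∧ CoeffIn M' P₂ ∧ P = P₁ + P₂ := by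
  classical
  choose a ha b hb e using h
  have key : ∀ (N : AddSubgroup K) (c : (σ →₀ ℕ) → K), (∀ i, c i ∈ N) →
      CoeffIn N (∑ i ∈ P.support, MvPolynomial.monomial i (c i)) := by
    intro N c hc j
    rw [MvPolynomial.coeff_sum]
    refine sum_mem fun i _ => ?_
    rw [MvPolynomial.coeff_monomial]
    split_ifs
    exacts [hc i, N.zero_mem]
  refine ⟨_, _, key M a ha, key M' b hb, ?_⟩
  rw [← Finset.sum_add_distrib]
  conv_lhs => rw [P.as_sum]
  refine Finset.sum_congr rfl fun i _ => ?_
  rw [← map_add, e]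

/-- Gauss' lemma for a valuation. -/
theorem valuation_coeff_le_of_mul {V : ValuationSubring K} {γ : V.ValueGroup}
    (hP : CoeffIn V.toSubring.toAddSubgroup P) (hP1 : ∃ i, V.valuation (P.coeff i) = 1)
    (hPQ : ∀ i, V.valuation ((P * Q).coeff i) ≤ γ) (i : σ →₀ ℕ) : V.valuation (Q.coeff i) ≤ γ := by
  by_cases hQ : Q = 0
  · simp [hQ]
  -- Divide `Q` by a coefficient `ε` of largest value. Then `P` and `Q/ε` have coefficients in `V`
  -- and nonzero reductions over the residue field, so some coefficient of `PQ` has exactly the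
  -- value of `ε`.
  obtain ⟨i₀, hi₀, hmax⟩ := Finset.exists_max_image Q.support (fun i => V.valuation (Q.coeff i))
    (MvPolynomial.support_nonempty.2 hQ)
  set ε := Q.coeff i₀ with hε
  have hε0 : ε ≠ 0 := MvPolynomial.mem_support_iff.1 hi₀
  have hmax' : ∀ i, V.valuation (Q.coeff i) ≤ V.valuation ε := by
    intro i
    by_cases h : i ∈ Q.support
    · exact hmax i h
    · rw [MvPolynomial.notMem_support_iff.1 h, map_zero]; exact zero_le
  refine (hmax' i).trans ?_
  obtain ⟨P', rfl⟩ := coeffIn_subring_iff.1 hP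
  have hQ' : CoeffIn V.toSubring.toAddSubgroup (MvPolynomial.C ε⁻¹ * Q) := by
    intro i
    rw [MvPolynomial.coeff_C_mul]
    refine (V.valuation_le_one_iff _).1 ?_
    rw [map_mul, map_inv₀]
    have h0 : V.valuation ε ≠ 0 := (_root_.map_ne_zero _).2 hε0
    calc (V.valuation ε)⁻¹ * V.valuation (Q.coeff i) ≤ (V.valuation ε)⁻¹ * V.valuation ε := by
          gcongr; exact hmax' i
      _ = 1 := inv_mul_cancel₀ h0
  obtain ⟨Q', hQ'⟩ := coeffIn_subring_iff.1 hQ'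
  let ρ : V.toSubring →+* ResidueField V := residue V
  have hρ : ∀ a : V.toSubring, ρ a ≠ 0 ↔ V.valuation a = 1 := by
    intro a
    change residue V (⟨a, a.2⟩ : V) ≠ 0 ↔ _
    rw [Ne, residue_eq_zero_iff, ← valuation_coe_lt_one_iff, not_lt]
    exact ⟨fun h => le_antisymm ((V.valuation_le_one_iff _).2 a.2) h, fun h => h.ge⟩
  have h1 : P'.map ρ ≠ 0 := by
    obtain ⟨i, hi⟩ := hP1
    rw [MvPolynomial.coeff_map] at hi
    intro e
    have := congrArg (MvPolynomial.coeff i) e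
    rw [MvPolynomial.coeff_map, MvPolynomial.coeff_zero] at this
    exact (hρ _).2 hi this
  have h2 : Q'.map ρ ≠ 0 := by
    intro e
    have h3 := congrArg (MvPolynomial.coeff i₀) e
    rw [MvPolynomial.coeff_map, MvPolynomial.coeff_zero] at h3
    refine (hρ _).2 ?_ h3
    have h4 := congrArg (MvPolynomial.coeff i₀) hQ'
    rw [MvPolynomial.coeff_map, MvPolynomial.coeff_C_mul, ← hε, inv_mul_cancel₀ hε0] at h4
    rw [show ((Q'.coeff i₀ : V.toSubring) : K) = 1 from h4, map_one]
  have h3 : (P' * Q').map ρ ≠ 0 := by rw [map_mul]; exact mul_ne_zero h1 h2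
  obtain ⟨j, hj⟩ := MvPolynomial.ne_zero_iff.1 h3
  rw [MvPolynomial.coeff_map, hρ] at hj
  have h4 : P'.map V.toSubring.subtype * Q = MvPolynomial.C ε * (P' * Q').map V.toSubring.subtype := by
    rw [map_mul, hQ', mul_left_comm, ← mul_assoc (MvPolynomial.C ε), ← map_mul,
      mul_inv_cancel₀ hε0, map_one, one_mul]
  have h5 := hPQ j
  rw [h4, MvPolynomial.coeff_C_mul, MvPolynomial.coeff_map, map_mul] at h5
  rw [show V.valuation (V.toSubring.subtype ((P' * Q').coeff j)) = 1 from hj, mul_one] at h5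
  exact h5

end Coefficients

section Coprime

theorem degreeOf_toMvPolynomial_eq_zero {R σ : Type*} [CommRing R] {i j : σ} (hij : i ≠ j)
    (f : R[X]) : (f.toMvPolynomial i).degreeOf j = 0 := by
  rw [← Nat.le_zero, MvPolynomial.degreeOf_le_iff]
  intro m hm
  by_contra hj
  rw [Nat.le_zero] at hj
  refine MvPolynomial.mem_support_iff.1 hm (coeff_toMvPolynomial_of_ne i f fun e => hj ?_)
  rw [e, Finsupp.single_eq_of_ne (by exact hij.symm)]

/-- A divisor of a nonzero polynomial in one variable has degree zero in the other, so a common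
divisor is a constant, and it divides all coefficients of `g`. -/
theorem isRelPrime_toMvPolynomial {R : Type*} [CommRing R] [IsDomain R] {f g : R[X]}
    (hf : f ≠ 0) (hg : ∀ c, (∀ k, c ∣ g.coeff k) → IsUnit c) :
    IsRelPrime (f.toMvPolynomial (0 : Fin 2)) (g.toMvPolynomial (1 : Fin 2)) := by
  have hg0 : g ≠ 0 := by
    rintro rfl
    exact not_isUnit_zero (hg 0 (by simp))
  have hdeg : ∀ {i j : Fin 2} (hij : i ≠ j) {f : R[X]} (hf : f ≠ 0) {d : MvPolynomial (Fin 2) R},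
      d ∣ f.toMvPolynomial i → d.degreeOf j = 0 := by
    rintro i j hij f hf d ⟨e, he⟩
    have h0 := degreeOf_toMvPolynomial_eq_zero hij f
    have hne : f.toMvPolynomial i ≠ 0 := (map_ne_zero_iff _ (toMvPolynomial_injective i)).2 hf
    rw [he] at h0 hne
    rw [MvPolynomial.degreeOf_mul_eq (left_ne_zero_of_mul hne) (right_ne_zero_of_mul hne)] at h0
    omega
  intro d h0 h1
  have hd : d = MvPolynomial.C (d.coeff 0) := by
    rw [← MvPolynomial.vars_eq_empty_iff_eq_C]
    refine Finset.eq_empty_of_forall_notMem fun i hi => ?_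
    have : d.degreeOf i = 0 := by
      fin_cases i
      · exact hdeg (by decide) hg0 h1
      · exact hdeg (by decide) hf h0
    rw [← Nat.le_zero, MvPolynomial.degreeOf_le_iff] at this
    obtain ⟨m, hm, him⟩ := (MvPolynomial.mem_vars_iff_mem_support i).1 hi
    exact Finsupp.mem_support_iff.1 him (Nat.le_zero.1 (this m hm))
  rw [hd] at h1 ⊢
  rw [MvPolynomial.C_dvd_iff_dvd_coeff] at h1
  refine (hg _ fun k => ?_).map MvPolynomial.C
  have := h1 (Finsupp.single 1 k)
  rwa [coeff_toMvPolynomial_single] at this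

variable {K : Type*} [Field K]

/-- The ideal of `B` generated by the coefficients (lying in `B`) of a polynomial over `K`. -/
def contIdeal (B : Subring K) (f : K[X]) : Ideal B := Ideal.span {b : B | ∃ k, (b : K) = f.coeff k}

theorem exists_map_eq {B : Subring K} {f : K[X]} (hf : ∀ k, f.coeff k ∈ B) :
    ∃ f' : B[X], f'.map B.subtype = f := by
  have : f ∈ (mapRingHom B.subtype).range := by
    rw [mem_map_range]
    exact fun k => ⟨⟨_, hf k⟩, rfl⟩
  exact this

theorem isRelPrime_of_pow_le_contIdeal {B : Subring K} [IsLocalRing B] [IsNoetherianRing B]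
    {x y : B} (h : RegPair x y) {f g : B[X]} (hf : f ≠ 0)
    (hgN : ∃ N, maximalIdeal B ^ N ≤ contIdeal B (g.map B.subtype)) :
    IsRelPrime (f.toMvPolynomial (0 : Fin 2)) (g.toMvPolynomial (1 : Fin 2)) := by
  refine isRelPrime_toMvPolynomial hf fun c hc => ?_
  obtain ⟨N, hN⟩ := hgN
  refine h.isUnit_of_pow_le_span (hN.trans (Ideal.span_le.2 ?_))
  rintro b ⟨k, hk⟩
  rw [coeff_map] at hk
  rw [show b = g.coeff k from Subtype.ext hk]
  exact Ideal.mem_span_singleton.2 (hc k)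

/-- Exactness of the Koszul complex of `f(T₀)`, `g(T₁)` over the factorial ring `B[T₀,T₁]`.
Coprimality is the reason for putting `f` and `g` in separate variables. -/
theorem exists_eq_mul_of_toMvPolynomial_mul_eq {B : Subring K} [IsLocalRing B] [IsNoetherianRing B]
    {x y : B} (h : RegPair x y) {f g : K[X]} (hf : ∀ k, f.coeff k ∈ B) (hg : ∀ k, g.coeff k ∈ B)
    (hf' : f ≠ 0) (hgN : ∃ N, maximalIdeal B ^ N ≤ contIdeal B g)
    {s t : MvPolynomial (Fin 2) K} (hs : CoeffIn B.toAddSubgroup s) (ht : CoeffIn B.toAddSubgroup t)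
    (e : f.toMvPolynomial 0 * s = g.toMvPolynomial 1 * t) :
    ∃ w, CoeffIn B.toAddSubgroup w ∧ s = g.toMvPolynomial 1 * w ∧ t = f.toMvPolynomial 0 * w := by
  have := h.uniqueFactorizationMonoid
  obtain ⟨f, rfl⟩ := exists_map_eq hf
  obtain ⟨g, rfl⟩ := exists_map_eq hg
  obtain ⟨s, rfl⟩ := coeffIn_subring_iff.1 hs
  obtain ⟨t, rfl⟩ := coeffIn_subring_iff.1 ht
  have hinj : Function.Injective (MvPolynomial.map (σ := Fin 2) B.subtype) :=
    MvPolynomial.map_injective _ B.subtype_injective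
  have hf0 : f ≠ 0 := by rintro rfl; simp at hf'
  have hrel := isRelPrime_of_pow_le_contIdeal h hf0 hgN
  rw [← map_toMvPolynomial, ← map_toMvPolynomial, ← map_mul, ← map_mul] at e
  have e' := hinj e
  obtain ⟨w, rfl⟩ := hrel.symm.dvd_of_dvd_mul_left (⟨t, e'⟩ : _ ∣ _ * s)
  have hg0 : g.toMvPolynomial (1 : Fin 2) ≠ 0 := by
    intro h0
    rw [h0] at hrel
    have := (isRelPrime_zero_right).1 hrel
    have h2 : g = 0 := (map_eq_zero_iff _ (toMvPolynomial_injective (1 : Fin 2))).1 h0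
    obtain ⟨N, hN⟩ := hgN
    have h3 : contIdeal B (g.map B.subtype) ≤ Ideal.span {0} := by
      refine Ideal.span_le.2 ?_
      rintro b ⟨k, hk⟩
      rw [h2] at hk
      rw [show b = 0 from Subtype.ext (by simpa using hk)]
      exact Ideal.mem_span_singleton_self _
    exact not_isUnit_zero (h.isUnit_of_pow_le_span (hN.trans h3))
  refine ⟨w.map B.subtype, coeffIn_subring_iff.2 ⟨w, rfl⟩, ?_, ?_⟩
  · rw [← map_toMvPolynomial, ← map_mul]
  · rw [← map_toMvPolynomial, ← map_mul]
    congr 1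
    refine mul_left_cancel₀ hg0 ?_
    rw [← e']; ring

end Coprime

end AdjointIdeals

end

/-! ### Powers of the maximal ideal seen from the two charts. -/

section

open IsLocalRing Polynomial

namespace AdjointIdeals

variable {K : Type*} [Field K]

section ChartArithmetic

variable {B : Subring K} [IsLocalRing B] {x y : B} {z : K}

theorem exists_eval₂_eq_of_mem_pow (h : RegPair x y) (hz : (x : K) * z = y) {k : ℕ} {b : B}
    (hb : b ∈ maximalIdeal B ^ k) :
    ∃ p : B[X], p.natDegree ≤ k ∧ (x : K) ^ k * p.eval₂ B.subtype z = b := by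
  induction k generalizing b with
  | zero => exact ⟨C b, by simp, by simp⟩
  | succ k ih =>
    rw [pow_succ'] at hb
    induction hb using Submodule.mul_induction_on' with
    | mem_mul_mem a ha c hc =>
      obtain ⟨p, hp, e⟩ := ih hc
      rw [h.max, Ideal.mem_span_pair] at ha
      obtain ⟨u, w, rfl⟩ := ha
      refine ⟨(C u + C w * X) * p, ?_, ?_⟩
      · refine natDegree_mul_le.trans ?_
        have : (C u + C w * X).natDegree ≤ 1 := by
          rw [add_comm]; exact natDegree_linear_le
        omega
      · push_cast
        rw [← e, ← hz]
        simp [eval₂_mul, eval₂_add]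
        ring
    | add a _ c _ ha hc =>
      obtain ⟨p, hp, e⟩ := ha
      obtain ⟨q, hq, e'⟩ := hc
      refine ⟨p + q, (natDegree_add_le _ _).trans (max_le hp hq), ?_⟩
      push_cast
      rw [eval₂_add, mul_add, e, e']

theorem mem_pow_of_eq_pow_mul_eval₂ (h : RegPair x y) (hz : (x : K) * z = y) {k j : ℕ} {p : B[X]}
    (hp : p.natDegree ≤ k) (hj : ∀ i, p.coeff i ∈ maximalIdeal B ^ j) {b : B}
    (hb : (b : K) = (x : K) ^ k * p.eval₂ B.subtype z) : b ∈ maximalIdeal B ^ (j + k) := by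
  have : b = ∑ i ∈ Finset.range (k + 1), p.coeff i * (x ^ (k - i) * y ^ i) := by
    refine Subtype.ext ?_
    rw [hb, eval₂_eq_sum_range' _ (Nat.lt_succ_of_le hp), Finset.mul_sum]
    push_cast
    refine Finset.sum_congr rfl fun i hi => ?_
    have hi' : k - i + i = k := by have := Finset.mem_range.1 hi; omega
    have e : (x : K) ^ k = x ^ (k - i) * x ^ i := by rw [← pow_add, hi']
    rw [e, ← hz, Subring.subtype_apply]
    ring
  rw [this, pow_add (maximalIdeal B)]
  refine Ideal.sum_mem _ fun i hi => Ideal.mul_mem_mul (hj i) ?_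
  have hi' : k - i + i = k := by have := Finset.mem_range.1 hi; omega
  rw [← hi', pow_add (maximalIdeal B), hi']
  exact Ideal.mul_mem_mul (Ideal.pow_mem_pow h.left_mem _) (Ideal.pow_mem_pow h.right_mem _)

/-- Write `b = x ^ k * p(z)` with `p` of degree at most `k`. Divisibility by `x` in the chart puts
the coefficients of `p` in the maximal ideal, which raises the degree of the form by one. -/
theorem mem_pow_succ_of_dvd (h : RegPair x y) (hz : (x : K) * z = y) {k : ℕ} {b : B}
    (hb : b ∈ maximalIdeal B ^ k) {a : chart B z} (ha : (b : K) = (x : K) ^ k * a)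
    (hd : toChart z x ∣ a) : b ∈ maximalIdeal B ^ (k + 1) := by
  have hx0 : (x : K) ≠ 0 := fun e => h.prime.ne_zero (Subtype.ext e)
  obtain ⟨p, hp, e⟩ := exists_eval₂_eq_of_mem_pow h hz hb
  have e2 : a = ⟨p.eval₂ B.subtype z, mem_chart.2 ⟨p, rfl⟩⟩ :=
    Subtype.ext (mul_left_cancel₀ (pow_ne_zero k hx0) (by rw [← ha, e]))
  rw [← chartResidue_eq_zero_iff h hz, e2, chartResidue_eval₂] at hd
  rw [add_comm]
  refine mem_pow_of_eq_pow_mul_eval₂ h hz hp (fun i => ?_) e.symm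
  have := congrArg (fun q => q.coeff i) hd
  simpa [coeff_map, residue_eq_zero_iff] using this

theorem exists_chart_of_mem_pow (h : RegPair x y) (hz : (x : K) * z = y) {k : ℕ} {b : B}
    (hb : b ∈ maximalIdeal B ^ k) : ∃ a : chart B z, (b : K) = (x : K) ^ k * a := by
  obtain ⟨p, -, e⟩ := exists_eval₂_eq_of_mem_pow h hz hb
  exact ⟨⟨_, mem_chart.2 ⟨p, rfl⟩⟩, e.symm⟩

/-- The valuation ideals of the order valuation contract to the powers of `m`: the exponent is
raised one step at a time, using that `x` is prime in the chart. -/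
theorem mem_pow_of_eq_pow_mul_locSub (h : RegPair x y) (hz : (x : K) * z = y)
    [(Ideal.span {toChart z x}).IsPrime] {k : ℕ} {b : B}
    {v : K} (hv : v ∈ locSub (chart B z) (Ideal.span {toChart z x})) (hb : (b : K) = (x : K) ^ k * v) :
    b ∈ maximalIdeal B ^ k := by
  have hx0 : (x : K) ≠ 0 := fun e => h.prime.ne_zero (Subtype.ext e)
  obtain ⟨g, d, hd, rfl⟩ := hv
  have hd0 := ne_zero_of_notMem hd
  suffices ∀ j ≤ k, b ∈ maximalIdeal B ^ j from this k le_rfl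
  intro j
  induction j with
  | zero => simp
  | succ j ih =>
    intro hj
    obtain ⟨a, ha⟩ := exists_chart_of_mem_pow h hz (ih (by omega))
    refine mem_pow_succ_of_dvd h hz (ih (by omega)) ha ?_
    rw [Ideal.mem_span_singleton] at hd
    refine ((prime_toChart h hz).dvd_or_dvd (b := d) (a := a) ?_).resolve_right hd
    obtain ⟨i, rfl⟩ : ∃ i, k = j + 1 + i := ⟨k - (j + 1), by omega⟩
    refine ⟨toChart z x ^ i * g, Subtype.ext (mul_left_cancel₀ (pow_ne_zero j hx0) ?_)⟩
    push_cast
    rw [← mul_assoc, ← ha, hb, coe_toChart]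
    field_simp
    ring

omit [IsLocalRing B] in
-- A Laurent polynomial in `z` is the sum of its terms of nonnegative and of negative degree. This
-- is the vanishing of cohomology behind the gluing of the charts.
theorem exists_add_inv_mul_of_pow_mul_mem (hz0 : z ≠ 0) {j : ℕ} {c : K}
    (hc : z ^ j * c ∈ chart B z) : ∃ a ∈ chart B z, ∃ b ∈ chart B z⁻¹, c = a + z⁻¹ * b := by
  induction j generalizing c with
  | zero => exact ⟨c, by simpa using hc, 0, Subring.zero_mem _, by simp⟩
  | succ j ih =>
    obtain ⟨p, hp⟩ := mem_chart.1 hc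
    rw [← divX_mul_X_add p, eval₂_add, eval₂_mul, eval₂_X, eval₂_C] at hp
    obtain ⟨a, ha, b, hb, e⟩ := ih (c := c - (p.coeff 0 : K) * z⁻¹ ^ (j + 1)) (by
      refine mem_chart.2 ⟨p.divX, mul_right_cancel₀ hz0 ?_⟩
      have h1 : z ^ (j + 1) * z⁻¹ ^ (j + 1) = 1 := by rw [← mul_pow, mul_inv_cancel₀ hz0, one_pow]
      rw [eq_sub_of_add_eq hp, Subring.subtype_apply]
      linear_combination (p.coeff 0 : K) * h1)
    refine ⟨a, ha, b + (p.coeff 0 : K) * z⁻¹ ^ j, Subring.add_mem _ hb (Subring.mul_mem _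
      (le_chart (p.coeff 0).2) (Subring.pow_mem _ mem_chart_self _)), ?_⟩
    rw [eq_add_of_sub_eq e, pow_succ]
    ring

omit [IsLocalRing B] in
theorem exists_pow_mul_mem_chart {u : K} (hz0 : z ≠ 0) (hu : u ∈ chart B z⁻¹) :
    ∃ N, ∀ n, N ≤ n → z ^ n * u ∈ chart B z := by
  obtain ⟨p, rfl⟩ := mem_chart.1 hu
  clear hu
  induction p using Polynomial.induction_on' with
  | add p q hp hq =>
    obtain ⟨N, hN⟩ := hp
    obtain ⟨N', hN'⟩ := hq
    refine ⟨max N N', fun n hn => ?_⟩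
    rw [eval₂_add, mul_add]
    exact Subring.add_mem _ (hN n (le_of_max_le_left hn)) (hN' n (le_of_max_le_right hn))
  | monomial i c =>
    refine ⟨i, fun n hn => ?_⟩
    obtain ⟨m, rfl⟩ : ∃ m, n = i + m := ⟨n - i, by omega⟩
    have : z ^ (i + m) * (monomial i c).eval₂ B.subtype z⁻¹ = z ^ m * c := by
      have h1 : z ^ i * z⁻¹ ^ i = 1 := by rw [← mul_pow, mul_inv_cancel₀ hz0, one_pow]
      rw [eval₂_monomial, Subring.subtype_apply]
      linear_combination z ^ m * c * h1
    rw [this]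
    exact Subring.mul_mem _ (Subring.pow_mem _ mem_chart_self _) (le_chart c.2)

theorem exists_pow_mul_mem (h : RegPair x y) (hz : (x : K) * z = y) {u : K} (hu : u ∈ chart B z) :
    ∃ N, ∀ n, N ≤ n → (x : K) ^ n * u ∈ B := by
  obtain ⟨p, rfl⟩ := mem_chart.1 hu
  refine ⟨p.natDegree, fun n hn => ?_⟩
  obtain ⟨b, -, e⟩ := exists_mem_pow_eq_pow_mul_eval₂ h hz p hn
  rw [e]; exact b.2

/-- If `u = p(z)` with `p` of degree greater than `k`, clearing the denominators of `w` shows that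
`x` divides the leading coefficient. Replacing `x * z` by `y` there lowers the degree, until `x ^ k
* u` is a form of degree `k`. -/
theorem exists_mem_pow_of_mem_charts [IsNoetherianRing B] (h : RegPair x y) (hz : (x : K) * z = y)
    {k : ℕ} {u w : K} (hu : u ∈ chart B z) (hw : w ∈ chart B z⁻¹)
    (e : (x : K) ^ k * u = (y : K) ^ k * w) :
    ∃ b ∈ maximalIdeal B ^ k, (b : K) = (x : K) ^ k * u := by
  have hx0 : (x : K) ≠ 0 := fun e => h.prime.ne_zero (Subtype.ext e)
  have hy0 : (y : K) ≠ 0 := fun e => h.symm.prime.ne_zero (Subtype.ext e)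
  have hz0 : z ≠ 0 := by rintro rfl; rw [mul_zero] at hz; exact hy0 hz.symm
  obtain ⟨p, rfl⟩ := mem_chart.1 hu
  clear hu
  induction hd : p.natDegree using Nat.strong_induction_on generalizing p with
  | _ d ih =>
  by_cases hdk : p.natDegree ≤ k
  · obtain ⟨b, hb, e⟩ := exists_mem_pow_eq_pow_mul_eval₂ h hz p hdk
    exact ⟨b, hb, e.symm⟩
  have hyz : (y : K) * z⁻¹ = x := by rw [← hz]; field_simp
  obtain ⟨N, hN⟩ := exists_pow_mul_mem h.symm hyz hw
  obtain ⟨n, hn⟩ : ∃ n, p.natDegree = n + 1 := ⟨p.natDegree - 1, by omega⟩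
  obtain ⟨b, -, hb⟩ := exists_mem_pow_eq_pow_mul_eval₂ h hz (k := n) p.eraseLead (by
    have := p.eraseLead_natDegree_le; omega)
  have e1 : p.eval₂ B.subtype z = p.eraseLead.eval₂ B.subtype z + p.leadingCoeff * z ^ (n + 1) := by
    conv_lhs => rw [← p.eraseLead_add_C_mul_X_pow]
    rw [eval₂_add, eval₂_mul, eval₂_C, eval₂_X_pow, hn]; rfl
  have hx : x ∣ p.leadingCoeff * y ^ (n + 1 + N) := by
    obtain ⟨i, hi⟩ : ∃ i, n + 1 = k + (i + 1) := ⟨n - k, by omega⟩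
    refine ⟨x ^ i * y ^ k * ⟨_, hN N le_rfl⟩ - b * y ^ N, Subtype.ext ?_⟩
    push_cast
    rw [← hb]
    have h3 : (x : K) * (x ^ i * y ^ k * (y ^ N * w)) = x ^ (i + 1) * (y ^ k * w) * y ^ N := by ring
    rw [mul_sub, h3, ← e, e1]
    have h4 : (y : K) ^ (n + 1 + N) = x ^ (n + 1) * z ^ (n + 1) * y ^ N := by
      rw [pow_add _ (n + 1), ← hz, mul_pow]
    have h5 : (x : K) ^ (i + 1) * x ^ k = x ^ (n + 1) := by rw [hi]; ring
    rw [h4, ← mul_assoc ((x : K) ^ (i + 1)), h5]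
    ring
  obtain ⟨c, hc⟩ := (h.prime.dvd_or_dvd hx).resolve_right (h.not_dvd_pow _)
  have e2 : p.eval₂ B.subtype z = (p.eraseLead + C (c * y) * X ^ n).eval₂ B.subtype z := by
    rw [e1, eval₂_add, eval₂_mul, eval₂_C, eval₂_X_pow, hc]
    push_cast
    rw [Subring.subtype_apply, Subring.coe_mul, ← hz]
    ring
  rw [e2] at e ⊢
  refine ih _ ?_ _ e rfl
  have h3 : (C (c * y) * X ^ n).natDegree ≤ n := natDegree_C_mul_X_pow_le _ _
  have h4 := p.eraseLead_natDegree_le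
  have h5 := natDegree_add_le p.eraseLead (C (c * y) * X ^ n)
  have : max p.eraseLead.natDegree (C (c * y) * X ^ n).natDegree ≤ n := max_le (by omega) h3
  omega

theorem CoeffIn.exists_pow {σ : Type*} {M M' : AddSubgroup K} {P : MvPolynomial σ K} {c : K}
    (hc : ∀ a ∈ M, ∃ N, ∀ n, N ≤ n → c ^ n * a ∈ M') (hP : CoeffIn M P) :
    ∃ N, ∀ n, N ≤ n → CoeffIn M' (MvPolynomial.C (c ^ n) * P) := by
  choose N hN using fun i => hc _ (hP i)
  refine ⟨P.support.sup N, fun n hn i => ?_⟩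
  rw [MvPolynomial.coeff_C_mul]
  by_cases hi : i ∈ P.support
  · exact hN i n ((Finset.le_sup hi).trans hn)
  · rw [MvPolynomial.notMem_support_iff.1 hi, mul_zero]; exact M'.zero_mem

end ChartArithmetic

end AdjointIdeals

end

/-! ### From the infinitely near points to a whole chart. -/

section

open IsLocalRing Polynomial

namespace AdjointIdeals

section Height

/-- A prime containing two coprime elements properly contains a nonzero principal prime, so it has
height at least two. The kernel is generated by `x` and `y` and has height at most two. -/
theorem not_lt_ker_map_residue {B : Type*} [CommRing B] [IsDomain B] [IsLocalRing B]
    [IsNoetherianRing B] {x y : B} (h : RegPair x y) {Q : Ideal (MvPolynomial (Fin 2) B)} [Q.IsPrime]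
    {α β : MvPolynomial (Fin 2) B} (hαβ : IsRelPrime α β) (hα0 : α ≠ 0) (hα : α ∈ Q) (hβ : β ∈ Q) :
    ¬ Q < RingHom.ker (MvPolynomial.map (σ := Fin 2) (residue B)) := by
  intro hlt
  have := h.uniqueFactorizationMonoid
  have hQ0 : Q ≠ ⊥ := fun e => hα0 (by rwa [e, Ideal.mem_bot] at hα)
  obtain ⟨π, hπQ, hπ⟩ := Ideal.IsPrime.exists_mem_prime_of_ne_bot (I := Q) inferInstance hQ0
  have hπp : (Ideal.span {π}).IsPrime := (Ideal.span_singleton_prime hπ.ne_zero).2 hπ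
  have h1 : Ideal.span {π} < Q := by
    refine lt_of_le_of_ne ((Ideal.span_singleton_le_iff_mem _).2 hπQ) fun e => ?_
    rw [← e, Ideal.mem_span_singleton] at hα hβ
    exact hπ.not_isUnit (hαβ hα hβ)
  have h0 : (⊥ : Ideal (MvPolynomial (Fin 2) B)) < Ideal.span {π} :=
    bot_lt_iff_ne_bot.2 fun e => hπ.ne_zero (Ideal.span_singleton_eq_bot.1 e)
  have e0 := Ideal.height_add_one_le_of_lt_of_isPrime h0
  have e1 := Ideal.height_add_one_le_of_lt_of_isPrime h1
  have hkp : (RingHom.ker (MvPolynomial.map (σ := Fin 2) (residue B))).IsPrime :=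
    RingHom.ker_isPrime _
  have e2 := Ideal.height_add_one_le_of_lt_of_isPrime hlt
  have hker : RingHom.ker (MvPolynomial.map (σ := Fin 2) (residue B)) =
      Ideal.span {MvPolynomial.C x, MvPolynomial.C y} := by
    rw [MvPolynomial.ker_map, ker_residue, h.max, Ideal.map_span, Set.image_pair]
  have e3 := Ideal.height_le_spanFinrank _ hkp.ne_top
  have e4 : (RingHom.ker (MvPolynomial.map (σ := Fin 2) (residue B))).spanFinrank ≤ 2 := by
    rw [hker]
    exact (Submodule.spanFinrank_span_le_ncard_of_finite (Set.toFinite _)).trans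
      ((Set.ncard_insert_le _ _).trans (by simp))
  have e5 : (3 : ℕ∞) ≤ 2 := by
    calc (3 : ℕ∞) = 0 + 1 + 1 + 1 := by norm_num
      _ ≤ (⊥ : Ideal (MvPolynomial (Fin 2) B)).height + 1 + 1 + 1 := by gcongr; exact zero_le
      _ ≤ (Ideal.span {π}).height + 1 + 1 := by gcongr
      _ ≤ Q.height + 1 := by gcongr
      _ ≤ _ := e2
      _ ≤ _ := e3
      _ ≤ 2 := by exact_mod_cast e4
  exact absurd e5 (by decide)

end Height

section Dimension

variable {κ S D : Type*} [Field κ] [CommRing S] [CommRing D] [IsDomain D] [Algebra κ D]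
  {ρ : S →+* κ[X]} {φ : MvPolynomial (Fin 2) S →+* D} {t : D}
  (hφ : ∀ a, φ (MvPolynomial.C a) = aeval t (ρ a))
  (hind : AlgebraicIndependent κ (fun i => φ (MvPolynomial.X i)))

include hφ hind

/-- The relation `ρ(a)(t) = 0` makes `t` algebraic over `κ`. The images of the variables stay
independent over the algebraic closure of `κ` in `D`, which contains the image of `S`. -/
theorem map_C_coeff_eq_zero (hρ : ∃ a, ρ a ≠ 0 ∧ φ (MvPolynomial.C a) = 0)
    {H : MvPolynomial (Fin 2) S} (hH : φ H = 0) (i : Fin 2 →₀ ℕ) :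
    φ (MvPolynomial.C (H.coeff i)) = 0 := by
  obtain ⟨a, ha, ha'⟩ := hρ
  have ht : t ∈ Subalgebra.algebraicClosure κ D := ⟨ρ a, ha, by rw [← hφ, ha']⟩
  have hmem : ∀ s, φ (MvPolynomial.C s) ∈ Subalgebra.algebraicClosure κ D := fun s => by
    rw [hφ]
    exact Algebra.adjoin_le (Set.singleton_subset_iff.2 ht) (aeval_mem_adjoin_singleton κ t)
  have hind' := hind.extendScalars (Subalgebra.algebraicClosure κ D)
  let ψ : S →+* Subalgebra.algebraicClosure κ D := (φ.comp MvPolynomial.C).codRestrict _ hmem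
  rw [algebraicIndependent_iff] at hind'
  have h0 : ∀ H : MvPolynomial (Fin 2) S,
      MvPolynomial.aeval (fun i => φ (MvPolynomial.X i)) (H.map ψ) = φ H := by
    intro H
    induction H using MvPolynomial.induction_on with
    | C a => rw [MvPolynomial.map_C, MvPolynomial.aeval_C]; rfl
    | add p q hp hq => rw [map_add, map_add, hp, hq, map_add]
    | mul_X p i hp => rw [map_mul, map_mul, hp, MvPolynomial.map_X, MvPolynomial.aeval_X, map_mul]
  have h1 := hind' (H.map ψ) (by rw [h0, hH])
  have h2 := congrArg (MvPolynomial.coeff i) h1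
  rw [MvPolynomial.coeff_map, MvPolynomial.coeff_zero] at h2
  exact congrArg Subtype.val h2

/-- Both variables become algebraic over `κ[t]`, so `D` has transcendence degree at most one over
`κ`, yet contains two independent elements. -/
theorem false_of_map_toMvPolynomial_eq_zero (hsurj : Function.Surjective φ) {f g : S[X]}
    (hf : φ (f.toMvPolynomial 0) = 0) (hf0 : ∃ k, φ (MvPolynomial.C (f.coeff k)) ≠ 0)
    (hg : φ (g.toMvPolynomial 1) = 0) (hg0 : ∃ k, φ (MvPolynomial.C (g.coeff k)) ≠ 0) : False := by
  have hmem : ∀ s, φ (MvPolynomial.C s) ∈ Algebra.adjoin κ {t} := fun s => by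
    rw [hφ]; exact aeval_mem_adjoin_singleton κ t
  let ψ : S →+* Algebra.adjoin κ {t} := (φ.comp MvPolynomial.C).codRestrict _ hmem
  have key : ∀ (j : Fin 2) (f : S[X]), φ (f.toMvPolynomial j) = 0 →
      (∃ k, φ (MvPolynomial.C (f.coeff k)) ≠ 0) →
      IsAlgebraic (Algebra.adjoin κ {t}) (φ (MvPolynomial.X j)) := by
    rintro j f hf ⟨k, hk⟩
    refine ⟨f.map ψ, fun e => hk ?_, ?_⟩
    · have := congrArg (fun p => p.coeff k) e
      rw [coeff_map, coeff_zero] at this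
      exact congrArg Subtype.val this
    · rw [← hf]
      clear hf hk
      induction f using Polynomial.induction_on' with
      | add p q hp hq => rw [Polynomial.map_add, map_add, hp, hq, map_add, map_add]
      | monomial n a =>
        rw [map_monomial, aeval_monomial, ← C_mul_X_pow_eq_monomial, map_mul, map_pow,
          toMvPolynomial_C, toMvPolynomial_X, map_mul, map_pow]
        rfl
  have htop : ∀ d : D, d ∈ Subalgebra.algebraicClosure (Algebra.adjoin κ {t}) D := by
    intro d
    obtain ⟨H, rfl⟩ := hsurj d
    induction H using MvPolynomial.induction_on with
    | C a => exact isAlgebraic_algebraMap (A := D) (⟨_, hmem a⟩ : Algebra.adjoin κ {t})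
    | add p q hp hq => rw [map_add]; exact add_mem hp hq
    | mul_X p i hp =>
      rw [map_mul]
      refine mul_mem hp ?_
      fin_cases i
      exacts [key 0 f hf hf0, key 1 g hg hg0]
  have halg : Algebra.IsAlgebraic (Algebra.adjoin κ {t}) D := ⟨htop⟩
  have h1 := Algebra.IsAlgebraic.trdeg_le_cardinalMk κ {t}
  have h2 := hind.lift_cardinalMk_le_trdeg
  rw [Cardinal.mk_singleton] at h1
  rw [Cardinal.mk_fin, Cardinal.lift_natCast, Cardinal.lift_uzero] at h2
  have h3 := h2.trans h1
  rw [← Nat.cast_one, Nat.cast_le] at h3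
  exact absurd h3 (by norm_num)

end Dimension

section Chart

variable {K : Type*} [Field K] {B : Subring K} [IsLocalRing B] {x y : B} {z : K}

/-- The inclusion of `B` in `B[z]`. -/
noncomputable def toChartHom (B : Subring K) (z : K) : B →+* chart B z := Subring.inclusion le_chart

omit [IsLocalRing B] in
theorem toChartHom_apply (b : B) : toChartHom B z b = toChart z b := rfl

omit [IsLocalRing B] in
theorem exists_eval₂_toChartHom (a : chart B z) :
    ∃ p : B[X], a = p.eval₂ (toChartHom B z) ⟨z, mem_chart_self⟩ ∧
      (a : K) = p.eval₂ B.subtype z := by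
  obtain ⟨p, hp⟩ := mem_chart.1 a.2
  refine ⟨p, Subtype.ext ?_, hp.symm⟩
  have := hom_eval₂ p (toChartHom B z) (chart B z).subtype ⟨z, mem_chart_self⟩
  exact hp.symm.trans this.symm

theorem toChart_mem_of_mem_maximalIdeal (h : RegPair x y) (hz : (x : K) * z = y)
    {n : Ideal (chart B z)} (hn : toChart z x ∈ n) {b : B} (hb : b ∈ maximalIdeal B) :
    toChart z b ∈ n := by
  rw [h.max, Ideal.mem_span_pair] at hb
  obtain ⟨u, w, rfl⟩ := hb
  have : toChart z (u * x + w * y) =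
      (toChart z u + toChart z w * ⟨z, mem_chart_self⟩) * toChart z x := Subtype.ext (by
    push_cast
    simp only [coe_toChart]
    push_cast
    rw [← hz]; ring)
  rw [this]
  exact Ideal.mul_mem_left _ _ hn

/-- Solutions modulo two coprime forms on all infinitely near points of a chart patch to a solution
on the whole chart. -/
theorem exists_unit_coeff_of_chart [IsNoetherianRing B] (h : RegPair x y) (hz : (x : K) * z = y)
    {f g : B[X]} {f₁ g₁ : (chart B z)[X]} {p q : ℕ}
    (hf : f.map (toChartHom B z) = C (toChart z x ^ p) * f₁)
    (hg : g.map (toChartHom B z) = C (toChart z x ^ q) * g₁) (hf0 : f ≠ 0)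
    (hrel : IsRelPrime (f.toMvPolynomial (0 : Fin 2)) (g.toMvPolynomial (1 : Fin 2)))
    (hf₁ : ∃ k, ¬ toChart z x ∣ f₁.coeff k) (hg₁ : ∃ k, ¬ toChart z x ∣ g₁.coeff k)
    (r : chart B z)
    (hn : ∀ n : Ideal (chart B z), n.IsPrime → toChart z x ∈ n → n ≠ Ideal.span {toChart z x} →
      ∃ H : MvPolynomial (Fin 2) (chart B z), (∃ i, H.coeff i ∉ n) ∧
        H * MvPolynomial.C r ∈ Ideal.span {f₁.toMvPolynomial 0, g₁.toMvPolynomial 1}) :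
    ∃ H : MvPolynomial (Fin 2) B, (∃ i, H.coeff i ∉ maximalIdeal B) ∧
      H.map (toChartHom B z) * MvPolynomial.C r ∈
        Ideal.span {f₁.toMvPolynomial 0, g₁.toMvPolynomial 1} := by
  set 𝔞 : Ideal (MvPolynomial (Fin 2) (chart B z)) :=
    Ideal.span {f₁.toMvPolynomial 0, g₁.toMvPolynomial 1} with h𝔞
  -- `𝔥` collects the multipliers that solve the problem over the chart. If it contained no
  -- polynomial over `B` with a unit coefficient, some prime `P` over `𝔥` would contract into the
  -- extension of `m` to `B[T₀,T₁]`; every such `P` is excluded below.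
  let 𝔥 : Ideal (MvPolynomial (Fin 2) (chart B z)) := Submodule.colon 𝔞 {MvPolynomial.C r}
  have hmem𝔥 : ∀ H, H ∈ 𝔥 ↔ H * MvPolynomial.C r ∈ 𝔞 := fun H => by
    rw [Submodule.mem_colon_singleton, smul_eq_mul]
  set mT := RingHom.ker (MvPolynomial.map (σ := Fin 2) (residue B)) with hmT
  have hmTp : mT.IsPrime := RingHom.ker_isPrime _
  have hmemT : ∀ H, H ∉ mT ↔ ∃ i, H.coeff i ∉ maximalIdeal B := by
    intro H
    rw [hmT, RingHom.mem_ker, ← Ne, MvPolynomial.ne_zero_iff]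
    simp only [MvPolynomial.coeff_map, ne_eq, residue_eq_zero_iff]
  by_contra hcon
  have hdisj : Disjoint (𝔥 : Set _)
      (mT.primeCompl.map (MvPolynomial.map (σ := Fin 2) (toChartHom B z)) :
        Set (MvPolynomial (Fin 2) (chart B z))) := by
    rw [Set.disjoint_left]
    rintro _ h1 ⟨H, hH, rfl⟩
    exact hcon ⟨H, (hmemT H).1 hH, (hmem𝔥 _).1 h1⟩
  obtain ⟨P, hP, h𝔥P, hPd⟩ := Ideal.exists_le_prime_disjoint 𝔥 _ hdisj
  have hPB : ∀ H : MvPolynomial (Fin 2) B, H.map (toChartHom B z) ∈ P → H ∈ mT := by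
    intro H hH
    by_contra hHm
    exact Set.disjoint_left.1 hPd hH ⟨H, hHm, rfl⟩
  have h𝔞P : 𝔞 ≤ P := fun a ha => h𝔥P ((hmem𝔥 a).2 (Ideal.mul_mem_right _ _ ha))
  have hαP : f₁.toMvPolynomial 0 ∈ P := h𝔞P (Ideal.subset_span (by simp))
  have hβP : g₁.toMvPolynomial 1 ∈ P := h𝔞P (Ideal.subset_span (by simp))
  have hcoef : ∀ (j : Fin 2) (f : B[X]) (f₁ : (chart B z)[X]) (p : ℕ),
      f.map (toChartHom B z) = C (toChart z x ^ p) * f₁ → f₁.toMvPolynomial j ∈ P →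
      (f.toMvPolynomial j).map (toChartHom B z) ∈ P := by
    intro j f f₁ p e hP
    rw [map_toMvPolynomial, e, map_mul]
    exact Ideal.mul_mem_left _ _ hP
  -- Off the exceptional fibre, the contraction of `P` is strictly smaller than the extension of
  -- `m`, but contains the coprime pair formed from `f` and `g`; heights forbid this.
  by_cases hxP : MvPolynomial.C (toChart z x) ∈ P
  swap
  · have hQlt : P.comap (MvPolynomial.map (toChartHom B z)) < mT := by
      refine lt_of_le_of_ne (fun H hH => hPB H hH) fun e => hxP ?_
      have : MvPolynomial.C x ∈ mT := by
        rw [hmT, RingHom.mem_ker, MvPolynomial.map_C, (residue_eq_zero_iff _).2 h.left_mem, map_zero]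
      rw [← e, Ideal.mem_comap, MvPolynomial.map_C] at this
      exact this
    exact not_lt_ker_map_residue h hrel
      ((map_ne_zero_iff _ (toMvPolynomial_injective _)).2 hf0) (hcoef 0 f f₁ p hf hαP)
      (hcoef 1 g g₁ q hg hβP) hQlt
  set n : Ideal (chart B z) := P.comap MvPolynomial.C with hn_def
  have hxn : toChart z x ∈ n := hxP
  obtain ⟨D, _, _, φ, hsurj, hker⟩ : ∃ (D : Type _) (_ : CommRing D) (_ : IsDomain D)
      (φ : MvPolynomial (Fin 2) (chart B z) →+* D), Function.Surjective φ ∧ ∀ a, φ a = 0 ↔ a ∈ P :=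
    ⟨_ ⧸ P, inferInstance, inferInstance, Ideal.Quotient.mk P, Ideal.Quotient.mk_surjective,
      fun a => Ideal.Quotient.eq_zero_iff_mem⟩
  -- On the exceptional fibre the quotient `D` by `P` is an algebra over the residue field of `B`.
  -- The two variables are independent in it because `P` contracts into the extension of `m`.
  let ι : ResidueField B →+* D :=
    Ideal.Quotient.lift (maximalIdeal B)
      (φ.comp (MvPolynomial.C.comp (toChartHom B z))) fun a ha =>
        (hker _).2 (toChart_mem_of_mem_maximalIdeal h hz hxn ha)
  let _ : Algebra (ResidueField B) D := RingHom.toAlgebra ι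
  have hι : ∀ b, algebraMap (ResidueField B) D (residue B b) =
    φ (MvPolynomial.C (toChart z b)) := fun _ => rfl
  have hφ : ∀ a, φ (MvPolynomial.C a) =
      aeval (φ (MvPolynomial.C ⟨z, mem_chart_self⟩)) (chartResidue h hz a) := by
    intro a
    obtain ⟨p, ha, ha'⟩ := exists_eval₂_toChartHom a
    have e1 : chartResidue h hz a = p.map (residue B) := by
      rw [← chartResidue_eval₂ h hz p (ha' ▸ a.2)]
      exact congrArg _ (Subtype.ext ha')
    rw [e1, aeval_def, eval₂_map, ha, hom_eval₂, hom_eval₂]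
    rfl
  have hind : AlgebraicIndependent (ResidueField B)
      (fun i : Fin 2 => φ (MvPolynomial.X i)) := by
    rw [algebraicIndependent_iff]
    intro q hq
    obtain ⟨Q, rfl⟩ := MvPolynomial.map_surjective (residue B) residue_surjective q
    refine hPB Q ((hker _).1 (Eq.trans ?_ hq))
    clear hq
    induction Q using MvPolynomial.induction_on with
    | C a => rw [MvPolynomial.map_C, MvPolynomial.map_C, MvPolynomial.aeval_C, hι]; rfl
    | add p q hp hq => simp only [map_add, hp, hq]
    | mul_X p i hp =>
      simp only [map_mul, MvPolynomial.map_X, MvPolynomial.aeval_X, hp]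
  -- Over the generic point of the fibre, the transforms of `f` and `g` give nontrivial algebraic
  -- relations for both variables. Over any other point the local multiplier `H` lies in `P`, and
  -- independence forces all its coefficients into `n`.
  by_cases hne : n = Ideal.span {toChart z x}
  · refine false_of_map_toMvPolynomial_eq_zero hφ hind hsurj
      ((hker _).2 hαP) ?_ ((hker _).2 hβP) ?_
    · obtain ⟨k, hk⟩ := hf₁
      refine ⟨k, fun e => hk ?_⟩
      rw [← Ideal.mem_span_singleton, ← hne]
      exact (hker _).1 e
    · obtain ⟨k, hk⟩ := hg₁
      refine ⟨k, fun e => hk ?_⟩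
      rw [← Ideal.mem_span_singleton, ← hne]
      exact (hker _).1 e
  · obtain ⟨H, ⟨i, hi⟩, hH⟩ := hn n inferInstance hxn hne
    obtain ⟨w, hw, hxw⟩ := SetLike.not_le_iff_exists.1 fun hle : n ≤ Ideal.span {toChart z x} =>
      hne (le_antisymm hle ((Ideal.span_singleton_le_iff_mem _).2 hxn))
    refine hi ((hker _).1 (map_C_coeff_eq_zero hφ hind
      ⟨w, ?_, (hker _).2 hw⟩
      ((hker _).2 (h𝔥P ((hmem𝔥 H).2 hH))) i))
    rwa [Ne, chartResidue_eq_zero_iff, ← Ideal.mem_span_singleton]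

end Chart

end AdjointIdeals

end

/-! ### Gluing the solutions on the two charts. -/

section

open IsLocalRing Polynomial

namespace AdjointIdeals

variable {K : Type*} [Field K] {B : Subring K} [IsLocalRing B] {x y : B} {z : K}

/-- A power of the maximal ideal of a local subring of a field, as a subgroup of the field. -/
def maxPow (B : Subring K) [IsLocalRing B] (k : ℕ) : AddSubgroup K :=
  (maximalIdeal B ^ k).toAddSubgroup.map (B.subtype : B →+ K)

theorem mem_maxPow {k : ℕ} {a : K} : a ∈ maxPow B k ↔ ∃ b ∈ maximalIdeal B ^ k, (b : K) = a := Iff.rfl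

theorem maxPow_le (k : ℕ) : maxPow B k ≤ B.toAddSubgroup := by
  rintro _ ⟨b, -, rfl⟩
  exact b.2

theorem inv_pow_mul_mem_chart (h : RegPair x y) (hz : (x : K) * z = y) {k : ℕ} {a : K}
    (ha : a ∈ maxPow B k) : ((x : K) ^ k)⁻¹ * a ∈ chart B z := by
  have hx0 : (x : K) ≠ 0 := fun e => h.prime.ne_zero (Subtype.ext e)
  obtain ⟨b, hb, rfl⟩ := mem_maxPow.1 ha
  obtain ⟨c, hc⟩ := exists_chart_of_mem_pow h hz hb
  rw [hc, inv_mul_cancel_left₀ (pow_ne_zero k hx0)]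
  exact c.2

/-- On the overlap, `s₁ - z^q s₂ = β' w` and `z^p t₂ - t₁ = α' w` by the Koszul relation. Here `w`
is a Laurent polynomial in `z`, split as `w₁ + z⁻¹ w₂`, and `w₁`, `w₂` correct the solutions on
their own charts. The factor `z⁻¹` is absorbed by `β' = z^(q+1) β''`, which has one power of `z`
more than the twist `z^q`: this is where the orders `p`, `q`, one less than those of `f` and `g`,
enter. -/
theorem exists_glue [IsNoetherianRing B] (h : RegPair x y) (hz : (x : K) * z = y)
    {f g : K[X]} {p q : ℕ} (hf : ∀ k, f.coeff k ∈ maxPow B (p + 1))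
    (hg : ∀ k, g.coeff k ∈ maxPow B (q + 1)) (hgq : ∃ k, g.coeff k ∉ maxPow B (q + 2)) (hf0 : f ≠ 0)
    (hgN : ∃ N, maximalIdeal B ^ N ≤ contIdeal B g) {R : MvPolynomial (Fin 2) K}
    {s₁ t₁ s₂ t₂ : MvPolynomial (Fin 2) K} (hs₁ : CoeffIn (chart B z).toAddSubgroup s₁)
    (ht₁ : CoeffIn (chart B z).toAddSubgroup t₁) (hs₂ : CoeffIn (chart B z⁻¹).toAddSubgroup s₂)
    (ht₂ : CoeffIn (chart B z⁻¹).toAddSubgroup t₂)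
    (e₁ : R = f.toMvPolynomial 0 * (MvPolynomial.C (x : K) ^ q * s₁) +
      g.toMvPolynomial 1 * (MvPolynomial.C (x : K) ^ p * t₁))
    (e₂ : R = f.toMvPolynomial 0 * (MvPolynomial.C (y : K) ^ q * s₂) +
      g.toMvPolynomial 1 * (MvPolynomial.C (y : K) ^ p * t₂)) :
    ∃ s t, CoeffIn (maxPow B q) s ∧ CoeffIn (maxPow B p) t ∧
      R = f.toMvPolynomial 0 * s + g.toMvPolynomial 1 * t := by
  have hx0 : (x : K) ≠ 0 := fun e => h.prime.ne_zero (Subtype.ext e)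
  have hy0 : (y : K) ≠ 0 := fun e => h.symm.prime.ne_zero (Subtype.ext e)
  have hz0 : z ≠ 0 := by rintro rfl; rw [mul_zero] at hz; exact hy0 hz.symm
  have hyz : (y : K) * z⁻¹ = x := by rw [← hz]; field_simp
  set α := f.toMvPolynomial (0 : Fin 2)
  set β := g.toMvPolynomial (1 : Fin 2) with hβ
  have hα_in : CoeffIn (maxPow B (p + 1)) α := coeffIn_toMvPolynomial hf
  have hβ_in : CoeffIn (maxPow B (q + 1)) β := coeffIn_toMvPolynomial hg
  have hC0 : ∀ {a : K}, a ≠ 0 → (MvPolynomial.C a : MvPolynomial (Fin 2) K) ≠ 0 := fun ha =>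
    (map_ne_zero_iff _ (MvPolynomial.C_injective _ _)).2 ha
  set X : MvPolynomial (Fin 2) K := MvPolynomial.C (x : K) with hX
  set Y : MvPolynomial (Fin 2) K := MvPolynomial.C (y : K) with hY
  set Z : MvPolynomial (Fin 2) K := MvPolynomial.C z with hZ
  set Z' : MvPolynomial (Fin 2) K := MvPolynomial.C z⁻¹ with hZ'
  have hXZ : X * Z = Y := by rw [hX, hZ, ← map_mul, hz]
  have hZZ : Z * Z' = 1 := by rw [hZ, hZ', ← map_mul, mul_inv_cancel₀ hz0, map_one]
  have hX0 : X ≠ 0 := hC0 hx0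
  have hY0 : Y ≠ 0 := hC0 hy0
  have hZ0 : Z ≠ 0 := hC0 hz0
  -- the transforms of `α` and `β` on the two charts
  have htrans : ∀ (x : B) {k : ℕ} {γ : MvPolynomial (Fin 2) K}, (x : K) ≠ 0 →
      γ = MvPolynomial.C (x : K) ^ k * (MvPolynomial.C ((x : K) ^ k)⁻¹ * γ) := by
    intro x k γ hx0
    rw [← mul_assoc, ← map_pow, ← map_mul, mul_inv_cancel₀ (pow_ne_zero k hx0), map_one, one_mul]
  set α' := MvPolynomial.C ((x : K) ^ (p + 1))⁻¹ * α
  set β' := MvPolynomial.C ((x : K) ^ (q + 1))⁻¹ * β with hβ'_def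
  set α'' := MvPolynomial.C ((y : K) ^ (p + 1))⁻¹ * α
  set β'' := MvPolynomial.C ((y : K) ^ (q + 1))⁻¹ * β
  have hα : α = X ^ (p + 1) * α' := htrans x hx0
  have hβe : β = X ^ (q + 1) * β' := htrans x hx0
  have hα2 : α = Y ^ (p + 1) * α'' := htrans y hy0
  have hβ2 : β = Y ^ (q + 1) * β'' := htrans y hy0
  have hα'' : α' = Z ^ (p + 1) * α'' := mul_left_cancel₀ (pow_ne_zero (p + 1) hX0) (by
    rw [← hα, hα2, ← hXZ]; ring)
  have hβ'' : β' = Z ^ (q + 1) * β'' := mul_left_cancel₀ (pow_ne_zero (q + 1) hX0) (by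
    rw [← hβe, hβ2, ← hXZ]; ring)
  have hα'_in : CoeffIn (chart B z).toAddSubgroup α' :=
    hα_in.C_mul fun a ha => inv_pow_mul_mem_chart h hz ha
  have hβ'_in : CoeffIn (chart B z).toAddSubgroup β' :=
    hβ_in.C_mul fun a ha => inv_pow_mul_mem_chart h hz ha
  have hα''_in : CoeffIn (chart B z⁻¹).toAddSubgroup α'' :=
    hα_in.C_mul fun a ha => inv_pow_mul_mem_chart h.symm hyz ha
  have hβ''_in : CoeffIn (chart B z⁻¹).toAddSubgroup β'' :=
    hβ_in.C_mul fun a ha => inv_pow_mul_mem_chart h.symm hyz ha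
  -- clearing denominators
  obtain ⟨N₁, hN₁⟩ := hs₁.exists_pow (M' := B.toAddSubgroup) fun a ha => exists_pow_mul_mem h hz ha
  obtain ⟨N₂, hN₂⟩ := ht₁.exists_pow (M' := B.toAddSubgroup) fun a ha => exists_pow_mul_mem h hz ha
  obtain ⟨N₃, hN₃⟩ := hs₂.exists_pow (M' := B.toAddSubgroup) fun a ha =>
    exists_pow_mul_mem h.symm hyz ha
  obtain ⟨N₄, hN₄⟩ := ht₂.exists_pow (M' := B.toAddSubgroup) fun a ha =>
    exists_pow_mul_mem h.symm hyz ha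
  set M := max (max N₁ N₂) (max N₃ N₄)
  have hclear : ∀ {k : ℕ} {s₁ s₂ : MvPolynomial (Fin 2) K},
      CoeffIn B.toAddSubgroup (MvPolynomial.C ((x : K) ^ M) * s₁) →
      CoeffIn B.toAddSubgroup (MvPolynomial.C ((y : K) ^ M) * s₂) →
      CoeffIn B.toAddSubgroup ((X * Y) ^ M * (X ^ k * s₁ - Y ^ k * s₂)) := by
    intro k s₁ s₂ h1 h2
    have e : (X * Y) ^ M * (X ^ k * s₁ - Y ^ k * s₂) =
        MvPolynomial.C ((x : K) ^ k * y ^ M) * (MvPolynomial.C ((x : K) ^ M) * s₁) -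
        MvPolynomial.C ((y : K) ^ k * x ^ M) * (MvPolynomial.C ((y : K) ^ M) * s₂) := by
      simp only [map_mul, map_pow, ← hX, ← hY]
      ring
    rw [e]
    refine (h1.C_mul fun a ha => ?_).sub (h2.C_mul fun a ha => ?_)
    · exact B.mul_mem (B.mul_mem (B.pow_mem x.2 _) (B.pow_mem y.2 _)) ha
    · exact B.mul_mem (B.mul_mem (B.pow_mem y.2 _) (B.pow_mem x.2 _)) ha
  have hBf : ∀ k, f.coeff k ∈ B := fun k => maxPow_le _ (hf k)
  have hBg : ∀ k, g.coeff k ∈ B := fun k => maxPow_le _ (hg k)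
  obtain ⟨w₀, hw₀, hD, hE⟩ := exists_eq_mul_of_toMvPolynomial_mul_eq h hBf hBg hf0 hgN
    (s := (X * Y) ^ M * (X ^ q * s₁ - Y ^ q * s₂)) (t := -((X * Y) ^ M * (X ^ p * t₁ - Y ^ p * t₂)))
    (hclear (hN₁ M (by simp [M])) (hN₃ M (by simp [M])))
    (hclear (hN₂ M (by simp [M])) (hN₄ M (by simp [M]))).neg
    (by linear_combination (X * Y) ^ M * (e₂ - e₁))
  have hXY0 : (X * Y) ^ M ≠ 0 := pow_ne_zero _ (mul_ne_zero hX0 hY0)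
  -- The extra factor `x` in front of `w₀` comes from `β = x^(q+1) β'`, compared with the factor
  -- `x^q` of `s₁`.
  obtain ⟨w, hw⟩ : ∃ w, (X * Y) ^ M * w = X * w₀ :=
    ⟨MvPolynomial.C (((x : K) * y) ^ M)⁻¹ * (X * w₀), by
      rw [← mul_assoc, hX, hY, ← map_mul, ← map_pow, ← map_mul,
        mul_inv_cancel₀ (pow_ne_zero _ (mul_ne_zero hx0 hy0)), map_one, one_mul]⟩
  have hs : s₁ - Z ^ q * s₂ = β' * w := mul_left_cancel₀ (mul_ne_zero (pow_ne_zero q hX0) hXY0) (by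
    have h1 : Y ^ q = X ^ q * Z ^ q := by rw [← hXZ, mul_pow]
    linear_combination hD + (X * Y) ^ M * s₂ * h1 + w₀ * hβe - X ^ q * β' * hw)
  have ht : Z ^ p * t₂ - t₁ = α' * w := mul_left_cancel₀ (mul_ne_zero (pow_ne_zero p hX0) hXY0) (by
    have h1 : Y ^ p = X ^ p * Z ^ p := by rw [← hXZ, mul_pow]
    linear_combination hE - (X * Y) ^ M * t₂ * h1 + w₀ * hα - X ^ p * α' * hw)
  -- the decomposition of `w`
  obtain ⟨j, hj⟩ : ∃ j, CoeffIn (chart B z).toAddSubgroup (Z ^ j * w) := by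
    obtain ⟨N, hN⟩ := hs₂.exists_pow (M' := (chart B z).toAddSubgroup) fun a ha =>
      exists_pow_mul_mem_chart hz0 ha
    have hzS : ∀ k, ∀ a ∈ (chart B z).toAddSubgroup, z ^ k * a ∈ (chart B z).toAddSubgroup :=
      fun k a ha => Subring.mul_mem _ (Subring.pow_mem _ mem_chart_self _) ha
    -- The exponent `N` brings `s₂` into `B[z]`, and `M` comes from `(xy)^M = x^(2M) z^M`. After
    -- multiplication by `β'` or by `x^(2M)` the polynomial `z^(N+M) w` has coefficients in the
    -- chart; as `x` is prime there and does not divide `β'`, the power of `x` can be removed.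
    refine ⟨N + M, ?_⟩
    have h1 : CoeffIn (chart B z).toAddSubgroup (β' * (Z ^ (N + M) * w)) := by
      have e : β' * (Z ^ (N + M) * w) = MvPolynomial.C (z ^ (N + M)) * s₁ -
          MvPolynomial.C (z ^ (N + M + q)) * s₂ := by
        simp only [map_pow, ← hZ]
        linear_combination -Z ^ (N + M) * hs
      rw [e]
      exact (hs₁.C_mul (hzS _)).sub (hN _ (by omega))
    have h2 : CoeffIn (chart B z).toAddSubgroup (X ^ (2 * M) * (Z ^ (N + M) * w)) := by
      have e : X ^ (2 * M) * (Z ^ (N + M) * w) = MvPolynomial.C (z ^ N * x) * w₀ := by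
        simp only [map_mul, map_pow, ← hZ, ← hX]
        rw [mul_assoc, ← hw, ← hXZ]
        ring
      rw [e]
      exact hw₀.C_mul fun a ha => Subring.mul_mem _ (Subring.mul_mem _
        (Subring.pow_mem _ mem_chart_self _) (le_chart x.2)) (le_chart ha)
    obtain ⟨G, hG⟩ := coeffIn_subring_iff.1 h1
    obtain ⟨U, hU⟩ := coeffIn_subring_iff.1 h2
    obtain ⟨b, hb⟩ := coeffIn_subring_iff.1 hβ'_in
    have hinj : Function.Injective (MvPolynomial.map (σ := Fin 2) (chart B z).subtype) :=
      MvPolynomial.map_injective _ (Subring.subtype_injective _)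
    have hXm : (MvPolynomial.C (toChart z x)).map (chart B z).subtype = X := by
      rw [MvPolynomial.map_C]; rfl
    have h3 : b * U = MvPolynomial.C (toChart z x) ^ (2 * M) * G := hinj (by
      rw [map_mul, map_mul, map_pow, hXm, hG, hU, hb]; ring)
    have hprime : Prime (MvPolynomial.C (toChart z x) : MvPolynomial (Fin 2) (chart B z)) :=
      (MvPolynomial.prime_C_iff _).2 (prime_toChart h hz)
    have hnd : ¬ MvPolynomial.C (toChart z x) ∣ b := by
      intro hd
      obtain ⟨k, hk⟩ := hgq
      refine hk ?_
      obtain ⟨c, hc, hck⟩ := mem_maxPow.1 (hg k)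
      rw [MvPolynomial.C_dvd_iff_dvd_coeff] at hd
      refine mem_maxPow.2 ⟨c, mem_pow_succ_of_dvd h hz hc ?_ (hd (Finsupp.single 1 k)), hck⟩
      have h4 := congrArg (MvPolynomial.coeff (Finsupp.single 1 k)) hb
      rw [MvPolynomial.coeff_map, hβ'_def, MvPolynomial.coeff_C_mul, hβ,
        coeff_toMvPolynomial_single] at h4
      rw [hck, show ((b.coeff (Finsupp.single 1 k) : chart B z) : K) = _ from h4,
        mul_inv_cancel_left₀ (pow_ne_zero _ hx0)]
    obtain ⟨U', hU'⟩ := hprime.pow_dvd_of_dvd_mul_left (2 * M) hnd ⟨G, h3⟩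
    refine coeffIn_subring_iff.2 ⟨U', mul_left_cancel₀ (pow_ne_zero (2 * M) hX0) ?_⟩
    rw [← hU, hU', map_mul, map_pow, hXm]
  obtain ⟨w₁, P, hw₁, hP, hwP⟩ := exists_add_of_coeffIn (P := w) (M := (chart B z).toAddSubgroup)
    (M' := (chart B z⁻¹).toAddSubgroup.map (AddMonoidHom.mulLeft z⁻¹)) (fun i => by
      have h1 := hj i
      rw [hZ, ← map_pow, MvPolynomial.coeff_C_mul] at h1
      obtain ⟨a, ha, b, hb, e⟩ := exists_add_inv_mul_of_pow_mul_mem hz0 h1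
      exact ⟨a, ha, z⁻¹ * b, ⟨b, hb, rfl⟩, e⟩)
  obtain ⟨w₂, hw₂, rfl⟩ : ∃ w₂, CoeffIn (chart B z⁻¹).toAddSubgroup w₂ ∧ P = Z' * w₂ := by
    refine ⟨Z * P, hP.C_mul ?_, by rw [← mul_assoc, mul_comm Z', hZZ, one_mul]⟩
    rintro _ ⟨b, hb, rfl⟩
    rw [AddMonoidHom.coe_mulLeft, mul_inv_cancel_left₀ hz0]
    exact hb
  -- the glued solution
  have es : X ^ q * (s₁ - β' * w₁) = Y ^ q * (s₂ + β'' * w₂) := by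
    rw [← hXZ]
    linear_combination X ^ q * hs + X ^ q * β' * hwP + X ^ q * Z' * w₂ * hβ'' +
      X ^ q * Z ^ q * β'' * w₂ * hZZ
  have et : X ^ p * (t₁ + α' * w₁) = Y ^ p * (t₂ - α'' * w₂) := by
    rw [← hXZ]
    linear_combination -X ^ p * ht - X ^ p * α' * hwP - X ^ p * Z' * w₂ * hα'' -
      X ^ p * Z ^ p * α'' * w₂ * hZZ
  have hmem : ∀ {k : ℕ} {s s' : MvPolynomial (Fin 2) K}, CoeffIn (chart B z).toAddSubgroup s →
      CoeffIn (chart B z⁻¹).toAddSubgroup s' → X ^ k * s = Y ^ k * s' →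
      CoeffIn (maxPow B k) (X ^ k * s) := by
    intro k s s' hs hs' e i
    have h1 := congrArg (MvPolynomial.coeff i) e
    rw [hX, hY, ← map_pow, ← map_pow, MvPolynomial.coeff_C_mul, MvPolynomial.coeff_C_mul] at h1
    rw [hX, ← map_pow, MvPolynomial.coeff_C_mul]
    exact mem_maxPow.2 (exists_mem_pow_of_mem_charts h hz (hs i) (hs' i) h1)
  refine ⟨_, _, hmem (hs₁.sub (hβ'_in.mul_subring hw₁)) (hs₂.add (hβ''_in.mul_subring hw₂)) es,
    hmem (ht₁.add (hα'_in.mul_subring hw₁)) (ht₂.sub (hα''_in.mul_subring hw₂)) et, ?_⟩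
  linear_combination e₁ + X ^ q * β' * w₁ * hα - X ^ p * α' * w₁ * hβe

end AdjointIdeals

end

/-! ### Transforms of polynomials and the length of their coefficient ideals. -/

section

open IsLocalRing Polynomial

namespace AdjointIdeals

section ChainLE

/-- Every strictly increasing chain of ideals starting at `I` has length at most `N`. -/
def ChainLE {A : Type*} [CommRing A] : ℕ → Ideal A → Prop
  | 0, I => I = ⊤
  | N + 1, I => ∀ I', I < I' → ChainLE N I'

theorem ChainLE.mono {A : Type*} [CommRing A] {N : ℕ} {I I' : Ideal A} (h : ChainLE N I)
    (hI : I ≤ I') : ChainLE N I' := by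
  cases N with
  | zero => exact top_le_iff.1 (h.ge.trans hI)
  | succ N => exact fun J hJ => h J (hI.trans_lt hJ)

/-- The quotient by `I` is Artinian, so heights in its lattice of ideals are finite and bound the
chains above `I`. -/
theorem exists_chainLE {A : Type*} [CommRing A] [IsLocalRing A] [IsNoetherianRing A] {I : Ideal A}
    {M : ℕ} (hM : maximalIdeal A ^ M ≤ I) : ∃ N, ChainLE N I := by
  by_cases hI : I = ⊤
  · exact ⟨0, hI⟩
  have : Nontrivial (A ⧸ I) := Ideal.Quotient.nontrivial_iff.2 hI
  have hsurj : Function.Surjective (Ideal.Quotient.mk I) := Ideal.Quotient.mk_surjective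
  have : IsLocalRing (A ⧸ I) := IsLocalRing.of_surjective' _ hsurj
  have : IsArtinianRing (A ⧸ I) := by
    rw [isArtinianRing_iff_isNilpotent_maximalIdeal]
    refine ⟨M, ?_⟩
    rw [← IsLocalRing.map_maximalIdeal_of_surjective _ hsurj, ← Ideal.map_pow, Ideal.zero_eq_bot,
      Ideal.map_eq_bot_iff_le_ker, Ideal.mk_ker]
    exact hM
  have hmono := Submodule.height_strictMono (R := A ⧸ I) (M := A ⧸ I)
  have hlt : ∀ J J' : Ideal A, I ≤ J → J < J' →
      J.map (Ideal.Quotient.mk I) < J'.map (Ideal.Quotient.mk I) := by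
    intro J J' hJ hJJ'
    refine lt_of_le_of_ne (Ideal.map_mono hJJ'.le) fun e => hJJ'.ne ?_
    have := congrArg (Ideal.comap (Ideal.Quotient.mk I)) e
    rwa [Ideal.comap_map_of_surjective' _ hsurj, Ideal.comap_map_of_surjective' _ hsurj,
      Ideal.mk_ker, sup_eq_left.2 hJ, sup_eq_left.2 (hJ.trans hJJ'.le)] at this
  have key : ∀ (n : ℕ) (J : Ideal A), I ≤ J → Order.height (⊤ : Ideal (A ⧸ I)) ≤
      Order.height (J.map (Ideal.Quotient.mk I)) + n → ChainLE n J := by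
    intro n
    induction n with
    | zero =>
      intro J hJ h
      by_contra hJt
      have h1 := hmono (hlt J ⊤ hJ (lt_top_iff_ne_top.2 hJt))
      rw [Ideal.map_top] at h1
      exact absurd h1 (not_lt.2 (by simpa using h))
    | succ n ih =>
      intro J hJ h J' hJJ'
      refine ih J' (hJ.trans hJJ'.le) (h.trans ?_)
      have h1 := Order.add_one_le_of_lt (hmono (hlt J J' hJ hJJ'))
      push_cast
      rw [add_comm (n : ℕ∞), ← add_assoc]
      gcongr
  obtain ⟨n, hn⟩ := ENat.ne_top_iff_exists.1 (Submodule.height_lt_top (⊤ : Ideal (A ⧸ I))).ne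
  exact ⟨n, key n I le_rfl (by rw [← hn]; exact le_add_self)⟩

end ChainLE

variable {K : Type*} [Field K] {B : Subring K} [IsLocalRing B] {x y : B} {z : K}

theorem exists_order [IsNoetherianRing B] {f : K[X]} (hf : ∀ k, f.coeff k ∈ B) (hf0 : f ≠ 0) :
    ∃ p, (∀ k, f.coeff k ∈ maxPow B p) ∧ ∃ k, f.coeff k ∉ maxPow B (p + 1) := by
  classical
  have hex : ∃ p, ∃ k, f.coeff k ∉ maxPow B (p + 1) := by
    by_contra hcon
    push Not at hcon
    refine hf0 (Polynomial.ext fun k => ?_)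
    have h1 : (⟨_, hf k⟩ : B) ∈ (⨅ i, maximalIdeal B ^ i : Ideal B) := by
      rw [Ideal.mem_iInf]
      intro i
      obtain ⟨b, hb, e⟩ := mem_maxPow.1 (hcon i k)
      rw [← show b = ⟨_, hf k⟩ from Subtype.ext e]
      exact Ideal.pow_le_pow_right (Nat.le_succ i) hb
    rw [Ideal.iInf_pow_eq_bot_of_isLocalRing _ (Ideal.IsPrime.ne_top inferInstance)] at h1
    simpa using congrArg Subtype.val ((Ideal.mem_bot).1 h1)
  refine ⟨Nat.find hex, fun k => ?_, Nat.find_spec hex⟩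
  rcases hp : Nat.find hex with _ | p
  · exact mem_maxPow.2 ⟨⟨_, hf k⟩, by simp, rfl⟩
  · by_contra hk
    exact Nat.find_min hex (m := p) (by omega) ⟨k, hk⟩

theorem ne_zero_of_pow_le_contIdeal (h : RegPair x y) {f : K[X]} {N : ℕ}
    (hN : maximalIdeal B ^ N ≤ contIdeal B f) : f ≠ 0 := by
  rintro rfl
  have : contIdeal B (0 : K[X]) ≤ ⊥ := Ideal.span_le.2 (by
    rintro b ⟨k, hk⟩
    exact Subtype.ext (by simpa using hk))
  exact pow_ne_zero N h.prime.ne_zero (this (hN (Ideal.pow_mem_pow h.left_mem N)))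

section Transform

/-- The transform of a polynomial whose coefficients have order at least `p`. -/
noncomputable def transform (x : K) (p : ℕ) (f : K[X]) : K[X] := C (x ^ p)⁻¹ * f

theorem coeff_transform (x : K) (p : ℕ) (f : K[X]) (k : ℕ) :
    (transform x p f).coeff k = (x ^ p)⁻¹ * f.coeff k := coeff_C_mul _

theorem pow_mul_coeff_transform {x : K} (hx : x ≠ 0) (p : ℕ) (f : K[X]) (k : ℕ) :
    x ^ p * (transform x p f).coeff k = f.coeff k := by
  rw [coeff_transform, mul_inv_cancel_left₀ (pow_ne_zero _ hx)]

variable {f : K[X]} {p : ℕ}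

theorem coeff_transform_mem_chart (h : RegPair x y) (hz : (x : K) * z = y)
    (hf : ∀ k, f.coeff k ∈ maxPow B p) (k : ℕ) : (transform (x : K) p f).coeff k ∈ chart B z := by
  rw [coeff_transform]; exact inv_pow_mul_mem_chart h hz (hf k)

theorem exists_not_dvd_transform (h : RegPair x y) (hz : (x : K) * z = y)
    (hf : ∀ k, f.coeff k ∈ maxPow B p) (hfp : ∃ k, f.coeff k ∉ maxPow B (p + 1)) :
    ∃ k, ∃ a : chart B z, (a : K) = (transform (x : K) p f).coeff k ∧ ¬ toChart z x ∣ a := by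
  have hx0 : (x : K) ≠ 0 := fun e => h.prime.ne_zero (Subtype.ext e)
  obtain ⟨k, hk⟩ := hfp
  refine ⟨k, ⟨_, coeff_transform_mem_chart h hz hf k⟩, rfl, fun hd => hk ?_⟩
  obtain ⟨c, hc, e⟩ := mem_maxPow.1 (hf k)
  refine mem_maxPow.2 ⟨c, mem_pow_succ_of_dvd h hz hc ?_ hd, e⟩
  rw [e, pow_mul_coeff_transform hx0]

omit [IsLocalRing B] in
theorem exists_eq_mul_of_mem_contIdeal {S : Subring K} (hBS : B ≤ S) (hx0 : (x : K) ≠ 0)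
    (hfS : ∀ k, (transform (x : K) p f).coeff k ∈ S) {b : B} (hb : b ∈ contIdeal B f) :
    ∃ c ∈ contIdeal S (transform (x : K) p f), (b : K) = (x : K) ^ p * c := by
  induction hb using Submodule.span_induction with
  | mem b hb =>
    obtain ⟨k, hk⟩ := hb
    exact ⟨⟨_, hfS k⟩, Ideal.subset_span ⟨k, rfl⟩, by rw [pow_mul_coeff_transform hx0, hk]⟩
  | zero => exact ⟨0, zero_mem _, by simp⟩
  | add a b _ _ ha hb =>
    obtain ⟨c, hc, e⟩ := ha
    obtain ⟨d, hd, e'⟩ := hb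
    exact ⟨c + d, add_mem hc hd, by push_cast; rw [e, e']; ring⟩
  | smul a b _ hb =>
    obtain ⟨c, hc, e⟩ := hb
    exact ⟨⟨a, hBS a.2⟩ * c, Ideal.mul_mem_left _ _ hc, by
      rw [smul_eq_mul]; push_cast; rw [e]; ring⟩

theorem pow_mem_contIdeal_transform (h : RegPair x y) {S : Subring K} (hBS : B ≤ S)
    (hfS : ∀ k, (transform (x : K) p f).coeff k ∈ S) {N : ℕ}
    (hN : maximalIdeal B ^ N ≤ contIdeal B f) :
    (⟨x, hBS x.2⟩ : S) ^ N ∈ contIdeal S (transform (x : K) p f) := by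
  have hx0 : (x : K) ≠ 0 := fun e => h.prime.ne_zero (Subtype.ext e)
  obtain ⟨c, hc, e⟩ := exists_eq_mul_of_mem_contIdeal (p := p) hBS hx0 hfS
    (hN (Ideal.pow_mem_pow h.left_mem N))
  rw [show (⟨x, hBS x.2⟩ : S) ^ N = ⟨x, hBS x.2⟩ ^ p * c from Subtype.ext e]
  exact Ideal.mul_mem_left _ _ hc

variable [IsNoetherianRing B] {n : Ideal (chart B z)} [n.IsPrime]

omit [IsNoetherianRing B] in
theorem coeff_transform_mem_locSub (h : RegPair x y) (hz : (x : K) * z = y)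
    (hf : ∀ k, f.coeff k ∈ maxPow B p) (k : ℕ) :
    (transform (x : K) p f).coeff k ∈ locSub (chart B z) n :=
  le_locSub _ _ (coeff_transform_mem_chart h hz hf k)

/-- The new coefficient ideal contains a power of `x` and an element that `x` does not divide. -/
theorem exists_pow_le_contIdeal_transform (h : RegPair x y) (hz : (x : K) * z = y)
    (hxn : toChart z x ∈ n) (hne : n ≠ Ideal.span {toChart z x})
    (hf : ∀ k, f.coeff k ∈ maxPow B p) (hfp : ∃ k, f.coeff k ∉ maxPow B (p + 1))
    (hN : ∃ N, maximalIdeal B ^ N ≤ contIdeal B f) :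
    ∃ N, maximalIdeal (locSub (chart B z) n) ^ N ≤
      contIdeal (locSub (chart B z) n) (transform (x : K) p f) := by
  obtain ⟨f', hreg⟩ := exists_regPair_locSub h hz n hxn hne
  obtain ⟨N, hN⟩ := hN
  obtain ⟨k, a, ha, hxa⟩ := exists_not_dvd_transform h hz hf hfp
  exact hreg.exists_pow_le_of_mem (M := N) (w := algebraMap _ _ a)
    (pow_mem_contIdeal_transform h (le_chart.trans (le_locSub _ _))
      (coeff_transform_mem_locSub h hz hf) hN)
    (Ideal.subset_span ⟨k, ha⟩)
    (fun hd => hxa (dvd_of_algebraMap_dvd_locSub _ _ (prime_toChart h hz) hxn hd))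

omit [IsNoetherianRing B] in
theorem isMaximal_of_ne (h : RegPair x y) (hz : (x : K) * z = y)
    (hxn : toChart z x ∈ n) (hne : n ≠ Ideal.span {toChart z x}) : n.IsMaximal := by
  have hsurj := chartResidue_surjective h hz
  have hker : RingHom.ker (chartResidue h hz) ≤ n := by
    intro a ha
    obtain ⟨b, rfl⟩ := (chartResidue_eq_zero_iff h hz).1 ha
    exact n.mul_mem_right _ hxn
  have hp := Ideal.map_isPrime_of_surjective hsurj hker
  have h0 : n.map (chartResidue h hz) ≠ ⊥ := by
    intro e
    refine hne (le_antisymm (fun a ha => ?_) ((Ideal.span_singleton_le_iff_mem _).2 hxn))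
    have h1 := Ideal.mem_map_of_mem (chartResidue h hz) ha
    rwa [e, Ideal.mem_bot, chartResidue_eq_zero_iff, ← Ideal.mem_span_singleton] at h1
  have hm := IsPrime.to_maximal_ideal h0
  have := Ideal.comap_isMaximal_of_surjective (chartResidue h hz) hsurj (K := n.map (chartResidue h hz))
  rwa [Ideal.comap_map_of_surjective' _ hsurj, sup_eq_left.2 hker] at this

omit [IsNoetherianRing B] in
-- The elements `x⁻ᵖF` with `F` in `m^p` represent the chart modulo the new coefficient ideal. Some
-- generator of that ideal reduces modulo `x` to a nonzero polynomial of degree at most `p`;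
-- division by it leaves a remainder of degree at most `p`, which homogenizes into `m^p`, and an
-- error divisible by `x`. The division is iterated until the power of `x` lies in the ideal.
theorem exists_chart_decomposition (h : RegPair x y) (hz : (x : K) * z = y)
    (hf : ∀ k, f.coeff k ∈ maxPow B p) (hfp : ∃ k, f.coeff k ∉ maxPow B (p + 1))
    (hN : ∃ N, maximalIdeal B ^ N ≤ contIdeal B f) (a : chart B z) :
    ∃ F ∈ maximalIdeal B ^ p, ∃ c ∈ contIdeal (chart B z) (transform (x : K) p f),
      (x : K) ^ p * a = F + (x : K) ^ p * c := by
  obtain ⟨k, φ, hφ, hxφ⟩ := exists_not_dvd_transform h hz hf hfp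
  have hφI : φ ∈ contIdeal (chart B z) (transform (x : K) p f) := Ideal.subset_span ⟨k, hφ⟩
  set ρ := chartResidue h hz with hρ
  have hρφ : ρ φ ≠ 0 := fun e => hxφ ((chartResidue_eq_zero_iff h hz).1 e)
  have hdeg : (ρ φ).natDegree ≤ p := by
    obtain ⟨c, hc, e⟩ := mem_maxPow.1 (hf k)
    obtain ⟨P, hP, e'⟩ := exists_eval₂_eq_of_mem_pow h hz hc
    have hx0 : (x : K) ≠ 0 := fun e => h.prime.ne_zero (Subtype.ext e)
    have e2 : φ = ⟨P.eval₂ B.subtype z, mem_chart.2 ⟨P, rfl⟩⟩ :=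
      Subtype.ext (mul_left_cancel₀ (pow_ne_zero p hx0) (by
        rw [e', e, hφ, pow_mul_coeff_transform hx0]))
    rw [e2, hρ, chartResidue_eval₂]
    exact natDegree_map_le.trans hP
  have step : ∀ a : chart B z, ∃ F ∈ maximalIdeal B ^ p,
      ∃ c ∈ contIdeal (chart B z) (transform (x : K) p f), ∃ a₁ : chart B z,
      (x : K) ^ p * a = F + (x : K) ^ p * (c + x * a₁) := by
    intro a
    obtain ⟨R, hR, hRd⟩ : ∃ R : B[X], R.map (residue B) = ρ a % ρ φ ∧ R.natDegree ≤ p := by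
      obtain ⟨R, hR, hRd⟩ := exists_natDegree_eq_of_mem_lifts
        (mem_lifts_of_surjective residue_surjective (ρ a % ρ φ))
      refine ⟨R, hR, ?_⟩
      rw [hRd]
      exact (natDegree_le_natDegree (degree_mod_lt _ hρφ).le).trans hdeg
    obtain ⟨b, hb⟩ := chartResidue_surjective h hz (ρ a / ρ φ)
    obtain ⟨F, hF, e⟩ := exists_mem_pow_eq_pow_mul_eval₂ h hz R hRd
    have h0 : ρ (a - ⟨_, mem_chart.2 ⟨R, rfl⟩⟩ - φ * b) = 0 := by
      rw [map_sub, map_sub, map_mul, hb, hρ, chartResidue_eval₂, hR, ← hρ, sub_sub,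
        add_comm, EuclideanDomain.div_add_mod, sub_self]
    obtain ⟨a₁, ha₁⟩ := (chartResidue_eq_zero_iff h hz).1 h0
    refine ⟨F, hF, φ * b, Ideal.mul_mem_right _ _ hφI, a₁, ?_⟩
    have h1 := congrArg Subtype.val ha₁
    push_cast at h1 ⊢
    rw [coe_toChart] at h1
    rw [← e]
    linear_combination (x : K) ^ p * h1
  have steps : ∀ M : ℕ, ∃ F ∈ maximalIdeal B ^ p,
      ∃ c ∈ contIdeal (chart B z) (transform (x : K) p f), ∃ a₁ : chart B z,
      (x : K) ^ p * a = F + (x : K) ^ p * (c + (x : K) ^ M * a₁) := by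
    intro M
    induction M with
    | zero => exact ⟨0, zero_mem _, 0, zero_mem _, a, by simp⟩
    | succ M ih =>
      obtain ⟨F, hF, c, hc, a₁, e⟩ := ih
      obtain ⟨F', hF', c', hc', a₂, e'⟩ := step a₁
      refine ⟨F + x ^ M * F', add_mem hF (Ideal.mul_mem_left _ _ hF'), c + toChart z x ^ M * c',
        add_mem hc (Ideal.mul_mem_left _ _ hc'), a₂, ?_⟩
      push_cast
      rw [coe_toChart]
      linear_combination e + (x : K) ^ M * e'
  obtain ⟨N, hN⟩ := hN
  obtain ⟨F, hF, c, hc, a₁, e⟩ := steps N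
  refine ⟨F, hF, c + toChart z x ^ N * a₁, add_mem hc (Ideal.mul_mem_right _ _ ?_), ?_⟩
  · exact pow_mem_contIdeal_transform h le_chart (coeff_transform_mem_chart h hz hf) hN
  · push_cast
    rw [coe_toChart, e]

/-- As `n` is maximal, a denominator outside `n` is invertible modulo `n ^ M`, and `n ^ M` is
absorbed by the new coefficient ideal. This reduces the claim to the chart. -/
theorem exists_locSub_decomposition (h : RegPair x y) (hz : (x : K) * z = y)
    (hxn : toChart z x ∈ n) (hne : n ≠ Ideal.span {toChart z x})
    (hf : ∀ k, f.coeff k ∈ maxPow B p) (hfp : ∃ k, f.coeff k ∉ maxPow B (p + 1))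
    (hN : ∃ N, maximalIdeal B ^ N ≤ contIdeal B f) (a : locSub (chart B z) n) :
    ∃ F ∈ maximalIdeal B ^ p, ∃ c ∈ contIdeal (locSub (chart B z) n) (transform (x : K) p f),
      (x : K) ^ p * a = F + (x : K) ^ p * c := by
  have hmax := isMaximal_of_ne h hz hxn hne
  obtain ⟨M, hM⟩ := exists_pow_le_contIdeal_transform h hz hxn hne hf hfp hN
  obtain ⟨_, g, d, hd, rfl⟩ := a
  have hcop : Ideal.span {d} ⊔ n ^ M = ⊤ := by
    refine Ideal.sup_pow_eq_top ((Ideal.eq_top_iff_one _).2 ?_)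
    obtain ⟨e, i, hi, h1⟩ := hmax.exists_inv hd
    rw [← h1]
    exact Submodule.add_mem_sup (Ideal.mul_mem_left _ _ (Ideal.mem_span_singleton_self d)) hi
  obtain ⟨e, he, ν, hν, heν⟩ := Submodule.mem_sup.1 ((Ideal.eq_top_iff_one _).1 hcop)
  obtain ⟨e, rfl⟩ := Ideal.mem_span_singleton'.1 he
  obtain ⟨F, hF, c, hc, e1⟩ := exists_chart_decomposition h hz hf hfp hN (g * e)
  have hmap : ∀ c ∈ contIdeal (chart B z) (transform (x : K) p f),
      algebraMap _ (locSub (chart B z) n) c ∈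
        contIdeal (locSub (chart B z) n) (transform (x : K) p f) := by
    intro c hc
    have : contIdeal (chart B z) (transform (x : K) p f) ≤
        (contIdeal (locSub (chart B z) n) (transform (x : K) p f)).comap (algebraMap _ _) := by
      refine Ideal.span_le.2 ?_
      rintro b ⟨k, hk⟩
      exact Ideal.subset_span ⟨k, hk⟩
    exact this hc
  have hν' : algebraMap _ (locSub (chart B z) n) ν ∈
      contIdeal (locSub (chart B z) n) (transform (x : K) p f) := by
    refine hM ?_
    rw [maximalIdeal_locSub, ← Ideal.map_pow]
    exact Ideal.mem_map_of_mem _ hν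
  refine ⟨F, hF, algebraMap _ _ c + ⟨_, g, d, hd, rfl⟩ * algebraMap _ _ ν,
    add_mem (hmap c hc) (Ideal.mul_mem_left _ _ hν'), ?_⟩
  have h1 := congrArg Subtype.val heν
  have hd0 := ne_zero_of_notMem hd
  push_cast at h1 e1 ⊢
  rw [coe_algebraMap_locSub, coe_algebraMap_locSub, mul_add, ← add_assoc, ← e1]
  field_simp
  linear_combination (-(x : K) ^ p * g) * h1

/-- The ideal of `B` of elements of order at least `p` whose transform lies in an ideal. -/
def untransform {S : Subring K} (hBS : B ≤ S) (x : B) (p : ℕ) (Q : Ideal S) : Ideal B where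
  carrier := {F | F ∈ maximalIdeal B ^ p ∧ ∃ u ∈ Q, (F : K) = (x : K) ^ p * u}
  zero_mem' := ⟨zero_mem _, 0, zero_mem _, by simp⟩
  add_mem' := by
    rintro a b ⟨ha, u, hu, e⟩ ⟨hb, w, hw, e'⟩
    exact ⟨add_mem ha hb, u + w, add_mem hu hw, by push_cast; rw [e, e']; ring⟩
  smul_mem' := by
    rintro c a ⟨ha, u, hu, e⟩
    exact ⟨Ideal.mul_mem_left _ _ ha, ⟨c, hBS c.2⟩ * u, Ideal.mul_mem_left _ _ hu, by
      rw [smul_eq_mul]; push_cast; rw [e]; ring⟩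

/-- The length of the coefficient ideal drops under transform. -/
theorem chainLE_transform (h : RegPair x y) (hz : (x : K) * z = y)
    (hxn : toChart z x ∈ n) (hne : n ≠ Ideal.span {toChart z x}) (hp : p ≠ 0)
    (hf : ∀ k, f.coeff k ∈ maxPow B p) (hfp : ∃ k, f.coeff k ∉ maxPow B (p + 1))
    (hN : ∃ N, maximalIdeal B ^ N ≤ contIdeal B f) {l : ℕ}
    (hl : ChainLE (l + 1) (contIdeal B f)) :
    ChainLE l (contIdeal (locSub (chart B z) n) (transform (x : K) p f)) := by
  have hx0 : (x : K) ≠ 0 := fun e => h.prime.ne_zero (Subtype.ext e)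
  have hBS : B ≤ locSub (chart B z) n := le_chart.trans (le_locSub _ _)
  set I' := contIdeal (locSub (chart B z) n) (transform (x : K) p f)
  -- `Φ` maps ideals over the new coefficient ideal to ideals over the old one. By the decomposition
  -- above it is strictly increasing, and since `p ≠ 0` it does not reach the unit ideal; hence
  -- chains upstairs are shorter by at least one.
  let Φ := untransform hBS x p
  have hlt : ∀ Q Q' : Ideal (locSub (chart B z) n), I' ≤ Q → Q < Q' → Φ Q < Φ Q' := by
    intro Q Q' hQ hQQ'
    refine lt_of_le_of_ne ?_ fun e => ?_
    · rintro F ⟨hF, u, hu, e⟩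
      exact ⟨hF, u, hQQ'.le hu, e⟩
    · obtain ⟨u, hu, huQ⟩ := SetLike.exists_of_lt hQQ'
      obtain ⟨F, hF, c, hc, e1⟩ := exists_locSub_decomposition h hz hxn hne hf hfp hN u
      have h1 : F ∈ Φ Q' := ⟨hF, u - c, sub_mem hu (hQQ'.le (hQ hc)), by
        push_cast; linear_combination -e1⟩
      rw [← e] at h1
      obtain ⟨-, w, hw, e2⟩ := h1
      refine huQ ?_
      have : u = w + c := Subtype.ext (mul_left_cancel₀ (pow_ne_zero p hx0) (by
        push_cast; rw [e1, e2]; ring))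
      rw [this]
      exact add_mem hw (hQ hc)
  have htop : Φ ⊤ ≠ ⊤ := by
    intro e
    have h1 : (1 : B) ∈ Φ ⊤ := e ▸ Submodule.mem_top
    exact (Ideal.ne_top_iff_one _).1 (Ideal.IsPrime.ne_top (I := maximalIdeal B) inferInstance)
      (Ideal.pow_le_self hp h1.1)
  have key : ∀ l Q, I' ≤ Q → ChainLE (l + 1) (Φ Q) → ChainLE l Q := by
    intro l
    induction l with
    | zero =>
      intro Q hQ hl
      by_contra hQt
      exact htop (hl _ (hlt Q ⊤ hQ (lt_top_iff_ne_top.2 hQt)))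
    | succ l ih => exact fun Q hQ hl Q' hQ' => ih Q' (hQ.trans hQ'.le) (hl _ (hlt Q Q' hQ hQ'))
  refine key l I' le_rfl (hl.mono (Ideal.span_le.2 ?_))
  rintro b ⟨k, hk⟩
  refine ⟨?_, ⟨_, coeff_transform_mem_locSub h hz hf k⟩, Ideal.subset_span ⟨k, rfl⟩, ?_⟩
  · obtain ⟨c, hc, e⟩ := mem_maxPow.1 (hf k)
    rwa [show b = c from Subtype.ext (hk.trans e.symm)]
  · rw [hk, pow_mul_coeff_transform hx0]

end Transform

end AdjointIdeals

end

/-! ### Essential finiteness under transforms, valuation estimates, and the Jacobian of the order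
valuation. -/

section

open IsLocalRing Polynomial

namespace AdjointIdeals

variable {K : Type*} [Field K]

section EssFin

variable {B S : Subring K} {V : ValuationSubring K} {z : K}

theorem EssFin.mono (h : B ≤ S) (hV : EssFin B V) : EssFin S V := by
  obtain ⟨F, hF, hgen⟩ := hV
  refine ⟨F, hF, fun v hv => ?_⟩
  obtain ⟨g, hg, d, hd, e⟩ := hgen v hv
  have : Subring.closure (B ∪ F : Set K) ≤ Subring.closure (S ∪ F : Set K) :=
    Subring.closure_mono (Set.union_subset_union_left _ h)
  exact ⟨g, this hg, d, this hd, e⟩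

theorem valuation_eq_one_of_inv_mem {a : K} (ha0 : a ≠ 0) (ha : a ∈ V) (ha' : a⁻¹ ∈ V) :
    V.valuation a = 1 := by
  refine le_antisymm ((V.valuation_le_one_iff _).2 ha) ?_
  have h1 := (V.valuation_le_one_iff _).2 ha'
  rw [map_inv₀] at h1
  exact (inv_le_one₀ (zero_lt_iff.2 ((_root_.map_ne_zero _).2 ha0))).1 h1

theorem center_le_of_locSub_le {n : Ideal S} [n.IsPrime] (hS : S ≤ V.toSubring)
    (h : locSub S n ≤ V.toSubring) : center V hS ≤ n := by
  intro a ha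
  by_contra han
  have h1 := valuation_eq_one_of_inv_mem (ne_zero_of_notMem han) (hS a.2) (h (inv_mem_locSub han))
  exact ((mem_center).1 ha).ne h1

theorem EssFin.of_locSub {n : Ideal S} [n.IsPrime] (hS : locSub S n ≤ V.toSubring)
    (h : EssFin (locSub S n) V) : EssFin S V := by
  obtain ⟨F, hF, hgen⟩ := h
  have hSV : S ≤ V.toSubring := (le_locSub _ n).trans hS
  set C := Subring.closure (S ∪ F : Set K) with hC
  have hCV : C ≤ V.toSubring := by
    rw [hC, Subring.closure_le]
    exact Set.union_subset hSV hF
  have hSC : S ≤ C := fun b hb => Subring.subset_closure (Or.inl hb)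
  have hle : Subring.closure (locSub S n ∪ F : Set K) ≤ locSub C (center V hCV) := by
    rw [Subring.closure_le]
    rintro a (ha | ha)
    · obtain ⟨g, d, hd, rfl⟩ := ha
      exact ⟨⟨g, hSC g.2⟩, ⟨d, hSC d.2⟩, fun hc => hd (center_le_of_locSub_le hSV hS hc), rfl⟩
    · exact le_locSub _ _ (Subring.subset_closure (Or.inr ha))
  refine ⟨F, hF, fun v hv => ?_⟩
  obtain ⟨_, hg, _, hd, hd1, rfl⟩ := hgen v hv
  obtain ⟨g₁, d₁, hd₁, rfl⟩ := hle hg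
  obtain ⟨g₂, d₂, hd₂, rfl⟩ := hle hd
  rw [notMem_center] at hd₁ hd₂
  refine ⟨g₁ * d₂, C.mul_mem g₁.2 d₂.2, d₁ * g₂, C.mul_mem d₁.2 g₂.2, ?_, ?_⟩
  · rw [map_div₀, hd₂, div_one] at hd1
    rw [map_mul, hd₁, hd1, one_mul]
  · rw [div_div_div_eq]

theorem EssFin.of_chart (hz : z ∈ V) (h : EssFin (chart B z) V) : EssFin B V := by
  classical
  obtain ⟨F, hF, hgen⟩ := h
  have hle : Subring.closure (chart B z ∪ F : Set K) ≤
      Subring.closure (B ∪ (insert z F : Finset K) : Set K) := by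
    rw [Subring.closure_le]
    refine Set.union_subset (chart_le (fun b hb => Subring.subset_closure (Or.inl hb))
      (Subring.subset_closure (Or.inr (by simp)))) fun a ha => Subring.subset_closure (Or.inr ?_)
    simp [Finset.mem_coe.1 ha]
  refine ⟨insert z F, fun a ha => ?_, fun v hv => ?_⟩
  · rcases Finset.mem_insert.1 ha with rfl | ha
    exacts [hz, hF a ha]
  · obtain ⟨g, hg, d, hd, hd1, e⟩ := hgen v hv
    exact ⟨g, hle hg, d, hle hd, hd1, e⟩

theorem EssFin.of_locSub_chart {n : Ideal (chart B z)} [n.IsPrime]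
    (hS : locSub (chart B z) n ≤ V.toSubring) (h : EssFin (locSub (chart B z) n) V) :
    EssFin B V :=
  (h.of_locSub hS).of_chart (hS (le_locSub _ _ mem_chart_self))

theorem essFin_self (hBV : V.toSubring ≤ B) : EssFin B V :=
  ⟨∅, by simp, fun v hv => ⟨v, Subring.subset_closure (Or.inl (hBV hv)), 1, Subring.one_mem _,
    by simp, by simp⟩⟩

end EssFin

section Valuations

variable {V : ValuationSubring K}

theorem valuation_mul_le_mul_iff {c a b : K} (hc : c ≠ 0) :
    V.valuation (c * a) ≤ V.valuation (c * b) ↔ V.valuation a ≤ V.valuation b := by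
  rw [map_mul, map_mul]
  exact mul_le_mul_iff_right₀ (zero_lt_iff.2 ((_root_.map_ne_zero _).2 hc))

/-- The elements of valuation at most `γ`. -/
def leSubgroup (V : ValuationSubring K) (γ : V.ValueGroup) : AddSubgroup K where
  carrier := {a | V.valuation a ≤ γ}
  zero_mem' := by simp
  add_mem' := fun ha hb => V.valuation.map_add_le ha hb
  neg_mem' := fun ha => by
    simpa only [Set.mem_ofPred_eq, Valuation.map_neg] using ha

theorem mem_leSubgroup {γ : V.ValueGroup} {a : K} : a ∈ leSubgroup V γ ↔ V.valuation a ≤ γ := Iff.rfl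

theorem exists_coeff_max (V : ValuationSubring K) (g : K[X]) :
    ∃ l, ∀ k, V.valuation (g.coeff k) ≤ V.valuation (g.coeff l) := by
  by_cases hg : g = 0
  · exact ⟨0, by simp [hg]⟩
  obtain ⟨l, hl, hmax⟩ := Finset.exists_max_image g.support (fun k => V.valuation (g.coeff k))
    (nonempty_support_iff.2 hg)
  refine ⟨l, fun k => ?_⟩
  by_cases hk : k ∈ g.support
  · exact hmax k hk
  · rw [notMem_support_iff.1 hk, map_zero]; exact zero_le

/-- The coefficients of `j * H * s` are bounded by the largest value of a coefficient of `g`. Since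
`H` has a coefficient of value one, Gauss' lemma passes the bound to `j * s`. -/
theorem exists_valuation_coeff_mul_le {g : K[X]} {i : Fin 2} {H h s s' w : MvPolynomial (Fin 2) K}
    {j : K} (hH : CoeffIn V.toSubring.toAddSubgroup H) (hH1 : ∃ i, V.valuation (H.coeff i) = 1)
    (hh : CoeffIn V.toSubring.toAddSubgroup h) (hw : CoeffIn V.toSubring.toAddSubgroup w)
    (e : H * s = h * s' + g.toMvPolynomial i * w) (hj : j ∈ V)
    (hs' : ∀ i, ∃ l, V.valuation (s'.coeff i * j) ≤ V.valuation (g.coeff l)) (i : Fin 2 →₀ ℕ) :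
    ∃ l, V.valuation (s.coeff i * j) ≤ V.valuation (g.coeff l) := by
  obtain ⟨l, hl⟩ := exists_coeff_max V g
  refine ⟨l, ?_⟩
  set γ := V.valuation (g.coeff l)
  have hmul : ∀ a ∈ V.toSubring.toAddSubgroup, ∀ b ∈ leSubgroup V γ, a * b ∈ leSubgroup V γ := by
    intro a ha b hb
    rw [mem_leSubgroup, map_mul]
    exact (mul_le_of_le_one_left' ((V.valuation_le_one_iff _).2 ha)).trans hb
  have h1 : CoeffIn (leSubgroup V γ) (MvPolynomial.C j * s') := by
    intro i
    obtain ⟨k, hk⟩ := hs' i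
    rw [MvPolynomial.coeff_C_mul, mul_comm, mem_leSubgroup]
    exact hk.trans (hl k)
  have h2 : CoeffIn (leSubgroup V γ) (g.toMvPolynomial ‹Fin 2›) := coeffIn_toMvPolynomial hl
  have h3 : CoeffIn V.toSubring.toAddSubgroup (w * MvPolynomial.C j) :=
    hw.mul_subring (coeffIn_C hj)
  have h4 : CoeffIn (leSubgroup V γ) (H * (MvPolynomial.C j * s)) := by
    have e' : H * (MvPolynomial.C j * s) = h * (MvPolynomial.C j * s') +
        (w * MvPolynomial.C j) * g.toMvPolynomial ‹Fin 2› := by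
      linear_combination MvPolynomial.C j * e
    rw [e']
    exact (hh.mul hmul h1).add (h3.mul hmul h2)
  have h5 := valuation_coeff_le_of_mul (γ := γ) hH hH1 (fun i => h4 i) i
  rwa [MvPolynomial.coeff_C_mul, mul_comm] at h5

end Valuations

section OrdVal

variable {B : Subring K} [IsLocalRing B] [IsNoetherianRing B] [IsFractionRing B K] {x y : B} {z : K}

theorem chart_le_ordVal (h : RegPair x y) (hz : (x : K) * z = y) :
    chart B z ≤ (ordVal h hz).toSubring := by
  have : (Ideal.span {toChart z x}).IsPrime :=
    (Ideal.span_singleton_prime (prime_toChart h hz).ne_zero).2 (prime_toChart h hz)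
  rw [ordVal_toSubring]
  exact le_locSub _ _

theorem isNoetherianRing_ordVal (h : RegPair x y) (hz : (x : K) * z = y) :
    IsNoetherianRing (ordVal h hz) := by
  have : (Ideal.span {toChart z x}).IsPrime :=
    (Ideal.span_singleton_prime (prime_toChart h hz).ne_zero).2 (prime_toChart h hz)
  exact inferInstanceAs (IsNoetherianRing (locSub (chart B z) (Ideal.span {toChart z x})))

theorem essFin_ordVal (h : RegPair x y) (hz : (x : K) * z = y) : EssFin B (ordVal h hz) := by
  have hp : (Ideal.span {toChart z x}).IsPrime :=
    (Ideal.span_singleton_prime (prime_toChart h hz).ne_zero).2 (prime_toChart h hz)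
  exact EssFin.of_locSub_chart (z := z) (n := Ideal.span {toChart z x}) le_rfl (essFin_self le_rfl)

/-- The order valuation ring is a localization of the chart, so its Jacobian over the chart is the
unit ideal, and over `B` it contains `x`. -/
theorem mem_relJac_ordVal (h : RegPair x y) (hz : (x : K) * z = y) :
    (⟨x, chart_le_ordVal h hz (le_chart x.2)⟩ : ordVal h hz) ∈ relJac (ordVal h hz) B := by
  have hp : (Ideal.span {toChart z x}).IsPrime :=
    (Ideal.span_singleton_prime (prime_toChart h hz).ne_zero).2 (prime_toChart h hz)
  have h1 := span_mul_relJac_chart_le (V := ordVal h hz) (le_chart.trans (chart_le_ordVal h hz))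
    (chart_le_ordVal h hz mem_chart_self) hz
  have h2 : relSub (ordVal h hz) (locSub (chart B z) (Ideal.span {toChart z x})) = _ :=
    relJac_locSub (chart_le_ordVal h hz) (center_le_of_locSub_le _ le_rfl)
  have h3 : relJac (ordVal h hz) (chart B z) = ⊤ := by
    rw [← relJac_self, relJac, relJac, ordVal_toSubring, h2]
  rw [h3, Ideal.mul_top] at h1
  exact h1 (Ideal.mem_span_singleton_self _)

end OrdVal

end AdjointIdeals

end

/-! ### The local problem: orders, transforms, and solutions on a chart. -/

section

open IsLocalRing Polynomial

namespace AdjointIdeals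

variable {K : Type*} [Field K]

/-- The hypotheses of the local theorem: `f` and `g` are polynomials whose coefficients generate
ideals `I` and `J` of `B` containing a power of the maximal ideal, and `r ∈ B` satisfies the
valuative conditions for `IJ`. -/
structure IsDatum (B : Subring K) [IsLocalRing B] (f g : K[X]) (r : K) : Prop where
  f_mem : ∀ k, f.coeff k ∈ B
  g_mem : ∀ k, g.coeff k ∈ B
  f_prim : ∃ N, maximalIdeal B ^ N ≤ contIdeal B f
  g_prim : ∃ N, maximalIdeal B ^ N ≤ contIdeal B g
  r_mem : r ∈ B
  adj : ∀ V : ValuationSubring K, IsNoetherianRing V → EssFin B V → B ≤ V.toSubring →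
    ∀ j ∈ relJac V B, ∃ k l, V.valuation (r * j) ≤ V.valuation (f.coeff k * g.coeff l)

/-- A polynomial whose coefficients satisfy the valuative conditions for the ideal generated by
the coefficients of `g`. -/
def IsAdj (B : Subring K) (g : K[X]) (s : MvPolynomial (Fin 2) K) : Prop :=
  ∀ V : ValuationSubring K, IsNoetherianRing V → EssFin B V → B ≤ V.toSubring →
    ∀ j ∈ relJac V B, ∀ i, ∃ l, V.valuation (s.coeff i * j) ≤ V.valuation (g.coeff l)

/-- A solution `h r = α s + β t` of the local problem, where `α` and `β` are the forms with
coefficients those of `f` and `g`. -/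
structure IsSol (B : Subring K) [IsLocalRing B] (f g : K[X]) (r : K) (p q : ℕ)
    (h s t : MvPolynomial (Fin 2) K) : Prop where
  h_mem : CoeffIn B.toAddSubgroup h
  h_unit : ∃ i, h.coeff i ∉ maxPow B 1
  s_mem : CoeffIn (maxPow B (q - 1)) s
  t_mem : CoeffIn (maxPow B (p - 1)) t
  eq : h * MvPolynomial.C r = f.toMvPolynomial 0 * s + g.toMvPolynomial 1 * t
  s_adj : IsAdj B g s
  t_adj : IsAdj B f t

section

variable {B : Subring K} [IsLocalRing B] [IsNoetherianRing B] [IsFractionRing B K] {x y : B} {z : K}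
  {f g : K[X]} {r : K} {p q : ℕ}

omit [IsNoetherianRing B] [IsFractionRing B K] in
theorem mem_maxPow_zero {a : K} (ha : a ∈ B) : a ∈ maxPow B 0 :=
  mem_maxPow.2 ⟨⟨a, ha⟩, by simp, rfl⟩

/-- Test the hypothesis on the order valuation with the element `x` of the Jacobian: the order of `r
x` is at least `p + q`. -/
theorem IsDatum.mem_maxPow (hd : IsDatum B f g r) (h : RegPair x y)
    (hf : ∀ k, f.coeff k ∈ maxPow B p) (hg : ∀ k, g.coeff k ∈ maxPow B q) :
    r ∈ maxPow B (p + q - 1) := by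
  have hx0 : (x : K) ≠ 0 := fun e => h.prime.ne_zero (Subtype.ext e)
  rcases Nat.eq_zero_or_pos (p + q) with h0 | hpos
  · rw [h0]; exact mem_maxPow_zero hd.r_mem
  obtain ⟨m, hm⟩ : ∃ m, p + q = m + 1 := ⟨p + q - 1, by omega⟩
  rw [hm, Nat.add_sub_cancel]
  set z : K := y / x
  have hz : (x : K) * z = y := mul_div_cancel₀ _ hx0
  have hp : (Ideal.span {toChart z x}).IsPrime :=
    (Ideal.span_singleton_prime (prime_toChart h hz).ne_zero).2 (prime_toChart h hz)
  have hV := chart_le_ordVal h hz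
  obtain ⟨k, l, hkl⟩ := hd.adj (ordVal h hz) (isNoetherianRing_ordVal h hz) (essFin_ordVal h hz)
    (le_chart.trans hV) _ (mem_relJac_ordVal h hz)
  have h1 : f.coeff k * g.coeff l = x ^ (m + 1) *
      ((((x : K) ^ p)⁻¹ * f.coeff k) * (((x : K) ^ q)⁻¹ * g.coeff l)) := by
    rw [← hm, pow_add]; field_simp
  have h2 : r * x = x ^ (m + 1) * (((x : K) ^ m)⁻¹ * r) := by rw [pow_succ]; field_simp
  change (ordVal h hz).valuation (r * x) ≤ _ at hkl
  rw [h1, h2, valuation_mul_le_mul_iff (pow_ne_zero _ hx0)] at hkl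
  have h3 : ((x : K) ^ m)⁻¹ * r ∈ ordVal h hz := by
    refine (ValuationSubring.valuation_le_one_iff _ _).1 (hkl.trans ?_)
    refine (ValuationSubring.valuation_le_one_iff _ _).2 ?_
    exact mul_mem (hV (inv_pow_mul_mem_chart h hz (hf k))) (hV (inv_pow_mul_mem_chart h hz (hg l)))
  refine AdjointIdeals.mem_maxPow.2 ⟨⟨r, hd.r_mem⟩, ?_, rfl⟩
  refine mem_pow_of_eq_pow_mul_locSub (k := m) (b := ⟨r, hd.r_mem⟩) h hz h3 ?_
  rw [mul_inv_cancel_left₀ (pow_ne_zero _ hx0)]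

/-- While `f` and `g` together are divided by `x^(m+1)`, only `x^m` can be taken from `r`. The
missing factor is supplied by the Jacobian, since `x J_{V/B[z]}` lies in `J_{V/B}`. -/
theorem IsDatum.transform (hd : IsDatum B f g r) (h : RegPair x y) (hz : (x : K) * z = y)
    {n : Ideal (chart B z)} [n.IsPrime] (hxn : toChart z x ∈ n)
    (hne : n ≠ Ideal.span {toChart z x})
    (hf : ∀ k, f.coeff k ∈ maxPow B p) (hfp : ∃ k, f.coeff k ∉ maxPow B (p + 1))
    (hg : ∀ k, g.coeff k ∈ maxPow B q) (hgq : ∃ k, g.coeff k ∉ maxPow B (q + 1))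
    {m : ℕ} (hm : p + q = m + 1) :
    IsDatum (locSub (chart B z) n) (transform (x : K) p f) (transform (x : K) q g)
      (((x : K) ^ m)⁻¹ * r) where
  f_mem := coeff_transform_mem_locSub h hz hf
  g_mem := coeff_transform_mem_locSub h hz hg
  f_prim := exists_pow_le_contIdeal_transform h hz hxn hne hf hfp hd.f_prim
  g_prim := exists_pow_le_contIdeal_transform h hz hxn hne hg hgq hd.g_prim
  r_mem := le_locSub _ _ (inv_pow_mul_mem_chart h hz (by
    have := hd.mem_maxPow h hf hg
    rwa [hm] at this))
  adj := by
    intro V hVn hV hSV j hj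
    have hx0 : (x : K) ≠ 0 := fun e => h.prime.ne_zero (Subtype.ext e)
    have hcV : chart B z ≤ V.toSubring := (le_locSub _ n).trans hSV
    have hBV : B ≤ V.toSubring := le_chart.trans hcV
    have h1 : relSub V (locSub (chart B z) n) = relSub V (chart B z) :=
      relJac_locSub hcV (center_le_of_locSub_le hcV hSV)
    rw [relJac, h1] at hj
    have h2 := span_mul_relJac_chart_le hBV (hcV mem_chart_self) hz
      (Ideal.mul_mem_mul (Ideal.mem_span_singleton_self _) hj)
    obtain ⟨k, l, hkl⟩ := hd.adj V hVn (hV.of_locSub_chart hSV) hBV _ h2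
    refine ⟨k, l, ?_⟩
    change V.valuation (r * (x * j)) ≤ _ at hkl
    have h3 : r * (x * j) = x ^ (m + 1) * (((x : K) ^ m)⁻¹ * r * j) := by rw [pow_succ]; field_simp
    rw [h3, ← pow_mul_coeff_transform hx0 p f, ← pow_mul_coeff_transform hx0 q g, mul_mul_mul_comm,
      ← pow_add, hm, valuation_mul_le_mul_iff (pow_ne_zero _ hx0)] at hkl
    exact hkl

end

section Chart

theorem CoeffIn.exists_den {A : Subring K} {n : Ideal A} [hn : n.IsPrime]
    {P : MvPolynomial (Fin 2) K} (hP : CoeffIn (locSub A n).toAddSubgroup P) :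
    ∃ d : A, d ∉ n ∧ CoeffIn A.toAddSubgroup (MvPolynomial.C (d : K) * P) := by
  classical
  choose g d hd e using hP
  refine ⟨∏ i ∈ P.support, d i, fun hmem => ?_, fun i => ?_⟩
  · obtain ⟨i, -, hi⟩ := (hn.prod_mem_iff).1 hmem
    exact hd i hi
  · rw [MvPolynomial.coeff_C_mul]
    by_cases hi : i ∈ P.support
    · rw [← Finset.mul_prod_erase _ _ hi, e i]
      have : ((d i * ∏ j ∈ P.support.erase i, d j : A) : K) * (g i / d i) =
          ((∏ j ∈ P.support.erase i, d j) * g i : A) := by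
        have := ne_zero_of_notMem (hd i)
        push_cast
        field_simp
      rw [this]
      exact Subtype.mem _
    · rw [MvPolynomial.notMem_support_iff.1 hi, mul_zero]; exact A.zero_mem

variable {B : Subring K} [IsLocalRing B] [IsNoetherianRing B] [IsFractionRing B K] {x y : B} {z : K}
  {f g : K[X]} {r : K} {p q : ℕ}

/-- The solutions at the points of the chart, freed of denominators, are patched together.
Multiplying back by `x^(p+q+1) = x^(p+1) x^q = x^(q+1) x^p` produces the factors `x^q` and `x^p`. -/
theorem exists_chart_solution (hd : IsDatum B f g r) (h : RegPair x y) (hz : (x : K) * z = y)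
    (hf : ∀ k, f.coeff k ∈ maxPow B (p + 1)) (hfp : ∃ k, f.coeff k ∉ maxPow B (p + 2))
    (hg : ∀ k, g.coeff k ∈ maxPow B (q + 1)) (hgq : ∃ k, g.coeff k ∉ maxPow B (q + 2))
    (hnode : ∀ (n : Ideal (chart B z)) [n.IsPrime], toChart z x ∈ n →
      n ≠ Ideal.span {toChart z x} → ∃ a b H s t, IsSol (locSub (chart B z) n)
        (transform (x : K) (p + 1) f) (transform (x : K) (q + 1) g)
        (((x : K) ^ (p + q + 1))⁻¹ * r) a b H s t) :
    ∃ H s t : MvPolynomial (Fin 2) K, CoeffIn B.toAddSubgroup H ∧ (∃ i, H.coeff i ∉ maxPow B 1) ∧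
      CoeffIn (chart B z).toAddSubgroup s ∧ CoeffIn (chart B z).toAddSubgroup t ∧
      H * MvPolynomial.C r = f.toMvPolynomial 0 * (MvPolynomial.C (x : K) ^ q * s) +
        g.toMvPolynomial 1 * (MvPolynomial.C (x : K) ^ p * t) := by
  have hx0 : (x : K) ≠ 0 := fun e => h.prime.ne_zero (Subtype.ext e)
  obtain ⟨N, hN⟩ := hd.f_prim
  have hf0 := ne_zero_of_pow_le_contIdeal h hN
  obtain ⟨f₀, hf₀⟩ := exists_map_eq hd.f_mem
  obtain ⟨g₀, hg₀⟩ := exists_map_eq hd.g_mem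
  obtain ⟨f₁, hf₁⟩ := exists_map_eq (coeff_transform_mem_chart h hz hf)
  obtain ⟨g₁, hg₁⟩ := exists_map_eq (coeff_transform_mem_chart h hz hg)
  have hr := inv_pow_mul_mem_chart h hz (hd.mem_maxPow h hf hg)
  have hmm : p + 1 + (q + 1) - 1 = p + q + 1 := by omega
  rw [hmm] at hr
  have hlift : ∀ {f : K[X]} {f₀ : B[X]} {f₁ : (chart B z)[X]} {p : ℕ}, f₀.map B.subtype = f →
      f₁.map (chart B z).subtype = transform (x : K) p f →
      f₀.map (toChartHom B z) = C (toChart z x ^ p) * f₁ := by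
    intro f f₀ f₁ p e e'
    ext k
    rw [coeff_map, coeff_C_mul, toChartHom_apply, coe_toChart]
    have h1 := congrArg (fun P => P.coeff k) e
    have h2 := congrArg (fun P => P.coeff k) e'
    simp only [coeff_map, Subring.subtype_apply] at h1 h2
    push_cast
    rw [h1, h2, coe_toChart, pow_mul_coeff_transform hx0]
  have hnd : ∀ {f : K[X]} {f₁ : (chart B z)[X]} {p : ℕ}, (∀ k, f.coeff k ∈ maxPow B p) →
      (∃ k, f.coeff k ∉ maxPow B (p + 1)) → f₁.map (chart B z).subtype = transform (x : K) p f →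
      ∃ k, ¬ toChart z x ∣ f₁.coeff k := by
    intro f f₁ p hf hfp e
    obtain ⟨k, a, ha, hxa⟩ := exists_not_dvd_transform h hz hf hfp
    refine ⟨k, ?_⟩
    have h1 := congrArg (fun P => P.coeff k) e
    simp only [coeff_map, Subring.subtype_apply] at h1
    rwa [show f₁.coeff k = a from Subtype.ext (h1.trans ha.symm)]
  have hinj : Function.Injective (MvPolynomial.map (σ := Fin 2) (chart B z).subtype) :=
    MvPolynomial.map_injective _ (Subring.subtype_injective _)
  obtain ⟨H, ⟨i, hi⟩, hH⟩ := exists_unit_coeff_of_chart h hz (hlift hf₀ hf₁) (hlift hg₀ hg₁)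
    (by rintro rfl; simp at hf₀; exact hf0 hf₀.symm)
    (isRelPrime_of_pow_le_contIdeal h (by rintro rfl; simp at hf₀; exact hf0 hf₀.symm)
      (by rw [hg₀]; exact hd.g_prim))
    (hnd hf hfp hf₁) (hnd hg hgq hg₁) ⟨_, hr⟩ (by
      intro n hn hxn hne
      obtain ⟨a, b, H, s, t, hsol⟩ := hnode n hxn hne
      obtain ⟨d₁, hd₁, hH⟩ := hsol.h_mem.exists_den
      obtain ⟨d₂, hd₂, hs⟩ := (hsol.s_mem.mono (maxPow_le _)).exists_den
      obtain ⟨d₃, hd₃, ht⟩ := (hsol.t_mem.mono (maxPow_le _)).exists_den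
      have hmulC : ∀ (c : chart B z) (P : MvPolynomial (Fin 2) K),
          CoeffIn (chart B z).toAddSubgroup P →
          CoeffIn (chart B z).toAddSubgroup (MvPolynomial.C (c : K) * P) := fun c P hP =>
        hP.C_mul fun a ha => Subring.mul_mem _ c.2 ha
      obtain ⟨H', hH'⟩ := coeffIn_subring_iff.1 (hmulC (d₂ * d₃) _ hH)
      obtain ⟨s', hs'⟩ := coeffIn_subring_iff.1 (hmulC (d₁ * d₃) _ hs)
      obtain ⟨t', ht'⟩ := coeffIn_subring_iff.1 (hmulC (d₁ * d₂) _ ht)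
      refine ⟨H', ?_, ?_⟩
      · obtain ⟨i, hi⟩ := hsol.h_unit
        refine ⟨i, fun hmem => hi ?_⟩
        have h1 : algebraMap _ (locSub (chart B z) n) (H'.coeff i) =
            algebraMap _ (locSub (chart B z) n) (d₁ * (d₂ * d₃)) * ⟨H.coeff i, hsol.h_mem i⟩ := by
          refine Subtype.ext ?_
          have h2 := congrArg (MvPolynomial.coeff i) hH'
          rw [MvPolynomial.coeff_map, MvPolynomial.coeff_C_mul, MvPolynomial.coeff_C_mul] at h2
          refine Eq.trans h2 ?_
          push_cast
          simp only [coe_algebraMap_locSub]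
          ring
        rw [← algebraMap_mem_maximalIdeal_locSub, h1] at hmem
        rcases (inferInstance : (maximalIdeal (locSub (chart B z) n)).IsPrime).mem_or_mem hmem
          with hm | hm
        · rw [algebraMap_mem_maximalIdeal_locSub] at hm
          rcases hn.mem_or_mem hm with hm | hm
          · exact absurd hm hd₁
          · rcases hn.mem_or_mem hm with hm | hm
            exacts [absurd hm hd₂, absurd hm hd₃]
        · exact mem_maxPow.2 ⟨_, by rwa [pow_one], rfl⟩
      · rw [Ideal.mem_span_pair]
        refine ⟨s', t', hinj ?_⟩
        simp only [map_add, map_mul, map_toMvPolynomial, hf₁, hg₁, hH', hs', ht',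
          MvPolynomial.map_C]
        simp only [Subring.coe_mul, map_mul, Subring.subtype_apply]
        have h3 := hsol.eq
        rw [map_mul] at h3
        linear_combination -(MvPolynomial.C (d₁ : K) * MvPolynomial.C (d₂ : K) *
          MvPolynomial.C (d₃ : K)) * h3)
  rw [Ideal.mem_span_pair] at hH
  obtain ⟨s, t, e⟩ := hH
  refine ⟨H.map B.subtype, s.map (chart B z).subtype, t.map (chart B z).subtype,
    coeffIn_subring_iff.2 ⟨H, rfl⟩, ⟨i, ?_⟩, coeffIn_subring_iff.2 ⟨s, rfl⟩,
    coeffIn_subring_iff.2 ⟨t, rfl⟩, ?_⟩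
  · rw [MvPolynomial.coeff_map]
    intro hm
    obtain ⟨b, hb, e⟩ := mem_maxPow.1 hm
    rw [pow_one] at hb
    rw [show b = H.coeff i from Subtype.ext e] at hb
    exact hi hb
  · have e' := congrArg (MvPolynomial.map (chart B z).subtype) e
    simp only [map_add, map_mul, map_toMvPolynomial, hf₁, hg₁, MvPolynomial.map_C,
      MvPolynomial.map_map] at e'
    have h1 : (chart B z).subtype.comp (toChartHom B z) = B.subtype := rfl
    rw [h1] at e'
    have hC : ∀ k : ℕ, ∀ f : K[X], ∀ i : Fin 2, f.toMvPolynomial i =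
        MvPolynomial.C (x : K) ^ k * (transform (x : K) k f).toMvPolynomial i := by
      intro k f i
      rw [transform, map_mul, toMvPolynomial_C, ← mul_assoc, ← map_pow, ← map_mul,
        mul_inv_cancel₀ (pow_ne_zero k hx0), map_one, one_mul]
    have hrr : (MvPolynomial.C r : MvPolynomial (Fin 2) K) = MvPolynomial.C (x : K) ^ (p + q + 1) *
        MvPolynomial.C (((x : K) ^ (p + q + 1))⁻¹ * r) := by
      rw [← map_pow, ← map_mul, mul_inv_cancel_left₀ (pow_ne_zero _ hx0)]
    rw [hC (p + 1) f, hC (q + 1) g, hrr]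
    change _ = _ * MvPolynomial.C (((x : K) ^ (p + q + 1))⁻¹ * r) at e'
    linear_combination -MvPolynomial.C (x : K) ^ (p + q + 1) * e'

end Chart

end AdjointIdeals

end

/-! ### The adjoint conditions for a glued solution, and the induction. -/

section

open IsLocalRing Polynomial

namespace AdjointIdeals

variable {K : Type*} [Field K]

theorem toMvPolynomial_transform {x : K} (hx : x ≠ 0) (k : ℕ) (f : K[X]) (i : Fin 2) :
    f.toMvPolynomial i = MvPolynomial.C x ^ k * (transform x k f).toMvPolynomial i := by
  rw [transform, map_mul, toMvPolynomial_C, ← mul_assoc, ← map_pow, ← map_mul,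
    mul_inv_cancel₀ (pow_ne_zero k hx), map_one, one_mul]

variable {B : Subring K} [IsLocalRing B] {x y : B} {z : K} {f g : K[X]} {r : K} {p q : ℕ}

/-- A valuation not centered on the maximal ideal sees an ideal containing a power of it as the unit
ideal. -/
theorem exists_one_le_valuation_coeff {V : ValuationSubring K} (hBV : B ≤ V.toSubring)
    (hgN : ∃ N, maximalIdeal B ^ N ≤ contIdeal B g) {a : B}
    (ha : a ∈ maximalIdeal B) (hva : ¬ V.valuation a < 1) : ∃ l, 1 ≤ V.valuation (g.coeff l) := by
  by_contra hcon
  push Not at hcon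
  obtain ⟨N, hN⟩ := hgN
  have h1 : contIdeal B g ≤ center V hBV := by
    refine Ideal.span_le.2 ?_
    rintro b ⟨k, hk⟩
    exact mem_center.2 (hk ▸ hcon k)
  exact hva (mem_center.1 (Ideal.IsPrime.mem_of_pow_mem (inferInstance : (center V hBV).IsPrime) N
    (h1 (hN (Ideal.pow_mem_pow ha N)))))

/-- For the order valuation only orders count: `q` from `s` and one from `j` make up the order `q +
1` of `g`. -/
theorem exists_valuation_le_of_order [IsNoetherianRing B] (h : RegPair x y) (hz : (x : K) * z = y)
    {V : ValuationSubring K} (hcV : chart B z ≤ V.toSubring)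
    (hV : ∀ a : chart B z, ¬ toChart z x ∣ a → V.valuation a = 1)
    (hg : ∀ k, g.coeff k ∈ maxPow B (q + 1)) (hgq : ∃ k, g.coeff k ∉ maxPow B (q + 2))
    {s : MvPolynomial (Fin 2) K} (hs : CoeffIn (maxPow B q) s) {j : K}
    (hj : V.valuation j ≤ V.valuation x) (i : Fin 2 →₀ ℕ) :
    ∃ l, V.valuation (s.coeff i * j) ≤ V.valuation (g.coeff l) := by
  have hx0 : (x : K) ≠ 0 := fun e => h.prime.ne_zero (Subtype.ext e)
  obtain ⟨l, a, ha, hxa⟩ := exists_not_dvd_transform h hz hg hgq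
  refine ⟨l, ?_⟩
  have h1 := inv_pow_mul_mem_chart h hz (hs i)
  have h2 : s.coeff i = x ^ q * (((x : K) ^ q)⁻¹ * s.coeff i) := by
    rw [mul_inv_cancel_left₀ (pow_ne_zero _ hx0)]
  rw [h2, ← pow_mul_coeff_transform hx0 (q + 1) g, ← ha, map_mul _ _ (a : K), hV a hxa, mul_one,
    pow_succ, mul_assoc, valuation_mul_le_mul_iff (pow_ne_zero q hx0), map_mul]
  exact (mul_le_of_le_one_left' ((V.valuation_le_one_iff _).2 (hcV h1))).trans hj

variable [IsNoetherianRing B] [IsFractionRing B K]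

/-- If `V` is not centered on `m` the conditions are trivial, and for the order valuation they
follow from the orders of `s` and `t`. Otherwise `V` is centered on an infinitely near point, where
`hnode` provides a solution with adjoint coefficients. An element of `J_{V/B}` is `x` times one of
the Jacobian over that point, and the conditions for `s` and `t` are compared with those for `sn`
and `tn`. -/
theorem isAdj_of_eq (hd : IsDatum B f g r) (h : RegPair x y)
    (hf : ∀ k, f.coeff k ∈ maxPow B (p + 1)) (hfp : ∃ k, f.coeff k ∉ maxPow B (p + 2))
    (hg : ∀ k, g.coeff k ∈ maxPow B (q + 1)) (hgq : ∃ k, g.coeff k ∉ maxPow B (q + 2))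
    (hnode : ∀ (x y : B) (z : K), RegPair x y → (x : K) * z = y →
      ∀ (n : Ideal (chart B z)) [n.IsPrime], toChart z x ∈ n →
      n ≠ Ideal.span {toChart z x} → ∃ a b H s t, IsSol (locSub (chart B z) n)
        (transform (x : K) (p + 1) f) (transform (x : K) (q + 1) g)
        (((x : K) ^ (p + q + 1))⁻¹ * r) a b H s t)
    {H s t : MvPolynomial (Fin 2) K} (hH : CoeffIn B.toAddSubgroup H)
    (hs : CoeffIn (maxPow B q) s) (ht : CoeffIn (maxPow B p) t)
    (e : H * MvPolynomial.C r = f.toMvPolynomial 0 * s + g.toMvPolynomial 1 * t) :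
    IsAdj B g s ∧ IsAdj B f t := by
  suffices hmain : ∀ V : ValuationSubring K, IsNoetherianRing V → EssFin B V → B ≤ V.toSubring →
      ∀ j ∈ relJac V B, (∀ i, ∃ l, V.valuation (s.coeff i * j) ≤ V.valuation (g.coeff l)) ∧
        (∀ i, ∃ l, V.valuation (t.coeff i * j) ≤ V.valuation (f.coeff l)) from
    ⟨fun V hVn hV hBV j hj => (hmain V hVn hV hBV j hj).1,
      fun V hVn hV hBV j hj => (hmain V hVn hV hBV j hj).2⟩
  intro V hVn hV hBV j hj
  by_cases hdom : ∀ a ∈ maximalIdeal B, V.valuation (a : K) < 1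
  swap
  · push Not at hdom
    obtain ⟨a, ha, hva⟩ := hdom
    have key : ∀ {g : K[X]} {s : MvPolynomial (Fin 2) K} {q : ℕ}, CoeffIn (maxPow B q) s →
        (∃ N, maximalIdeal B ^ N ≤ contIdeal B g) →
        ∀ i, ∃ l, V.valuation (s.coeff i * j) ≤ V.valuation (g.coeff l) := by
      intro g s q hs hgN i
      obtain ⟨l, hl⟩ := exists_one_le_valuation_coeff hBV hgN ha hva.not_gt
      exact ⟨l, ((V.valuation_le_one_iff _).2 (mul_mem (hBV (maxPow_le _ (hs i))) j.2)).trans hl⟩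
    exact ⟨key hs hd.g_prim, key ht hd.f_prim⟩
  have hVB : Dominates V B := ⟨hBV, hdom⟩
  obtain ⟨x, y, z, h, hz, hzV, -⟩ := exists_coordinate h V
  have hx0 : (x : K) ≠ 0 := fun e => h.prime.ne_zero (Subtype.ext e)
  have hcV : chart B z ≤ V.toSubring := chart_le hBV hzV
  have hj' := relJac_le_span_mul h hz hVB hV hzV hj
  obtain ⟨j', hj'm, hjj⟩ := Ideal.mem_span_singleton_mul.1 hj'
  have hjj' : (j : K) = x * j' := (congrArg Subtype.val hjj).symm
  by_cases hne : center V hcV = Ideal.span {toChart z x}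
  · have hV1 : ∀ a : chart B z, ¬ toChart z x ∣ a → V.valuation a = 1 := by
      intro a ha
      rwa [← Ideal.mem_span_singleton, ← hne, notMem_center] at ha
    have hvj : V.valuation j ≤ V.valuation x := by
      rw [hjj', map_mul]
      exact mul_le_of_le_one_right' ((V.valuation_le_one_iff _).2 j'.2)
    exact ⟨exists_valuation_le_of_order h hz hcV hV1 hg hgq hs hvj,
      exists_valuation_le_of_order h hz hcV hV1 hf hfp ht hvj⟩
  have hxn : toChart z x ∈ center V hcV := mem_center.2 (hdom x h.left_mem)
  obtain ⟨a, b, Hn, sn, tn, hsol⟩ := hnode x y z h hz (center V hcV) hxn hne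
  set S := locSub (chart B z) (center V hcV)
  have hSV : Dominates V S := dominates_locSub_center hcV
  have hBS : B ≤ S := le_chart.trans (le_locSub _ _)
  obtain ⟨y', hreg⟩ := exists_regPair_locSub h hz (center V hcV) hxn hne
  have hjS : j' ∈ relJac V S := by
    rw [relJac, relJac_locSub hcV le_rfl]; exact hj'm
  have htr : ∀ {k : ℕ} {s : MvPolynomial (Fin 2) K}, CoeffIn (maxPow B k) s →
      CoeffIn S.toAddSubgroup (MvPolynomial.C ((x : K) ^ k)⁻¹ * s) ∧
      s = MvPolynomial.C (x : K) ^ k * (MvPolynomial.C ((x : K) ^ k)⁻¹ * s) := by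
    intro k s hs
    refine ⟨hs.C_mul fun a ha => le_locSub _ _ (inv_pow_mul_mem_chart h hz ha), ?_⟩
    rw [← mul_assoc, ← map_pow, ← map_mul, mul_inv_cancel₀ (pow_ne_zero k hx0), map_one, one_mul]
  obtain ⟨hs'S, hs'⟩ := htr hs
  obtain ⟨ht'S, ht'⟩ := htr ht
  set s' := MvPolynomial.C ((x : K) ^ q)⁻¹ * s
  set t' := MvPolynomial.C ((x : K) ^ p)⁻¹ * t
  set X : MvPolynomial (Fin 2) K := MvPolynomial.C (x : K) with hX
  have hX0 : X ≠ 0 := (map_ne_zero_iff _ (MvPolynomial.C_injective _ _)).2 hx0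
  have hHS : CoeffIn S.toAddSubgroup H := hH.mono hBS
  have hrr : (MvPolynomial.C r : MvPolynomial (Fin 2) K) = X ^ (p + q + 1) *
      MvPolynomial.C (((x : K) ^ (p + q + 1))⁻¹ * r) := by
    rw [hX, ← map_pow, ← map_mul, mul_inv_cancel_left₀ (pow_ne_zero _ hx0)]
  have e' : H * MvPolynomial.C (((x : K) ^ (p + q + 1))⁻¹ * r) =
      (transform (x : K) (p + 1) f).toMvPolynomial 0 * s' +
      (transform (x : K) (q + 1) g).toMvPolynomial 1 * t' := by
    refine mul_left_cancel₀ (pow_ne_zero (p + q + 1) hX0) ?_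
    have hf' := toMvPolynomial_transform hx0 (p + 1) f 0
    have hg' := toMvPolynomial_transform hx0 (q + 1) g 1
    rw [hs', ht', hf', hg', hrr] at e
    linear_combination e
  have hfS : ∀ k, (transform (x : K) (p + 1) f).coeff k ∈ S := coeff_transform_mem_locSub h hz hf
  have hgS : ∀ k, (transform (x : K) (q + 1) g).coeff k ∈ S := coeff_transform_mem_locSub h hz hg
  obtain ⟨N, hN⟩ := exists_pow_le_contIdeal_transform h hz hxn hne hf hfp hd.f_prim
  have hsnS := hsol.s_mem.mono (maxPow_le _)
  have htnS := hsol.t_mem.mono (maxPow_le _)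
  -- The solution `(s', t')` multiplied by `Hn` and the solution `(sn, tn)` multiplied by `H`
  -- represent the same element, so they differ by a Koszul relation.
  obtain ⟨w, hw, hw1, hw2⟩ := exists_eq_mul_of_toMvPolynomial_mul_eq hreg hfS hgS
    (ne_zero_of_pow_le_contIdeal hreg hN)
    (exists_pow_le_contIdeal_transform h hz hxn hne hg hgq hd.g_prim)
    (s := Hn * s' - H * sn) (t := H * tn - Hn * t')
    ((hsol.h_mem.mul_subring hs'S).sub (hHS.mul_subring hsnS))
    ((hHS.mul_subring htnS).sub (hsol.h_mem.mul_subring ht'S))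
    (by linear_combination H * hsol.eq - Hn * e')
  have hHnV : ∃ i, V.valuation (Hn.coeff i) = 1 := by
    obtain ⟨i, hi⟩ := hsol.h_unit
    refine ⟨i, (hSV.valuation_eq_one_iff ⟨_, hsol.h_mem i⟩).2 fun hm => hi ?_⟩
    exact mem_maxPow.2 ⟨_, by rwa [pow_one], rfl⟩
  have hSV' : S.toAddSubgroup ≤ V.toSubring.toAddSubgroup := hSV.le
  have hVS := hV.mono hBS
  have fin : ∀ {g : K[X]} {s : MvPolynomial (Fin 2) K} {q : ℕ},
      (∀ i, ∃ l, V.valuation ((MvPolynomial.C ((x : K) ^ q)⁻¹ * s).coeff i * j') ≤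
        V.valuation ((transform (x : K) (q + 1) g).coeff l)) →
      ∀ i, ∃ l, V.valuation (s.coeff i * j) ≤ V.valuation (g.coeff l) := by
    intro g s q hq i
    obtain ⟨l, hl⟩ := hq i
    refine ⟨l, ?_⟩
    rw [← valuation_mul_le_mul_iff (pow_ne_zero (q + 1) hx0), pow_mul_coeff_transform hx0,
      MvPolynomial.coeff_C_mul] at hl
    convert! hl using 2
    rw [hjj', pow_succ]
    field_simp
  refine ⟨fin (exists_valuation_coeff_mul_le (hsol.h_mem.mono hSV') hHnV (hHS.mono hSV')
      (hw.mono hSV') (i := 1) (s' := sn) ?_ j'.2 (hsol.s_adj V hVn hVS hSV.le j' hjS)),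
    fin (exists_valuation_coeff_mul_le (hsol.h_mem.mono hSV') hHnV (hHS.mono hSV')
      (hw.neg.mono hSV') (i := 0) (s' := tn) ?_ j'.2 (hsol.t_adj V hVn hVS hSV.le j' hjS))⟩
  · linear_combination hw1
  · linear_combination -hw2

/-- When `f` has a unit coefficient, `h = α`, `s = r`, `t = 0` solves the problem. The order needed
for `s` is that given by `IsDatum.mem_maxPow`, and the truncated exponent `0 - 1` asks nothing of
`t`. -/
theorem exists_sol_of_order_zero (hd : IsDatum B f g r) (h : RegPair x y) 
    (hfp : ∃ k, f.coeff k ∉ maxPow B 1) (hg : ∀ k, g.coeff k ∈ maxPow B q) :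
    ∃ H s t, IsSol B f g r 0 q H s t := by
  refine ⟨f.toMvPolynomial 0, MvPolynomial.C r, 0, coeffIn_toMvPolynomial hd.f_mem, ?_, ?_,
    CoeffIn.zero, by rw [mul_zero, add_zero], ?_, ?_⟩
  · obtain ⟨k, hk⟩ := hfp
    exact ⟨Finsupp.single 0 k, by rwa [coeff_toMvPolynomial_single]⟩
  · have := hd.mem_maxPow h (p := 0) (fun k => mem_maxPow_zero (hd.f_mem k)) hg
    exact coeffIn_C (by rwa [zero_add] at this)
  · intro V hVn hV hBV j hj i
    classical
    rw [MvPolynomial.coeff_C]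
    split_ifs
    · obtain ⟨k, l, hkl⟩ := hd.adj V hVn hV hBV j hj
      refine ⟨l, hkl.trans ?_⟩
      rw [map_mul]
      exact mul_le_of_le_one_left' ((V.valuation_le_one_iff _).2 (hBV (hd.f_mem k)))
    · exact ⟨0, by simp⟩
  · intro V hVn hV hBV j hj i
    exact ⟨0, by simp⟩

theorem exists_sol_of_order_zero' (hd : IsDatum B f g r) (h : RegPair x y)
    (hf : ∀ k, f.coeff k ∈ maxPow B p) (hgq : ∃ k, g.coeff k ∉ maxPow B 1) :
    ∃ H s t, IsSol B f g r p 0 H s t := by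
  refine ⟨g.toMvPolynomial 1, 0, MvPolynomial.C r, coeffIn_toMvPolynomial hd.g_mem, ?_,
    CoeffIn.zero, ?_, by rw [mul_zero, zero_add], ?_, ?_⟩
  · obtain ⟨k, hk⟩ := hgq
    exact ⟨Finsupp.single 1 k, by rwa [coeff_toMvPolynomial_single]⟩
  · have := hd.mem_maxPow h (q := 0) hf (fun k => mem_maxPow_zero (hd.g_mem k))
    exact coeffIn_C (by rwa [add_zero] at this)
  · intro V hVn hV hBV j hj i
    exact ⟨0, by simp⟩
  · intro V hVn hV hBV j hj i
    classical
    rw [MvPolynomial.coeff_C]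
    split_ifs
    · obtain ⟨k, l, hkl⟩ := hd.adj V hVn hV hBV j hj
      refine ⟨k, hkl.trans ?_⟩
      rw [map_mul]
      exact mul_le_of_le_one_right' ((V.valuation_le_one_iff _).2 (hBV (hd.g_mem l)))
    · exact ⟨0, by simp⟩

omit [IsLocalRing B] x y [IsNoetherianRing B] [IsFractionRing B K] z f g r p q B in
-- Induction on a bound `N` for the length of `B` modulo the coefficient ideal of `f`. When both
-- orders are positive, each infinitely near point has a smaller bound, and its solutions are
-- patched on the two charts and glued.
theorem exists_sol_of_chainLE (N : ℕ) : ∀ (B : Subring K) [IsLocalRing B] [IsNoetherianRing B]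
    [IsFractionRing B K] (x y : B) (_ : RegPair x y) (f g : K[X]) (r : K) (p q : ℕ)
    (_ : IsDatum B f g r) (_ : ChainLE N (contIdeal B f))
    (_ : ∀ k, f.coeff k ∈ maxPow B p) (_ : ∃ k, f.coeff k ∉ maxPow B (p + 1))
    (_ : ∀ k, g.coeff k ∈ maxPow B q) (_ : ∃ k, g.coeff k ∉ maxPow B (q + 1)),
    ∃ H s t, IsSol B f g r p q H s t := by
  induction N with
  | zero =>
    intro B _ _ _ x y h f g r p q hd hl hf hfp hg hgq
    obtain rfl : p = 0 := by
      by_contra hp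
      have h1 : contIdeal B f ≤ maximalIdeal B := by
        refine Ideal.span_le.2 ?_
        rintro b ⟨k, hk⟩
        obtain ⟨c, hc, e⟩ := mem_maxPow.1 (hf k)
        rw [show b = c from Subtype.ext (hk.trans e.symm)]
        exact Ideal.pow_le_self hp hc
      exact Ideal.IsPrime.ne_top (I := maximalIdeal B) inferInstance (top_le_iff.1 (hl.ge.trans h1))
    exact exists_sol_of_order_zero hd h hfp hg
  | succ N ih =>
    intro B _ _ _ x y h f g r p q hd hl hf hfp hg hgq
    rcases p with _ | p
    · exact exists_sol_of_order_zero hd h hfp hg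
    rcases q with _ | q
    · exact exists_sol_of_order_zero' hd h hf hgq
    have hnode : ∀ (x y : B) (z : K), RegPair x y → (x : K) * z = y →
        ∀ (n : Ideal (chart B z)) [n.IsPrime], toChart z x ∈ n →
        n ≠ Ideal.span {toChart z x} → ∃ a b H s t, IsSol (locSub (chart B z) n)
          (transform (x : K) (p + 1) f) (transform (x : K) (q + 1) g)
          (((x : K) ^ (p + q + 1))⁻¹ * r) a b H s t := by
      intro x y z h hz n _ hxn hne
      obtain ⟨y', hreg⟩ := exists_regPair_locSub h hz n hxn hne
      have hd' := hd.transform h hz hxn hne hf hfp hg hgq (m := p + q + 1) (by omega)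
      have hl' := chainLE_transform h hz hxn hne (Nat.succ_ne_zero p) hf hfp hd.f_prim hl
      obtain ⟨M, hM⟩ := hd'.f_prim
      obtain ⟨M', hM'⟩ := hd'.g_prim
      obtain ⟨a, ha, ha'⟩ := exists_order hd'.f_mem (ne_zero_of_pow_le_contIdeal hreg hM)
      obtain ⟨b, hb, hb'⟩ := exists_order hd'.g_mem (ne_zero_of_pow_le_contIdeal hreg hM')
      obtain ⟨H, s, t, hsol⟩ := ih _ _ _ hreg _ _ _ a b hd' hl' ha ha' hb hb'
      exact ⟨a, b, H, s, t, hsol⟩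
    have hx0 : (x : K) ≠ 0 := fun e => h.prime.ne_zero (Subtype.ext e)
    have hy0 : (y : K) ≠ 0 := fun e => h.symm.prime.ne_zero (Subtype.ext e)
    have hz : (x : K) * (y / x) = y := mul_div_cancel₀ _ hx0
    have hz' : (y : K) * (y / x : K)⁻¹ = x := by rw [inv_div]; exact mul_div_cancel₀ _ hy0
    obtain ⟨H₁, s₁, t₁, hH₁, hu₁, hs₁, ht₁, e₁⟩ := exists_chart_solution hd h hz hf hfp hg hgq
      (fun n _ hxn hne => hnode x y _ h hz n hxn hne)
    obtain ⟨H₂, s₂, t₂, hH₂, hu₂, hs₂, ht₂, e₂⟩ := exists_chart_solution hd h.symm hz' hf hfp hg hgq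
      (fun n _ hxn hne => hnode y x _ h.symm hz' n hxn hne)
    obtain ⟨M, hM⟩ := hd.f_prim
    have hBc : ∀ {z : K} {P Q : MvPolynomial (Fin 2) K}, CoeffIn B.toAddSubgroup P →
        CoeffIn (chart B z).toAddSubgroup Q → CoeffIn (chart B z).toAddSubgroup (P * Q) :=
      fun hP hQ => hP.mul (fun a ha b hb => Subring.mul_mem _ (le_chart ha) hb) hQ
    -- Each chart solution is multiplied by the `H` of the other one, so that both solve for `H₁ *
    -- H₂ * r`. The product still has a unit coefficient because polynomials over the residue field
    -- form a domain.
    obtain ⟨s, t, hs, ht, e⟩ := exists_glue h hz hf hg hgq (ne_zero_of_pow_le_contIdeal h hM)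
      hd.g_prim (hBc hH₂ hs₁) (hBc hH₂ ht₁) (hBc hH₁ hs₂) (hBc hH₁ ht₂)
      (R := H₁ * H₂ * MvPolynomial.C r) (by linear_combination H₂ * e₁)
      (by linear_combination H₁ * e₂)
    have hadj := isAdj_of_eq hd h hf hfp hg hgq hnode (hH₁.mul_subring hH₂) hs ht e
    refine ⟨H₁ * H₂, s, t, hH₁.mul_subring hH₂, ?_, hs, ht, e, hadj.1, hadj.2⟩
    obtain ⟨P₁, rfl⟩ := coeffIn_subring_iff.1 hH₁
    obtain ⟨P₂, rfl⟩ := coeffIn_subring_iff.1 hH₂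
    have hunit : ∀ P : MvPolynomial (Fin 2) B,
        (∃ i, (P.map B.subtype).coeff i ∉ maxPow B 1) ↔ P.map (residue B) ≠ 0 := by
      intro P
      rw [MvPolynomial.ne_zero_iff]
      refine exists_congr fun i => not_congr ?_
      rw [MvPolynomial.coeff_map, MvPolynomial.coeff_map, residue_eq_zero_iff, mem_maxPow, pow_one]
      exact ⟨fun ⟨b, hb, e⟩ => (show b = P.coeff i from Subtype.ext e) ▸ hb, fun h => ⟨_, h, rfl⟩⟩
    rw [← map_mul, hunit, map_mul]
    exact mul_ne_zero ((hunit _).1 hu₁) ((hunit _).1 hu₂)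

end AdjointIdeals

end

/-! ### The shape of the local rings, and adjoints computed inside the fraction field. -/

section

open IsLocalRing Polynomial

namespace AdjointIdeals

/-- If the maximal ideal needs two generators `x`, `y`, then `x` divides no power of `y`: otherwise
the maximal ideal would be minimal over `(x)` and of height at most one, while regularity makes its
height two. -/
theorem isPrincipal_or_exists_regPair {A : Type*} [CommRing A] [IsRegularLocalRing A]
    (hdim : ringKrullDim A ≤ 2) : (maximalIdeal A).IsPrincipal ∨ ∃ x y : A, RegPair x y := by
  by_cases hprin : (maximalIdeal A).IsPrincipal
  · exact Or.inl hprin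
  right
  have hfg : (maximalIdeal A).FG := IsNoetherian.noetherian _
  have hspan := Submodule.span_generators (maximalIdeal A)
  have hcard := (Submodule.FG.generators_ncard hfg)
  have hreg := IsRegularLocalRing.spanFinrank_maximalIdeal (R := A)
  have hle : (maximalIdeal A).spanFinrank ≤ 2 := by
    rw [← hreg] at hdim; exact_mod_cast hdim
  have hnt : ∀ x : A, maximalIdeal A ≠ Ideal.span {x} := fun x e => hprin ⟨x, e⟩
  have h2 : (maximalIdeal A).spanFinrank = 2 := by
    by_contra hne
    have h1 : (maximalIdeal A).generators.ncard ≤ 1 := by omega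
    rcases (Set.ncard_le_one_iff_eq (Submodule.FG.finite_generators hfg)).1 h1 with h0 | ⟨x, hx⟩
    · refine hnt 0 ?_
      rw [← hspan, h0]
      simp
    · exact hnt x (by rw [← hx]; exact hspan.symm)
  obtain ⟨x, y, -, hxy⟩ := Set.ncard_eq_two.1 (hcard.trans h2)
  have hmax : maximalIdeal A = Ideal.span {x, y} := by rw [← hxy]; exact hspan.symm
  have hxy' : ∀ N, ¬ x ∣ y ^ N := by
    intro N hN
    have hmin : maximalIdeal A ∈ (Ideal.span {x}).minimalPrimes := by
      refine ⟨⟨inferInstance, ?_⟩, fun P hP _ => ?_⟩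
      · rw [hmax]; exact Ideal.span_mono (by simp)
      · have hx : x ∈ P := hP.2 (Ideal.mem_span_singleton_self x)
        have hy : y ∈ P := hP.1.mem_of_pow_mem N (P.mem_of_dvd hN hx)
        rw [hmax, Ideal.span_le]
        rintro _ (rfl | rfl)
        exacts [hx, hy]
    have h3 := Ideal.height_le_one_of_isPrincipal_of_mem_minimalPrimes (Ideal.span {x}) _ hmin
    have h4 := maximalIdeal_height_eq_ringKrullDim (R := A)
    rw [← hreg, h2] at h4
    have h5 : (maximalIdeal A).height = 2 := WithBot.coe_injective (h4.trans rfl)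
    rw [h5] at h3
    exact absurd h3 (by decide)
  have hx0 : x ≠ 0 := by
    rintro rfl
    refine hnt y ?_
    rw [hmax, Ideal.span_insert_zero]
  exact ⟨x, y, hmax, prime_of_not_dvd_pow hmax hx0 hxy', by simpa using hxy' 1⟩

variable {K : Type*} [Field K]

section AdjSub

/-- The adjoint ideal, computed with valuation subrings of the field of fractions. -/
def adjSub (A : Subring K) (I : Ideal A) : Ideal A where
  carrier := {c | ∀ V : ValuationSubring K, IsNoetherianRing V → EssFin A V → A ≤ V.toSubring →
    ∀ j ∈ relJac V A, ∃ a ∈ I, V.valuation ((c : K) * j) ≤ V.valuation a}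
  zero_mem' := fun V _ _ _ j _ => ⟨0, zero_mem _, by simp⟩
  add_mem' := by
    intro c d hc hd V h1 h2 h3 j hj
    obtain ⟨a, ha, hca⟩ := hc V h1 h2 h3 j hj
    obtain ⟨b, hb, hdb⟩ := hd V h1 h2 h3 j hj
    have hadd : V.valuation (((c + d : A) : K) * j) ≤ max (V.valuation a) (V.valuation b) := by
      rw [Subring.coe_add, add_mul]
      exact (V.valuation.map_add _ _).trans (max_le_max hca hdb)
    rcases le_max_iff.1 hadd with h | h
    exacts [⟨a, ha, h⟩, ⟨b, hb, h⟩]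
  smul_mem' := by
    intro c d hd V h1 h2 h3 j hj
    obtain ⟨b, hb, hdb⟩ := hd V h1 h2 h3 j hj
    refine ⟨c * b, Ideal.mul_mem_left _ _ hb, ?_⟩
    rw [smul_eq_mul, Subring.coe_mul, Subring.coe_mul, mul_assoc, map_mul, map_mul _ (c : K) (b : K)]
    gcongr

variable {A : Subring K} {I J : Ideal A}

theorem le_adjSub : I ≤ adjSub A I := by
  intro a ha V _ _ _ j _
  refine ⟨a, ha, ?_⟩
  rw [map_mul]
  exact mul_le_of_le_one_right' ((V.valuation_le_one_iff _).2 j.2)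

theorem relJac_locSub_eq {n : Ideal A} [n.IsPrime] {V : ValuationSubring K}
    (h : locSub A n ≤ V.toSubring) : relJac V (locSub A n) = relJac V A := by
  have hA : A ≤ V.toSubring := (le_locSub _ n).trans h
  rw [relJac, relJac, relJac_locSub hA (center_le_of_locSub_le hA h)]

/-- Passage from the local adjoint conditions at `n` to the global ones, at the cost of a factor
outside `n`. Valuations centered on `n` are covered by `hV`. For any other, some `a` in `n` has
value one, and one common factor `E` outside `n` carries `n ^ N * c₁`, where `c₁` is the numerator
of `c`, into `J`. -/
theorem exists_mul_mem_adjSub [IsNoetherianRing A] {n : Ideal A} [hn : n.IsMaximal] {c : K}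
    (hc : c ∈ locSub A n)
    (hN : ∃ N, ∀ a ∈ n ^ N, ∃ b ∈ J.map (algebraMap A (locSub A n)), (a : K) * c = b)
    (hV : ∀ V : ValuationSubring K, IsNoetherianRing V → EssFin (locSub A n) V →
      locSub A n ≤ V.toSubring → ∀ j ∈ relJac V (locSub A n),
      ∃ b ∈ J, V.valuation (c * j) ≤ V.valuation b) :
    ∃ e ∉ n, ∃ d ∈ adjSub A J, (e : K) * c = d := by
  classical
  obtain ⟨c₁, s, hs, rfl⟩ := hc
  have hs0 := ne_zero_of_notMem hs
  obtain ⟨N, hN⟩ := hN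
  have hloc : ∀ a ∈ n ^ N, ∃ e ∉ n, e * (a * c₁) ∈ J := by
    intro a ha
    obtain ⟨b, hb, e⟩ := hN a ha
    obtain ⟨⟨⟨b', hb'⟩, ⟨t, ht⟩⟩, e'⟩ :=
      (IsLocalization.mem_map_algebraMap_iff n.primeCompl (locSub A n)).1 hb
    refine ⟨t, ht, ?_⟩
    have e1 : (b : K) * t = b' := congrArg Subtype.val e'
    have : t * (a * c₁) = s * b' := Subtype.ext (by
      push_cast
      rw [← e1, ← e]
      field_simp)
    rw [this]
    exact J.mul_mem_left _ hb'
  obtain ⟨T, hT⟩ : (n ^ N).FG := IsNoetherian.noetherian _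
  choose! e he heJ using hloc
  have hTn : ∀ t ∈ T, t ∈ n ^ N := fun t ht => hT ▸ Submodule.subset_span ht
  have hprod : ∏ t ∈ T, e t ∉ n := by
    intro hmem
    obtain ⟨t, ht, h1⟩ := (hn.isPrime.prod_mem_iff).1 hmem
    exact he t (hTn t ht) h1
  have hall : ∀ a ∈ n ^ N, (∏ t ∈ T, e t) * (a * c₁) ∈ J := by
    intro a ha
    rw [← hT] at ha
    induction ha using Submodule.span_induction with
    | mem t ht =>
      rw [← Finset.mul_prod_erase _ _ (Finset.mem_coe.1 ht), mul_right_comm]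
      exact J.mul_mem_right _ (heJ t (hTn t ht))
    | zero => simp
    | add a b _ _ ha hb =>
      rw [add_mul, mul_add]; exact add_mem ha hb
    | smul k a _ ha =>
      rw [smul_eq_mul, mul_assoc k, mul_left_comm]; exact J.mul_mem_left _ ha
  set E := ∏ t ∈ T, e t
  refine ⟨E * s, fun h => (hn.isPrime.mem_or_mem h).elim hprod hs, E * c₁, ?_, ?_⟩
  swap
  · push_cast; field_simp
  intro V h1 h2 h3 j hj
  by_cases hcen : n ≤ center V h3
  · have hcn : center V h3 = n :=
      (hn.eq_of_le (Ideal.IsPrime.ne_top inferInstance) hcen).symm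
    have hBV : locSub A n ≤ V.toSubring := locSub_le h3 hcn.le
    obtain ⟨b, hb, hcb⟩ := hV V h1 (h2.mono (le_locSub _ _)) hBV j
      (by rw [relJac_locSub_eq hBV]; exact hj)
    refine ⟨b, hb, le_trans ?_ hcb⟩
    have hvs : V.valuation s = 1 := notMem_center.1 (by rw [hcn]; exact hs)
    rw [Subring.coe_mul, map_mul, map_mul, map_mul, map_div₀, hvs, div_one]
    gcongr
    exact mul_le_of_le_one_left' ((V.valuation_le_one_iff _).2 (h3 E.2))
  · obtain ⟨a, ha, hav⟩ := SetLike.not_le_iff_exists.1 hcen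
    rw [notMem_center] at hav
    refine ⟨_, hall (a ^ N) (Ideal.pow_mem_pow ha N), ?_⟩
    push_cast
    rw [map_mul, map_mul, map_mul, map_mul, map_pow, hav, one_pow, one_mul]
    exact mul_le_of_le_one_right' ((V.valuation_le_one_iff _).2 j.2)

end AdjSub

section Principal

variable {T : Subring K} [IsLocalRing T] [IsNoetherianRing T] [IsFractionRing T K]

/-- A Noetherian local subring with principal maximal ideal, as a valuation subring. -/
def valOfPrincipal (T : Subring K) [IsLocalRing T] [IsNoetherianRing T] [IsFractionRing T K]
    (h : (maximalIdeal T).IsPrincipal) : ValuationSubring K :=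
  ValuationSubring.ofSubring T (mem_or_inv_mem_of_isPrincipal h)

theorem toSubring_valOfPrincipal (h : (maximalIdeal T).IsPrincipal) :
    (valOfPrincipal T h).toSubring = T := rfl

theorem isNoetherianRing_valOfPrincipal (h : (maximalIdeal T).IsPrincipal) :
    IsNoetherianRing (valOfPrincipal T h) := inferInstanceAs (IsNoetherianRing T)

theorem one_mem_relJac_valOfPrincipal (h : (maximalIdeal T).IsPrincipal) :
    1 ∈ relJac (valOfPrincipal T h) T := by
  have := relJac_self (V := valOfPrincipal T h)
  rw [toSubring_valOfPrincipal] at this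
  rw [this]; exact Submodule.mem_top

end Principal

section Local

variable {A : Subring K} [IsNoetherianRing A] [IsFractionRing A K] {I J : Ideal A} {n : Ideal A}
  [hn : n.IsMaximal]

/-- The localization is itself an admissible valuation ring, with unit Jacobian, so the adjoint
condition there says that `r` lies in `IJ` locally. -/
theorem exists_mul_mem_of_isPrincipal (hprin : (maximalIdeal (locSub A n)).IsPrincipal) {r : A}
    (hr : r ∈ adjSub A (I * J)) : ∃ e ∉ n, e * r ∈ adjSub A I * adjSub A J := by
  have hle : locSub A n ≤ (valOfPrincipal _ hprin).toSubring := le_rfl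
  obtain ⟨a, ha, hra⟩ := hr (valOfPrincipal _ hprin) (isNoetherianRing_valOfPrincipal hprin)
    (EssFin.of_locSub hle (essFin_self le_rfl)) (le_locSub A n) 1
    (by rw [← relJac_locSub_eq hle]; exact one_mem_relJac_valOfPrincipal hprin)
  rw [show ((1 : valOfPrincipal _ hprin) : K) = 1 from rfl, mul_one] at hra
  obtain ⟨b, hb, e⟩ : ∃ b ∈ locSub A n, (r : K) = a * b := by
    by_cases ha0 : (a : K) = 0
    · rw [ha0, map_zero] at hra
      have := (Valuation.zero_iff _).1 (le_antisymm hra zero_le)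
      exact ⟨0, zero_mem _, by rw [this, mul_zero]⟩
    · refine ⟨(a : K)⁻¹ * r, ?_, by rw [mul_inv_cancel_left₀ ha0]⟩
      refine (ValuationSubring.valuation_le_one_iff (valOfPrincipal _ hprin) _).1 ?_
      rw [← map_one (valOfPrincipal _ hprin).valuation, ← valuation_mul_le_mul_iff ha0,
        mul_inv_cancel_left₀ ha0, mul_one]
      exact hra
  obtain ⟨g, s, hs, rfl⟩ := hb
  refine ⟨s, hs, ?_⟩
  have hs0 := ne_zero_of_notMem hs
  have : s * r = g * a := Subtype.ext (by push_cast; rw [e]; field_simp)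
  rw [this]
  exact Ideal.mul_mem_left _ _ (Ideal.mul_mono le_adjSub le_adjSub ha)

end Local

end AdjointIdeals

end

/-! ### The inclusion at a two-dimensional local ring. -/

section

open IsLocalRing Polynomial

namespace AdjointIdeals

variable {K : Type*} [Field K]

theorem exists_polynomial_span_coeff {A : Type*} [CommRing A] {I : Ideal A} (hI : I.FG) :
    ∃ f : A[X], (∀ k, f.coeff k ∈ I) ∧ I ≤ Ideal.span (Set.range f.coeff) := by
  classical
  obtain ⟨m, s, hs⟩ := Submodule.fg_iff_exists_fin_generating_family.1 hI
  refine ⟨ofFn m s, fun k => ?_, ?_⟩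
  · by_cases hk : k < m
    · rw [ofFn_coeff_eq_val_of_lt s hk, ← hs]
      exact Submodule.subset_span ⟨_, rfl⟩
    · rw [ofFn_coeff_eq_zero_of_ge s (not_lt.1 hk)]; exact zero_mem _
  · rw [← hs]
    refine Submodule.span_le.2 ?_
    rintro _ ⟨i, rfl⟩
    exact Ideal.subset_span ⟨i, ofFn_coeff_eq_val_of_lt s i.2⟩

theorem exists_eq_C_mul_of_ne_zero {B : Type*} [CommRing B] [IsDomain B]
    [UniqueFactorizationMonoid B] {f : B[X]} (hf : f ≠ 0) :
    ∃ u f₁, u ≠ 0 ∧ f = C u * f₁ ∧ ∀ c, (∀ k, c ∣ f₁.coeff k) → IsUnit c := by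
  classical
  let := UniqueFactorizationMonoid.strongNormalizationMonoid (α := B)
  let : NormalizedGCDMonoid B := UniqueFactorizationMonoid.toNormalizedGCDMonoid B
  refine ⟨f.content, f.primPart, fun e => hf (content_eq_zero_iff.1 e),
    f.eq_C_content_mul_primPart, fun c hc => f.isPrimitive_primPart c ?_⟩
  rwa [C_dvd_iff_dvd_coeff]

/-- The prime factors of `c` are removed one at a time, each tested away from itself by its own `s`.
The prime `π₀` settles the case `c = 0`. -/
theorem dvd_of_forall_prime {B : Type*} [CommRing B] [IsDomain B]
    [UniqueFactorizationMonoid B] {π₀ : B} (hπ₀ : Prime π₀) {c r : B}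
    (h : ∀ π : B, Prime π → ∃ s, ¬ π ∣ s ∧ c ∣ r * s) : c ∣ r := by
  induction c using UniqueFactorizationMonoid.induction_on_prime with
  | h₁ =>
    obtain ⟨s, hs, hd⟩ := h π₀ hπ₀
    have hs0 : s ≠ 0 := by rintro rfl; exact hs (dvd_zero _)
    exact zero_dvd_iff.2 ((mul_eq_zero.1 (zero_dvd_iff.1 hd)).resolve_right hs0)
  | h₂ u hu => exact hu.dvd
  | h₃ c π hc hπ ih =>
    obtain ⟨r', rfl⟩ := ih fun π' hπ' => by
      obtain ⟨s, hs, hd⟩ := h π' hπ'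
      exact ⟨s, hs, (dvd_mul_left c π).trans hd⟩
    obtain ⟨s, hs, hd⟩ := h π hπ
    rw [mul_comm π, mul_assoc c r' s] at hd
    rw [mul_comm π]
    exact mul_dvd_mul_left c ((hπ.dvd_or_dvd ((mul_dvd_mul_iff_left hc).1 hd)).resolve_right hs)

theorem valuation_le_of_mem_span {A : Subring K} {V : ValuationSubring K} (hA : A ≤ V.toSubring)
    {f : A[X]} {I : Ideal A} (hI : I ≤ Ideal.span (Set.range f.coeff)) :
    ∃ k, ∀ a ∈ I, V.valuation (a : K) ≤ V.valuation (f.coeff k : K) := by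
  obtain ⟨k, hk⟩ := exists_coeff_max V (f.map A.subtype)
  simp only [coeff_map, Subring.subtype_apply] at hk
  refine ⟨k, fun a ha => ?_⟩
  replace ha := hI ha
  induction ha using Submodule.span_induction with
  | mem a ha => obtain ⟨l, rfl⟩ := ha; exact hk l
  | zero => simp
  | add a b _ _ ha hb => rw [Subring.coe_add]; exact V.valuation.map_add_le ha hb
  | smul c a _ ha =>
    rw [smul_eq_mul, Subring.coe_mul, map_mul]
    exact (mul_le_of_le_one_left' ((V.valuation_le_one_iff _).2 (hA c.2))).trans ha

section Local

variable {A : Subring K} [IsNoetherianRing A] [IsFractionRing A K] {I J : Ideal A} {n : Ideal A}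
  [hn : n.IsMaximal]

/-- Polynomials with coefficients generating `I` and `J` are split into contents `u`, `w` and
primitive parts. The product `u * w` divides `r`, because the localization at each principal prime
is an admissible valuation ring with unit Jacobian. The primitive parts and the quotient `r₁` then
form a datum for the local theorem, whose solution is multiplied back by `u * w` and cleared of
denominators outside `n`. -/
theorem exists_mul_mem_of_regPair {x y : locSub A n} (h : RegPair x y) (hI : I ≠ ⊥) (hJ : J ≠ ⊥)
    {r : A} (hr : r ∈ adjSub A (I * J)) : ∃ e ∉ n, e * r ∈ adjSub A I * adjSub A J := by
  have hAB : A ≤ (locSub A n) := le_locSub A n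
  have hUFD := h.uniqueFactorizationMonoid
  obtain ⟨f, hfI, hIf⟩ := exists_polynomial_span_coeff (IsNoetherian.noetherian I)
  obtain ⟨g, hgJ, hJg⟩ := exists_polynomial_span_coeff (IsNoetherian.noetherian J)
  have hne : ∀ {f : A[X]} {I : Ideal A}, I ≠ ⊥ → I ≤ Ideal.span (Set.range f.coeff) →
      f.map (algebraMap A (locSub A n)) ≠ 0 := by
    intro f I hI hIf e
    rw [Polynomial.map_eq_zero_iff (algebraMap_locSub_injective A n)] at e
    refine hI (le_bot_iff.1 (hIf.trans (Ideal.span_le.2 ?_)))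
    rintro _ ⟨k, rfl⟩
    simp [e]
  obtain ⟨u, f₁, hu, hf₁, hfp⟩ := exists_eq_C_mul_of_ne_zero (hne hI hIf)
  obtain ⟨w, g₁, hw, hg₁, hgp⟩ := exists_eq_C_mul_of_ne_zero (hne hJ hJg)
  have hcoef : ∀ {f : A[X]} {f₁ : (locSub A n)[X]} {u : locSub A n}, f.map (algebraMap A (locSub A n)) = C u * f₁ →
      ∀ k, (f.coeff k : K) = u * f₁.coeff k := by
    intro f f₁ u e k
    have := congrArg (fun P => (P.coeff k : K)) e
    simpa only [coeff_map, coeff_C_mul, coe_algebraMap_locSub, Subring.coe_mul] using this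
  have hprim : ∀ {f₁ : (locSub A n)[X]}, (∀ c, (∀ k, c ∣ f₁.coeff k) → IsUnit c) →
      ∃ N, maximalIdeal (locSub A n) ^ N ≤ contIdeal (locSub A n) (f₁.map (locSub A n).subtype) := by
    intro f₁ hf
    refine h.exists_pow_le_of_forall_le_span fun c hc => hf c fun k => ?_
    exact Ideal.mem_span_singleton.1 (hc (Ideal.subset_span ⟨k, by rw [coeff_map]; rfl⟩))
  have hval : ∀ V : ValuationSubring K, IsNoetherianRing V → EssFin (locSub A n) V → (locSub A n) ≤ V.toSubring →
      ∀ j ∈ relJac V (locSub A n), ∃ k l, V.valuation ((r : K) * j) ≤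
        V.valuation ((f.coeff k : K) * g.coeff l) := by
    intro V h1 h2 h3 j hj
    have hA : A ≤ V.toSubring := hAB.trans h3
    obtain ⟨c, hc, hrc⟩ := hr V h1 (h2.of_locSub h3) hA j (by rw [← relJac_locSub_eq h3]; exact hj)
    obtain ⟨k, hk⟩ := valuation_le_of_mem_span hA hIf
    obtain ⟨l, hl⟩ := valuation_le_of_mem_span hA hJg
    refine ⟨k, l, hrc.trans ?_⟩
    clear hrc
    induction hc using Submodule.mul_induction_on' with
    | mem_mul_mem a ha b hb =>
      rw [Subring.coe_mul, map_mul, map_mul]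
      exact mul_le_mul' (hk a ha) (hl b hb)
    | add a _ b _ ha hb =>
      rw [Subring.coe_add]
      exact V.valuation.map_add_le ha hb
  -- the common factor of the coefficients divides `r`
  have hdvd : u * w ∣ algebraMap A (locSub A n) r := by
    refine dvd_of_forall_prime h.prime fun π hπ => ?_
    have hπp : (Ideal.span {π}).IsPrime := (Ideal.span_singleton_prime hπ.ne_zero).2 hπ
    have hprin : (maximalIdeal (locSub (locSub A n) (Ideal.span {π}))).IsPrincipal := by
      rw [maximalIdeal_locSub, Ideal.map_span, Set.image_singleton]
      exact ⟨⟨_, rfl⟩⟩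
    have hle : locSub (locSub A n) (Ideal.span {π}) ≤ (valOfPrincipal _ hprin).toSubring := le_rfl
    have hBV : (locSub A n) ≤ (valOfPrincipal _ hprin).toSubring := le_locSub (locSub A n) _
    obtain ⟨k, l, hkl⟩ := hval (valOfPrincipal _ hprin) (isNoetherianRing_valOfPrincipal hprin)
      (EssFin.of_locSub hle (essFin_self le_rfl)) hBV 1
      (by rw [← relJac_locSub_eq hle]; exact one_mem_relJac_valOfPrincipal hprin)
    have huw : (u : K) * w ≠ 0 := by
      rw [← Subring.coe_mul]
      exact fun e => mul_ne_zero hu hw (Subtype.ext e)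
    rw [show ((1 : valOfPrincipal _ hprin) : K) = 1 from rfl, mul_one, hcoef hf₁ k, hcoef hg₁ l,
      mul_mul_mul_comm, ← mul_inv_cancel_left₀ huw (r : K), valuation_mul_le_mul_iff huw] at hkl
    have h1 : ((u : K) * w)⁻¹ * r ∈ valOfPrincipal _ hprin :=
      (ValuationSubring.valuation_le_one_iff _ _).1 (hkl.trans
        ((ValuationSubring.valuation_le_one_iff _ _).2
          (mul_mem (hBV (f₁.coeff k).2) (hBV (g₁.coeff l).2))))
    obtain ⟨a, s, hs, e⟩ : _ ∈ locSub (locSub A n) (Ideal.span {π}) := h1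
    refine ⟨s, fun hd => hs (Ideal.mem_span_singleton.2 hd), a, Subtype.ext ?_⟩
    have hs0 := ne_zero_of_notMem hs
    push_cast
    rw [coe_algebraMap_locSub, (inv_mul_eq_iff_eq_mul₀ huw).1 e]
    field_simp
  obtain ⟨r₁, hr₁⟩ := hdvd
  have hr₁' : (r : K) = u * w * r₁ := congrArg Subtype.val hr₁
  have huw : (u : K) * w ≠ 0 := by
    rw [← Subring.coe_mul]
    exact fun e => mul_ne_zero hu hw (Subtype.ext e)
  set F := f₁.map (locSub A n).subtype with hF
  set G := g₁.map (locSub A n).subtype with hG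
  have hFc : ∀ k, F.coeff k = f₁.coeff k := fun k => by rw [hF, coeff_map]; rfl
  have hGc : ∀ k, G.coeff k = g₁.coeff k := fun k => by rw [hG, coeff_map]; rfl
  have hd : IsDatum (locSub A n) F G r₁ := by
    refine ⟨fun k => hFc k ▸ (f₁.coeff k).2, fun k => hGc k ▸ (g₁.coeff k).2, hprim hfp, hprim hgp,
      r₁.2, fun V h1 h2 h3 j hj => ?_⟩
    obtain ⟨k, l, hkl⟩ := hval V h1 h2 h3 j hj
    refine ⟨k, l, ?_⟩
    rwa [hr₁', hcoef hf₁ k, hcoef hg₁ l, mul_mul_mul_comm, mul_assoc (u * w : K),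
      valuation_mul_le_mul_iff huw, ← hFc, ← hGc] at hkl
  obtain ⟨NF, hNF⟩ := hd.f_prim
  obtain ⟨NG, hNG⟩ := hd.g_prim
  obtain ⟨p, hp, hp'⟩ := exists_order hd.f_mem (ne_zero_of_pow_le_contIdeal h hNF)
  obtain ⟨q, hq, hq'⟩ := exists_order hd.g_mem (ne_zero_of_pow_le_contIdeal h hNG)
  obtain ⟨N, hN⟩ := exists_chainLE hNF
  obtain ⟨H, s, t, hsol⟩ := exists_sol_of_chainLE N (locSub A n) x y h F G r₁ p q hd hN hp hp' hq hq'
  -- descent of the coefficients of `s` and `t`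
  have hdesc : ∀ {g : A[X]} {J : Ideal A} {g₁ : (locSub A n)[X]} {w : locSub A n} {G : K[X]} {s : MvPolynomial (Fin 2) K},
      (∀ k, g.coeff k ∈ J) → (∀ k, (g.coeff k : K) = w * g₁.coeff k) →
      (∀ k, G.coeff k = g₁.coeff k) → (∃ N, maximalIdeal (locSub A n) ^ N ≤ contIdeal (locSub A n) G) →
      CoeffIn (locSub A n).toAddSubgroup s → IsAdj (locSub A n) G s →
      ∀ i, ∃ e ∉ n, ∃ d ∈ adjSub A J, (e : K) * (w * s.coeff i) = d := by
    intro g J g₁ w G s hgJ hg hG hN hs hadj i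
    have hJB : ∀ b ∈ contIdeal (locSub A n) G, w * b ∈ J.map (algebraMap A (locSub A n)) := by
      intro b hb
      induction hb using Submodule.span_induction with
      | mem b hb =>
        obtain ⟨k, hk⟩ := hb
        rw [show w * b = algebraMap A (locSub A n) (g.coeff k) from Subtype.ext (by
          rw [coe_algebraMap_locSub, hg, ← hG, ← hk]; rfl)]
        exact Ideal.mem_map_of_mem _ (hgJ k)
      | zero => simp
      | add a b _ _ ha hb => rw [mul_add]; exact add_mem ha hb
      | smul c a _ ha => rw [smul_eq_mul, mul_left_comm]; exact Ideal.mul_mem_left _ _ ha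
    obtain ⟨N, hN⟩ := hN
    refine exists_mul_mem_adjSub ((locSub A n).mul_mem w.2 (hs i)) ⟨N, fun a ha => ?_⟩ fun V h1 h2 h3 j hj => ?_
    · refine ⟨_, Ideal.mul_mem_right ⟨_, hs i⟩ _ (hJB (algebraMap A (locSub A n) a) (hN ?_)), ?_⟩
      · rw [maximalIdeal_locSub, ← Ideal.map_pow]
        exact Ideal.mem_map_of_mem _ ha
      · push_cast
        rw [coe_algebraMap_locSub]
        ring
    · obtain ⟨l, hl⟩ := hadj V h1 h2 h3 j hj i
      refine ⟨g.coeff l, hgJ l, ?_⟩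
      rw [hg, ← hG, mul_assoc, map_mul, map_mul _ (w : K) (G.coeff l)]
      gcongr
  have hds := hdesc hgJ (hcoef hg₁) hGc hd.g_prim (hsol.s_mem.mono (maxPow_le _)) hsol.s_adj
  have hdt := hdesc hfI (hcoef hf₁) hFc hd.f_prim (hsol.t_mem.mono (maxPow_le _)) hsol.t_adj
  choose es hes ds hds hs using hds
  choose et het dt hdt ht using hdt
  -- the products, up to denominators prime to `n`
  set 𝔠 := adjSub A I * adjSub A J
  let Cn : AddSubgroup K :=
    { carrier := {c | ∃ e ∉ n, ∃ d ∈ 𝔠, (e : K) * c = d}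
      zero_mem' := ⟨1, (Ideal.ne_top_iff_one _).1 hn.ne_top, 0, zero_mem _, by simp⟩
      add_mem' := by
        rintro a b ⟨e, he, d, hd, h1⟩ ⟨e', he', d', hd', h2⟩
        refine ⟨e * e', fun h => (hn.isPrime.mem_or_mem h).elim he he', e' * d + e * d',
          add_mem (Ideal.mul_mem_left _ _ hd) (Ideal.mul_mem_left _ _ hd'), ?_⟩
        push_cast
        rw [← h1, ← h2]; ring
      neg_mem' := by
        rintro a ⟨e, he, d, hd, h1⟩
        exact ⟨e, he, -d, neg_mem hd, by push_cast; rw [← h1]; ring⟩ }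
  have hα : ∀ {f : A[X]} {F : K[X]} {f₁ : (locSub A n)[X]} {u : locSub A n} {i : Fin 2} {I : Ideal A},
      (∀ k, f.coeff k ∈ I) → (∀ k, (f.coeff k : K) = u * f₁.coeff k) →
      (∀ k, F.coeff k = f₁.coeff k) → ∀ m, ∃ a ∈ I, (u : K) * (F.toMvPolynomial i).coeff m = a := by
    intro f F f₁ u i I hf h1 h2 m
    by_cases hm : m = Finsupp.single i (m i)
    · refine ⟨f.coeff (m i), hf _, ?_⟩
      rw [hm, coeff_toMvPolynomial_single, h2, h1]
      simp
    · exact ⟨0, zero_mem _, by rw [coeff_toMvPolynomial_of_ne i F hm]; simp⟩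
  have hαs : ∀ i, (u * w : K) * (F.toMvPolynomial 0 * s).coeff i ∈ Cn := by
    intro i
    classical
    rw [MvPolynomial.coeff_mul, Finset.mul_sum]
    refine sum_mem fun k _ => ?_
    obtain ⟨a, ha, e⟩ := hα (i := 0) hfI (hcoef hf₁) hFc k.1
    refine ⟨es k.2, hes _, a * ds k.2, Ideal.mul_mem_mul (le_adjSub ha) (hds _), ?_⟩
    push_cast
    rw [← hs, ← e]; ring
  have hβt : ∀ i, (u * w : K) * (G.toMvPolynomial 1 * t).coeff i ∈ Cn := by
    intro i
    classical
    rw [MvPolynomial.coeff_mul, Finset.mul_sum]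
    refine sum_mem fun k _ => ?_
    obtain ⟨a, ha, e⟩ := hα (i := 1) hgJ (hcoef hg₁) hGc k.1
    refine ⟨et k.2, het _, dt k.2 * a, Ideal.mul_mem_mul (hdt _) (le_adjSub ha), ?_⟩
    push_cast
    rw [← ht, ← e]; ring
  -- Comparing the coefficients at one index where `H` has a unit expresses `r`, up to factors
  -- outside `n`, through products from `I·adj(J)` and `J·adj(I)`.
  obtain ⟨i, hi⟩ := hsol.h_unit
  have hmem : H.coeff i * r ∈ Cn := by
    have h1 := congrArg (MvPolynomial.coeff i) hsol.eq
    rw [mul_comm, MvPolynomial.coeff_C_mul, MvPolynomial.coeff_add] at h1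
    have h2 : H.coeff i * r = (u * w : K) * (F.toMvPolynomial 0 * s).coeff i +
        (u * w : K) * (G.toMvPolynomial 1 * t).coeff i := by
      rw [← mul_add, ← h1, hr₁']; ring
    rw [h2]
    exact Cn.add_mem (hαs i) (hβt i)
  obtain ⟨η₁, η₂, hη₂, hη⟩ := hsol.h_mem i
  have hη₁ : η₁ ∉ n := by
    intro hmem
    refine hi (mem_maxPow.2 ⟨⟨_, hsol.h_mem i⟩, ?_, rfl⟩)
    rw [pow_one]
    have h1 : (⟨_, hsol.h_mem i⟩ : locSub A n) * algebraMap A (locSub A n) η₂ = algebraMap A (locSub A n) η₁ := Subtype.ext (by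
      have := ne_zero_of_notMem hη₂
      push_cast
      rw [coe_algebraMap_locSub, coe_algebraMap_locSub, hη]; field_simp)
    have h2 : algebraMap A (locSub A n) η₁ ∈ maximalIdeal (locSub A n) := (algebraMap_mem_maximalIdeal_locSub A n).2 hmem
    rw [← h1] at h2
    exact ((inferInstance : (maximalIdeal (locSub A n)).IsPrime).mem_or_mem h2).resolve_right
      fun h3 => hη₂ ((algebraMap_mem_maximalIdeal_locSub A n).1 h3)
  obtain ⟨e, he, d, hd, hed⟩ := hmem
  refine ⟨e * η₁, fun h => (hn.isPrime.mem_or_mem h).elim he hη₁, ?_⟩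
  have : e * η₁ * r = η₂ * d := Subtype.ext (by
    have := ne_zero_of_notMem hη₂
    push_cast
    rw [← hed, hη]; field_simp)
  rw [this]
  exact Ideal.mul_mem_left _ _ hd

end Local

end AdjointIdeals

end

/-! ### From the local inclusions to the global one. -/

section

open IsLocalRing Polynomial

namespace AdjointIdeals

variable {K : Type*} [Field K]

section Global

variable {A : Subring K} [IsFractionRing A K] {I J : Ideal A}

/-- The trivial valuation, with valuation ring the whole field, already excludes every nonzero
element. -/
theorem adjSub_bot [IsNoetherianRing A] : adjSub A (⊥ : Ideal A) = ⊥ := by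
  rw [eq_bot_iff]
  intro r hr
  have hprin : (maximalIdeal (locSub A ⊥)).IsPrincipal := by
    rw [maximalIdeal_locSub, Ideal.map_bot]; infer_instance
  have hle : locSub A ⊥ ≤ (valOfPrincipal _ hprin).toSubring := le_rfl
  obtain ⟨a, ha, hra⟩ := hr (valOfPrincipal _ hprin) (isNoetherianRing_valOfPrincipal hprin)
    (EssFin.of_locSub hle (essFin_self le_rfl)) (le_locSub A ⊥) 1
    (by rw [← relJac_locSub_eq hle]; exact one_mem_relJac_valOfPrincipal hprin)
  rw [show ((1 : valOfPrincipal _ hprin) : K) = 1 from rfl, mul_one, (Submodule.mem_bot A).1 ha,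
    Subring.coe_zero, map_zero] at hra
  exact Subtype.ext ((Valuation.zero_iff _).1 (le_antisymm hra zero_le))

omit [IsFractionRing A K] in
theorem isRegularLocalRing_locSub [IsRegularRing A] {n : Ideal A} [n.IsPrime] :
    IsRegularLocalRing (locSub A n) :=
  IsRegularLocalRing.of_ringEquiv (IsLocalization.algEquiv n.primeCompl
    (Localization.AtPrime n) (locSub A n)).toRingEquiv

/-- The elements multiplying `r` into the product form an ideal, which lies in no maximal ideal by
the two local cases. -/
theorem adjSub_mul_le [IsRegularRing A] (hdim : ringKrullDim A ≤ 2) :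
    adjSub A (I * J) ≤ adjSub A I * adjSub A J := by
  by_cases hI : I = ⊥
  · rw [hI, Submodule.bot_mul, adjSub_bot]; exact bot_le
  by_cases hJ : J = ⊥
  · rw [hJ, Submodule.mul_bot, adjSub_bot]; exact bot_le
  intro r hr
  have key : ((adjSub A I * adjSub A J).colon {r} : Ideal A) = ⊤ := by
    by_contra hne
    obtain ⟨n, hn, hle⟩ := Ideal.exists_le_maximal _ hne
    have := isRegularLocalRing_locSub (A := A) (n := n)
    have hd : ringKrullDim (locSub A n) ≤ 2 := by
      rw [IsLocalization.AtPrime.ringKrullDim_eq_height n (locSub A n)]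
      exact (Ideal.height_le_ringKrullDim_of_ne_top hn.ne_top).trans hdim
    obtain ⟨e, he, h⟩ : ∃ e ∉ n, e * r ∈ adjSub A I * adjSub A J := by
      rcases isPrincipal_or_exists_regPair hd with hp | ⟨x, y, h⟩
      · exact exists_mul_mem_of_isPrincipal hp hr
      · exact exists_mul_mem_of_regPair h hI hJ hr
    exact he (hle (Submodule.mem_colon_singleton.2 h))
  have := Submodule.mem_colon_singleton.1 ((Ideal.eq_top_iff_one _).1 key)
  simpa using this

end Global

end AdjointIdeals

end

/-! ### Comparison of the two descriptions of the adjoint. -/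

section

open IsLocalRing Polynomial KaehlerDifferential

namespace AdjointIdeals

section Order

variable {W : Type*} [CommRing W] [IsLocalRing W] {𝔞 𝔟 𝔠 : Ideal W}

theorem order_bot : order W (⊥ : Ideal W) = ⊤ :=
  top_unique (ENat.forall_natCast_le_iff_le.1 fun _ _ => natCast_le_order_iff.2 bot_le)

theorem order_pow [IsDomain W] [IsNoetherianRing W] {n : ℕ} (hn : maximalIdeal W ^ n ≠ ⊥) :
    order W (maximalIdeal W ^ n) = n := by
  refine le_antisymm ?_ (natCast_le_order_iff.2 le_rfl)
  by_contra hlt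
  have h1 : ((n + 1 : ℕ) : ℕ∞) ≤ order W (maximalIdeal W ^ n) := by
    rw [Nat.cast_add, Nat.cast_one]
    exact Order.add_one_le_of_lt (not_le.1 hlt)
  refine hn (Submodule.eq_bot_of_le_smul_of_le_jacobson_bot (maximalIdeal W) _
    (IsNoetherian.noetherian _) ?_ (maximalIdeal_le_jacobson _))
  rw [smul_eq_mul, ← pow_succ']
  exact natCast_le_order_iff.1 h1

/-- Every nonzero ideal of `W` is a power of the maximal ideal, so orders and inclusions carry the
same information. Fields are covered as well, and zero ideals have order `⊤`. -/
theorem order_le_order_add_order_iff [IsDomain W] [IsNoetherianRing W]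
    (hW : (maximalIdeal W).IsPrincipal) :
    order W 𝔞 ≤ order W 𝔟 + order W 𝔠 ↔ 𝔟 * 𝔠 ≤ 𝔞 := by
  by_cases hb : 𝔟 = ⊥
  · simp [hb, order_bot]
  by_cases hc : 𝔠 = ⊥
  · simp [hc, order_bot]
  obtain ⟨j, rfl⟩ := exists_maximalIdeal_pow_eq_of_principal W hW 𝔟 hb
  obtain ⟨k, rfl⟩ := exists_maximalIdeal_pow_eq_of_principal W hW 𝔠 hc
  have hjk : maximalIdeal W ^ (j + k) ≠ ⊥ := by rw [pow_add]; exact mul_ne_zero hb hc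
  rw [order_pow hb, order_pow hc, ← pow_add, ← Nat.cast_add]
  by_cases ha : 𝔞 = ⊥
  · simp [ha, order_bot, hjk]
  obtain ⟨i, rfl⟩ := exists_maximalIdeal_pow_eq_of_principal W hW 𝔞 ha
  rw [order_pow ha]
  refine ⟨fun h => Ideal.pow_le_pow_right (by exact_mod_cast h), fun h => ?_⟩
  rw [← order_pow ha, ← order_pow hjk]
  exact order_anti h

end Order

section Jacobian

variable {K : Type*} [Field K] {R : Type*} [CommRing R] 

/-- By the first exact sequence, the differentials of `V` over `R` are those over `ℤ` modulo the
differentials coming from `R`. -/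
theorem jacobianIdeal_eq_relJac {V : ValuationSubring K} [Algebra R V] {A : Subring K}
    (hA : ∀ v : V, (v : K) ∈ A ↔ v ∈ (algebraMap R V).range) :
    jacobianIdeal R V = relJac V A := by
  have hker : LinearMap.ker (KaehlerDifferential.map ℤ R V V) = relSub V A := by
    rw [← range_mapBaseChange]
    refine le_antisymm ?_ (relSub_le fun v hv => ?_)
    · rintro _ ⟨w, rfl⟩
      induction w with
      | zero => simp
      | add a b ha hb => rw [map_add]; exact add_mem ha hb
      | tmul v w =>
        rw [mapBaseChange_tmul]
        refine Submodule.smul_mem _ _ ?_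
        have hw : w ∈ Submodule.span R (Set.range (D ℤ R)) := by
          rw [span_range_derivation]; trivial
        induction hw using Submodule.span_induction with
        | mem w hw =>
          obtain ⟨r, rfl⟩ := hw
          rw [map_D]
          exact D_mem_relSub ((hA _).2 ⟨r, rfl⟩)
        | zero => simp
        | add a b _ _ ha hb => rw [map_add]; exact add_mem ha hb
        | smul r a _ ha =>
          rw [LinearMap.map_smul, ← algebraMap_smul V r]
          exact Submodule.smul_mem _ _ ha
    · obtain ⟨r, rfl⟩ := (hA v).1 hv
      exact ⟨1 ⊗ₜ D ℤ R r, by simp⟩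
  have e := LinearMap.quotKerEquivOfSurjective _ (KaehlerDifferential.map_surjective ℤ R V)
  rw [hker] at e
  exact (fittingIdealZero_eq_of_linearEquiv e).symm

end Jacobian

section Transfer

variable {K : Type*} [Field K] {R : Type*} [CommRing R]

/-- The inequality of orders says that `r J_{V/R}` lies in `IV`, and in a valuation ring membership
in `IV` is decided by a single element of `I`. -/
theorem mem_valuativeIdeal_iff {V : ValuationSubring K} [IsNoetherianRing V] [Algebra R V] {A : Subring K}
    (hA : ∀ v : V, (v : K) ∈ A ↔ v ∈ (algebraMap R V).range) {I : Ideal R} {r : R} :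
    r ∈ valuativeIdeal V I ↔ ∀ j ∈ relJac V A, ∃ a ∈ I,
      V.valuation ((algebraMap R V r : K) * j) ≤ V.valuation (algebraMap R V a : K) := by
  have := isPrincipalIdealRing_of_isNoetherianRing (V := V)
  change order V _ ≤ order V _ + order V _ ↔ _
  rw [order_le_order_add_order_iff (IsPrincipalIdealRing.principal _), jacobianIdeal_eq_relJac hA]
  have hmem : ∀ v : V, v ∈ I.map (algebraMap R V) ↔
      ∃ a ∈ I, V.valuation (v : K) ≤ V.valuation (algebraMap R V a : K) := by
    intro v
    constructor
    · intro hv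
      induction hv using Submodule.span_induction with
      | mem v hv => obtain ⟨a, ha, rfl⟩ := hv; exact ⟨a, ha, le_rfl⟩
      | zero => exact ⟨0, zero_mem _, by simp⟩
      | add u v _ _ hu hv =>
        obtain ⟨a, ha, hua⟩ := hu
        obtain ⟨b, hb, hvb⟩ := hv
        rcases le_max_iff.1 ((V.valuation.map_add (u : K) v).trans (max_le_max hua hvb)) with h | h
        exacts [⟨a, ha, h⟩, ⟨b, hb, h⟩]
      | smul c v _ hv =>
        obtain ⟨a, ha, h⟩ := hv
        refine ⟨a, ha, le_trans ?_ h⟩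
        change V.valuation ((c : K) * v) ≤ _
        rw [map_mul]
        exact mul_le_of_le_one_left' ((V.valuation_le_one_iff _).2 c.2)
    · rintro ⟨a, ha, h⟩
      obtain ⟨c, hc⟩ := (V.valuation_le_iff _ _).1 h
      rw [show v = c * algebraMap R V a from Subtype.ext hc.symm]
      exact Ideal.mul_mem_left _ _ (Ideal.mem_map_of_mem _ ha)
  rw [Ideal.span_singleton_mul_le_iff]
  exact forall₂_congr fun j _ => hmem _

theorem essFin_iff_essFiniteType {V : ValuationSubring K} [Algebra R V] {A : Subring K}
    (hAV : A ≤ V.toSubring) (hA : ∀ v : V, (v : K) ∈ A ↔ v ∈ (algebraMap R V).range) :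
    EssFin A V ↔ Algebra.EssFiniteType R V := by
  classical
  rw [Algebra.essFiniteType_iff]
  constructor
  · rintro ⟨F, hF, hV⟩
    have hcl : ∀ w ∈ Subring.closure (A ∪ F : Set K), ∃ v ∈ Algebra.adjoin R
        ((F.subtype (· ∈ V) : Finset V) : Set V), (v : K) = w := by
      intro w hw
      suffices Subring.closure (A ∪ F : Set K) ≤ (Algebra.adjoin R
        ((F.subtype (· ∈ V) : Finset V) : Set V)).toSubring.map V.subtype from this hw
      refine Subring.closure_le.2 (Set.union_subset (fun a ha => ?_) fun f hf => ?_)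
      · obtain ⟨r, hr⟩ := (hA ⟨a, hAV ha⟩).1 ha
        exact ⟨⟨a, hAV ha⟩, hr ▸ Subalgebra.algebraMap_mem _ r, rfl⟩
      · exact ⟨⟨f, hF f hf⟩, Algebra.subset_adjoin (by simpa using hf), rfl⟩
    refine ⟨F.subtype (· ∈ V), fun v => ?_⟩
    obtain ⟨g, hg, h, hh, hv, e⟩ := hV v v.2
    obtain ⟨g, hg', rfl⟩ := hcl g hg
    obtain ⟨h, hh', rfl⟩ := hcl h hh
    refine ⟨h, hh', (V.valuation_eq_one_iff h).2 hv, ?_⟩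
    have h0 : (h : K) ≠ 0 := fun e => by simp [e] at hv
    rwa [show v * h = g from Subtype.ext (by
      change (v : K) * h = g
      rw [e, div_mul_cancel₀ _ h0])]
  · rintro ⟨σ, hσ⟩
    have hcl : ∀ w ∈ Algebra.adjoin R (σ : Set V),
        (w : K) ∈ Subring.closure (A ∪ (σ.image (↑) : Finset K) : Set K) := by
      intro w hw
      induction hw using Algebra.adjoin_induction with
      | mem w hw => exact Subring.subset_closure (Or.inr (by simpa using hw))
      | algebraMap r => exact Subring.subset_closure (Or.inl ((hA _).2 ⟨r, rfl⟩))
      | add a b _ _ ha hb => exact add_mem ha hb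
      | mul a b _ _ ha hb => exact mul_mem ha hb
    refine ⟨σ.image (↑), fun f hf => ?_, fun v hv => ?_⟩
    · obtain ⟨w, -, rfl⟩ := Finset.mem_image.1 hf
      exact w.2
    · obtain ⟨t, ht, hu, hvt⟩ := hσ ⟨v, hv⟩
      have ht1 := (V.valuation_eq_one_iff t).1 hu
      have h0 : (t : K) ≠ 0 := fun e => by simp [e] at ht1
      exact ⟨_, hcl _ hvt, _, hcl _ ht, ht1, (eq_div_iff h0).2 rfl⟩

variable [Algebra R K] [IsDomain R] [IsFractionRing R K]

theorem mem_or_inv_mem_of_valuationRing (V : Subalgebra R K) [ValuationRing V] (x : K) :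
    x ∈ V.toSubring ∨ x⁻¹ ∈ V.toSubring := by
  obtain ⟨a, b, hb, rfl⟩ := IsFractionRing.div_surjective R x
  have hinj := IsFractionRing.injective R K
  have hb0 : algebraMap R K b ≠ 0 := fun e =>
    nonZeroDivisors.ne_zero hb (hinj (e.trans (map_zero _).symm))
  by_cases ha0 : algebraMap R K a = 0
  · left; rw [ha0, zero_div]; exact zero_mem _
  obtain ⟨c, hc | hc⟩ := ValuationRing.cond (algebraMap R V a) (algebraMap R V b)
  · right
    have : algebraMap R K a * c = algebraMap R K b := congrArg Subtype.val hc
    rw [inv_div, ← this, mul_div_cancel_left₀ _ ha0]; exact c.2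
  · left
    have : algebraMap R K b * c = algebraMap R K a := congrArg Subtype.val hc
    rw [← this, mul_div_cancel_left₀ _ hb0]; exact c.2

/-- A domain, as a subring of its field of fractions. -/
noncomputable def rangeEquiv (R K : Type*) [CommRing R] [IsDomain R] [Field K] [Algebra R K]
    [IsFractionRing R K] : R ≃+* (algebraMap R K).range :=
  RingEquiv.ofBijective (algebraMap R K).rangeRestrict
    ⟨fun _ _ h => IsFractionRing.injective R K (congrArg Subtype.val h),
      (algebraMap R K).rangeRestrict_surjective⟩

theorem mem_adj_iff [IsNoetherianRing R] {I : Ideal R} {r : R} :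
    r ∈ adj K I ↔ rangeEquiv R K r ∈ adjSub _ (I.map (rangeEquiv R K)) := by
  have hI : ∀ (V : ValuationSubring K) (c : K),
      (∃ a ∈ I.map (rangeEquiv R K), V.valuation c ≤ V.valuation (a : K)) ↔
        ∃ a ∈ I, V.valuation c ≤ V.valuation (algebraMap R K a) := by
    intro V c
    constructor
    · rintro ⟨_, ha, h⟩
      obtain ⟨a, ha', rfl⟩ := (Ideal.mem_map_of_equiv _ _).1 ha
      exact ⟨a, ha', h⟩
    · rintro ⟨a, ha, h⟩
      exact ⟨_, Ideal.mem_map_of_mem (rangeEquiv R K) ha, h⟩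
  have hsub : ∀ (V : Subalgebra R K) (v : V), (v : K) ∈ (algebraMap R K).range ↔
      v ∈ (algebraMap R V).range := fun V v =>
    ⟨fun ⟨r, hr⟩ => ⟨r, Subtype.ext hr⟩, fun ⟨r, hr⟩ => ⟨r, congrArg Subtype.val hr⟩⟩
  constructor
  · intro hr W hN hE hAW
    let V : Subalgebra R K :=
      { W.toSubring with algebraMap_mem' := fun r => hAW ⟨r, rfl⟩ }
    have hV : ValuationRing V := inferInstanceAs (ValuationRing W)
    let : Algebra R W := V.algebra
    have hEV : Algebra.EssFiniteType R V := (essFin_iff_essFiniteType hAW (hsub V)).1 hE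
    have hrV : r ∈ valuativeIdeal V I := by
      simp only [adj, Ideal.mem_iInf] at hr
      exact hr V hV hEV
    exact fun j hj => (hI W _).2 ((mem_valuativeIdeal_iff (V := W) (hsub V)).1 hrV j hj)
  · intro hr
    simp only [adj, Ideal.mem_iInf]
    intro V hV hE
    let W := ValuationSubring.ofSubring V.toSubring (mem_or_inv_mem_of_valuationRing V)
    let : Algebra R W := V.algebra
    -- Essential finiteness over the Noetherian ring `R` supplies the Noetherian condition that is
    -- explicit in `adjSub`.
    have hN : IsNoetherianRing W := Algebra.EssFiniteType.isNoetherianRing R V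
    have hAW : (algebraMap R K).range ≤ W.toSubring := by
      rintro _ ⟨r, rfl⟩; exact V.algebraMap_mem r
    have hEW : EssFin (algebraMap R K).range W := (essFin_iff_essFiniteType hAW (hsub V)).2 hE
    exact (mem_valuativeIdeal_iff (V := W) (hsub V)).2 fun j hj =>
      (hI W _).1 (hr W hN hEW hAW j hj)

end Transfer

end AdjointIdeals

end

theorem mainTheorem6 {R : Type*} [CommRing R] [IsDomain R] [IsRegularRing R]
    (hdim : ringKrullDim R = 2)
    (K : Type*) [Field K] [Algebra R K] [IsFractionRing R K]
    (I J : Ideal R) :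
    AdjointIdeals.adj K (I * J) ≤ AdjointIdeals.adj K I * AdjointIdeals.adj K J := by
  let ρ := AdjointIdeals.rangeEquiv R K
  have : IsRegularRing (algebraMap R K).range := .of_ringEquiv ρ
  have : IsFractionRing (algebraMap R K).range K := by
    refine IsFractionRing.of_field _ _ fun z => ?_
    obtain ⟨a, b, -, e⟩ := IsFractionRing.div_surjective R z
    exact ⟨ρ a, ρ b, e.symm⟩
  have hadj : ∀ I : Ideal R, (AdjointIdeals.adj K I).map ρ = AdjointIdeals.adjSub _ (I.map ρ) := by
    intro I
    ext c
    rw [Ideal.mem_map_of_equiv]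
    constructor
    · rintro ⟨r, hr, rfl⟩
      exact AdjointIdeals.mem_adj_iff.1 hr
    · intro hc
      obtain ⟨r, rfl⟩ := ρ.surjective c
      exact ⟨r, AdjointIdeals.mem_adj_iff.2 hc, rfl⟩
  intro r hr
  have h := AdjointIdeals.adjSub_mul_le ((ringKrullDim_eq_of_ringEquiv ρ).symm.trans hdim).le
    ((Ideal.map_mul ρ I J) ▸ AdjointIdeals.mem_adj_iff.1 hr)
  rw [← hadj, ← hadj, ← Ideal.map_mul, Ideal.mem_map_of_equiv] at h
  obtain ⟨s, hs, e⟩ := h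
  rwa [← ρ.injective e]
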